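/- **Theorem.** For an integer $k\ge 0$, let $aa(k)bb$ be the ordered graph with vertices $1,\dots,k+4$ in their natural order and exactly the two edges $\{1,2\}$ and $\{k+3,k+4\}$ (so the $k$ vertices between them are isolated). An ordered graph (a finite simple graph with a fixed linear order of its vertices) is *$aa(k)bb$-free* if it contains no induced subgraph isomorphic to $aa(k)bb$ through an order-preserving isomorphism. In the problem *Maximum Weight Independent Set* (MWIS) one is given a graph $G$ and weights $\mathfrak w\colon V(G)\to\mathbb{Q}_{>0}$, and asks for an independent set of $G$ of maximum total weight. For every fixed $k\ge 0$, MWIS in $n$-vertex $aa(k)bb$-free ordered graphs can be solved in time $n^{\mathcal{O}(\log^2 n)}$. That is, for every $k$ there are a program $P$ and a constant $C$ such that, for every $aa(k)bb$-free ordered graph $G$ on $n$ vertices and all weights $\mathfrak w\colon V(G)\to\mathbb{Q}_{>0}$, the program $P$ started on $(G,\mathfrak w)$ halts after at most $N^{C(\log_2 N)^2}$ elementary operations, where $N=\max\{n,2\}$, and outputs an independent set of $G$ of maximum weight. Here programs are those of a random access machine with unit-cost addition, subtraction and comparison of integers (no multiplication), and with separate memory cells for weights, on which additions, subtractions and comparisons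 take constant time; the graph is given by $n$ and its adjacency matrix, with the vertices numbered in their order. -/

import Mathlib

/-! ### Ordered graphs

An ordered graph is a simple graph on a linearly ordered vertex set; an `n`-vertex ordered graph is,
up to a unique order isomorphism, a simple graph on `Fin n` with its natural order. -/

/-- `G` has no induced subgraph that is isomorphic to `H` through an order-preserving map. -/
def OrderedFree {U V : Type*} [LinearOrder U] [LinearOrder V]
    (H : SimpleGraph U) (G : SimpleGraph V) : Prop :=
  ¬ ∃ f : H ↪g G, StrictMono f

/-- The ordered graph `aa(k)bb`: its vertices, in this order, are two vertices joined by an edge,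
then `k` isolated vertices, then two vertices joined by an edge. -/
def aakbb (k : ℕ) : SimpleGraph (Fin (k + 4)) :=
  SimpleGraph.fromEdgeSet
    {s(⟨0, by omega⟩, ⟨1, by omega⟩), s(⟨k + 2, by omega⟩, ⟨k + 3, by omega⟩)}

/-- `S` is an independent set of `G` of maximum total weight with respect to `w`. -/
def IsMaxWeightIndepSet {V : Type*} (G : SimpleGraph V) (w : V → ℚ) (S : Finset V) : Prop :=
  G.IsIndepSet (S : Set V) ∧
    ∀ T : Finset V, G.IsIndepSet (T : Set V) → ∑ v ∈ T, w v ≤ ∑ v ∈ S, w v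

/-! ### A random access machine with weights

A unit-cost random access machine with structured control flow. Its memory consists of variables and
arrays (random access memories) of two kinds of cells: integer cells, which hold natural numbers, and
weight cells, which hold rational numbers. A program mentions finitely many variables and arrays.
On integers the machine adds, subtracts (truncated at `0`) and compares; there is no unit-cost
multiplication, so `t` steps cannot build numbers of more than `O(t)` bits beyond the input size.
Weights can be copied, added, subtracted and compared, each in one step, and there is no other way
to access them; in particular their bits cannot be read. -/
namespace RAM

/-- The contents of the memory. -/
structure State where
  var : ℕ → ℕ
  arr : ℕ → ℕ → ℕ
  wvar : ℕ → ℚ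
  warr : ℕ → ℕ → ℚ

/-- Integer expressions: constants, variables, array cells, sums, truncated differences. -/
inductive Expr where
  | const (c : ℕ)
  | var (x : ℕ)
  | get (a : ℕ) (i : Expr)
  | add (e f : Expr)
  | sub (e f : Expr)

/-- The value of an integer expression. -/
def Expr.eval (s : State) : Expr → ℕ
  | .const c => c
  | .var x => s.var x
  | .get a i => s.arr a (i.eval s)
  | .add e f => e.eval s + f.eval s
  | .sub e f => e.eval s - f.eval s

/-- The number of elementary operations that evaluate an integer expression. -/
def Expr.cost : Expr → ℕ
  | .const _ => 1
  | .var _ => 1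
  | .get _ i => i.cost + 1
  | .add e f => e.cost + f.cost + 1
  | .sub e f => e.cost + f.cost + 1

/-- Weight expressions: zero, variables, array cells, sums, differences. -/
inductive WExpr where
  | zero
  | var (x : ℕ)
  | get (a : ℕ) (i : Expr)
  | add (e f : WExpr)
  | sub (e f : WExpr)

/-- The value of a weight expression. -/
def WExpr.eval (s : State) : WExpr → ℚ
  | .zero => 0
  | .var x => s.wvar x
  | .get a i => s.warr a (i.eval s)
  | .add e f => e.eval s + f.eval s
  | .sub e f => e.eval s - f.eval s

/-- The number of elementary operations that evaluate a weight expression. -/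
def WExpr.cost : WExpr → ℕ
  | .zero => 1
  | .var _ => 1
  | .get _ i => i.cost + 1
  | .add e f => e.cost + f.cost + 1
  | .sub e f => e.cost + f.cost + 1

/-- Tests: comparisons of integers and of weights, negation and conjunction. -/
inductive Test where
  | le (e f : Expr)
  | wle (e f : WExpr)
  | not (b : Test)
  | and (b c : Test)

/-- The truth value of a test. -/
def Test.Holds (s : State) : Test → Prop
  | .le e f => e.eval s ≤ f.eval s
  | .wle e f => e.eval s ≤ f.eval s
  | .not b => ¬ b.Holds s
  | .and b c => b.Holds s ∧ c.Holds s

/-- The number of elementary operations that evaluate a test. -/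
def Test.cost : Test → ℕ
  | .le e f => e.cost + f.cost + 1
  | .wle e f => e.cost + f.cost + 1
  | .not b => b.cost + 1
  | .and b c => b.cost + c.cost + 1

/-- Programs. -/
inductive Program where
  | nop
  | assign (x : ℕ) (e : Expr)
  | store (a : ℕ) (i e : Expr)
  | wassign (x : ℕ) (e : WExpr)
  | wstore (a : ℕ) (i : Expr) (e : WExpr)
  | seq (p q : Program)
  | cond (b : Test) (p q : Program)
  | loop (b : Test) (p : Program)

/-- `Exec p s t s'`: started in the memory `s`, the program `p` halts after exactly `t` elementary
operations, and the memory is then `s'`. Here `cond b p q` is "if `b` then `p` else `q`" and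
`loop b p` is "while `b` do `p`". -/
inductive Exec : Program → State → ℕ → State → Prop where
  | nop (s : State) : Exec .nop s 1 s
  | assign (s : State) (x : ℕ) (e : Expr) :
      Exec (.assign x e) s (e.cost + 1)
        { s with var := Function.update s.var x (e.eval s) }
  | store (s : State) (a : ℕ) (i e : Expr) :
      Exec (.store a i e) s (i.cost + e.cost + 1)
        { s with arr := Function.update s.arr a
                    (Function.update (s.arr a) (i.eval s) (e.eval s)) }
  | wassign (s : State) (x : ℕ) (e : WExpr) :
      Exec (.wassign x e) s (e.cost + 1)
        { s with wvar := Function.update s.wvar x (e.eval s) }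
  | wstore (s : State) (a : ℕ) (i : Expr) (e : WExpr) :
      Exec (.wstore a i e) s (i.cost + e.cost + 1)
        { s with warr := Function.update s.warr a
                    (Function.update (s.warr a) (i.eval s) (e.eval s)) }
  | seq {p q : Program} {s s' s'' : State} {t t' : ℕ} :
      Exec p s t s' → Exec q s' t' s'' → Exec (.seq p q) s (t + t') s''
  | cond_true {b : Test} {p q : Program} {s s' : State} {t : ℕ} :
      b.Holds s → Exec p s t s' → Exec (.cond b p q) s (b.cost + t + 1) s'
  | cond_false {b : Test} {p q : Program} {s s' : State} {t : ℕ} :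
      ¬ b.Holds s → Exec q s t s' → Exec (.cond b p q) s (b.cost + t + 1) s'
  | loop_true {b : Test} {p : Program} {s s' s'' : State} {t t' : ℕ} :
      b.Holds s → Exec p s t s' → Exec (.loop b p) s' t' s'' →
        Exec (.loop b p) s (b.cost + t + t' + 1) s''
  | loop_false {b : Test} {p : Program} {s : State} :
      ¬ b.Holds s → Exec (.loop b p) s (b.cost + 1) s

open Classical in
/-- The memory that holds the weighted ordered graph `(G, w)` on the vertices `0, …, n - 1`:
variable `0` holds `n`, array `0` holds the adjacency matrix, row by row (the entry of `(i, j)` is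
in cell `i * n + j`), and weight array `0` holds the weights. All other cells hold `0`. -/
noncomputable def inputState (n : ℕ) (G : SimpleGraph (Fin n)) (w : Fin n → ℚ) : State where
  var x := if x = 0 then n else 0
  arr a c := if a = 0 ∧ ∃ i j : Fin n, G.Adj i j ∧ c = (i : ℕ) * n + (j : ℕ) then 1 else 0
  wvar _ := 0
  warr a c := if h : a = 0 ∧ c < n then w ⟨c, h.2⟩ else 0

open Classical in
/-- Array `1` of the memory `s` holds the characteristic vector of the vertex set `S`. -/
def IsOutput {n : ℕ} (s : State) (S : Finset (Fin n)) : Prop :=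
  ∀ v : Fin n, s.arr 1 v = if v ∈ S then 1 else 0

end RAM

/-- The program `p` solves Maximum Weight Independent Set (with positive rational weights) in the
class `𝒢` of ordered graphs, in time at most `T n` on `n`-vertex graphs: on every instance it halts
after at most `T n` operations and outputs an independent set of maximum weight. -/
def SolvesMWISInTime (p : RAM.Program) (𝒢 : (n : ℕ) → SimpleGraph (Fin n) → Prop)
    (T : ℕ → ℝ) : Prop :=
  ∀ (n : ℕ) (G : SimpleGraph (Fin n)) (w : Fin n → ℚ), 𝒢 n G → (∀ v, 0 < w v) →
    ∃ (t : ℕ) (s : RAM.State) (S : Finset (Fin n)),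
      RAM.Exec p (RAM.inputState n G w) t s ∧ (t : ℝ) ≤ T n ∧
        RAM.IsOutput s S ∧ IsMaxWeightIndepSet G w S

/-! A weak chain consists of an edge, `k` vertices and an edge, in weakly increasing order; inner
vertices may coincide. Given `k + 2` weak chains, no two of which share a vertex or are joined by an
edge, a greedy ordering allows taking the first edge of one chain, one middle vertex of each of `k`
others, and the last edge of the remaining one, so that the result is an induced `aa(k)bb`
(`card_le_of_pairwise_not_touch`). Hence in an `aa(k)bb`-free graph a maximum family of pairwise
non-touching weak chains has at most `k + 1` members. The closed neighbourhoods of its at most `c =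
(k + 1)(k + 4)` vertices meet all weak chains, so one of them meets at least a fraction `1 / c` of
the chains (`exists_heavy`).

This suggests branching: while a chain is left, pick such a heavy vertex and either choose it and
delete its closed neighbourhood, or discard it. Along the branch that follows a fixed independent
set, every choice multiplies the number of chains, at most `n ^ (k + 4)` initially, by at most `1 -
1 / c`. So only `O(log n)` vertices are chosen (`card_branch_le`), however many are discarded. The
chosen vertices determine the branch (`branch_eq_of_chosen`). Instead of recursing, the program
therefore runs through all sets of at most `L = O(log n)` vertices, coded by the numbers below `(n +
1) ^ L` (`exists_branch_code`). This costs only `n ^ O(log n)`, which is within the required bound.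

At the end of a branch no weak chain is left, and then the remaining graph is bipartite, with sides
split at the least right end of an edge (`IsSplit.adj`). There a maximum weight independent set is
read off from a final preflow of the push-relabel method (`cutSet_isMax`), which only adds,
subtracts and compares weights and takes polynomially many operations.

The rest is implementation. All programs use counted loops, whose running time is polynomial in the
loop bounds (`exists_time_le`), and all bounds are at most `(n + 2) ^ L`. -/

namespace RAM

/-! ### Counted loops

Programs whose only loops are counted loops with fixed bounds. They are total, so that their effect
is a function on memories, and their running time can be read off from their syntax. -/

/-- Programs with counted loops: `for_ x y p` runs `p` for `x = 0, …, y - 1`. -/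
inductive FProg where
  | nop
  | assign (x : ℕ) (e : Expr)
  | store (a : ℕ) (i e : Expr)
  | wassign (x : ℕ) (e : WExpr)
  | wstore (a : ℕ) (i : Expr) (e : WExpr)
  | seq (p q : FProg)
  | cond (b : Test) (p q : FProg)
  | for_ (x y : ℕ) (p : FProg)

namespace State

/-- Set an integer variable. -/
def setVar (s : State) (x v : ℕ) : State := { s with var := Function.update s.var x v }

/-- Set an integer array cell. -/
def setArr (s : State) (a i v : ℕ) : State :=
  { s with arr := Function.update s.arr a (Function.update (s.arr a) i v) }

/-- Set a weight variable. -/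
def setWVar (s : State) (x : ℕ) (v : ℚ) : State := { s with wvar := Function.update s.wvar x v }

/-- Set a weight array cell. -/
def setWArr (s : State) (a i : ℕ) (v : ℚ) : State :=
  { s with warr := Function.update s.warr a (Function.update (s.warr a) i v) }

variable (s : State) (a b i j x y v : ℕ) (q : ℚ)

@[simp] theorem setVar_var : (s.setVar x v).var y = if y = x then v else s.var y := by
  simp [setVar, Function.update_apply]
@[simp] theorem setVar_arr : (s.setVar x v).arr = s.arr := rfl
@[simp] theorem setVar_wvar : (s.setVar x v).wvar = s.wvar := rfl
@[simp] theorem setVar_warr : (s.setVar x v).warr = s.warr := rfl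
@[simp] theorem setArr_var : (s.setArr a i v).var = s.var := rfl
theorem setArr_arr : (s.setArr a i v).arr b = if b = a then Function.update (s.arr a) i v
    else s.arr b := by
  by_cases h : b = a <;> simp [setArr, h]
@[simp] theorem setArr_arr_apply : (s.setArr a i v).arr b j =
    if b = a ∧ j = i then v else s.arr b j := by
  by_cases h : b = a
  · subst h; simp [setArr, Function.update_apply]
  · simp [setArr, h]
@[simp] theorem setArr_warr : (s.setArr a i v).warr = s.warr := rfl
@[simp] theorem setWVar_var : (s.setWVar x q).var = s.var := rfl
@[simp] theorem setWVar_arr : (s.setWVar x q).arr = s.arr := rfl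
@[simp] theorem setWVar_wvar : (s.setWVar x q).wvar y = if y = x then q else s.wvar y := by
  simp [setWVar, Function.update_apply]
@[simp] theorem setWVar_warr : (s.setWVar x q).warr = s.warr := rfl
@[simp] theorem setWArr_var : (s.setWArr a i q).var = s.var := rfl
@[simp] theorem setWArr_arr : (s.setWArr a i q).arr = s.arr := rfl
@[simp] theorem setWArr_wvar : (s.setWArr a i q).wvar = s.wvar := rfl
theorem setWArr_warr : (s.setWArr a i q).warr b = if b = a then Function.update (s.warr a) i q
    else s.warr b := by
  by_cases h : b = a <;> simp [setWArr, h]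
@[simp] theorem setWArr_warr_apply : (s.setWArr a i q).warr b j =
    if b = a ∧ j = i then q else s.warr b j := by
  by_cases h : b = a
  · subst h; simp [setWArr, Function.update_apply]
  · simp [setWArr, h]

end State

attribute [simp] Expr.eval WExpr.eval Test.Holds

namespace FProg

open Classical in
/-- The effect of a program on the memory. -/
noncomputable def run : FProg → State → State
  | nop, s => s
  | assign x e, s => s.setVar x (e.eval s)
  | store a i e, s => s.setArr a (i.eval s) (e.eval s)
  | wassign x e, s => s.setWVar x (e.eval s)
  | wstore a i e, s => s.setWArr a (i.eval s) (e.eval s)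
  | seq p q, s => run q (run p s)
  | cond b p q, s => if b.Holds s then run p s else run q s
  | for_ x y p, s =>
      (fun r => (run p r).setVar x ((run p r).var x + 1))^[s.var y] (s.setVar x 0)

theorem run_seq (p q : FProg) (s : State) : run (seq p q) s = run q (run p s) := rfl

theorem run_cond_pos {b : Test} {s : State} (h : b.Holds s) (p q : FProg) :
    run (cond b p q) s = run p s := if_pos h

theorem run_cond_neg {b : Test} {s : State} (h : ¬ b.Holds s) (p q : FProg) :
    run (cond b p q) s = run q s := if_neg h

/-- `p` does not write the integer variable `z`. -/
@[simp] def KeepsVar (z : ℕ) : FProg → Prop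
  | nop => True
  | assign x _ => z ≠ x
  | store _ _ _ => True
  | wassign _ _ => True
  | wstore _ _ _ => True
  | seq p q => p.KeepsVar z ∧ q.KeepsVar z
  | cond _ p q => p.KeepsVar z ∧ q.KeepsVar z
  | for_ x _ p => z ≠ x ∧ p.KeepsVar z

/-- `p` does not write the integer array `z`. -/
@[simp] def KeepsArr (z : ℕ) : FProg → Prop
  | nop => True
  | assign _ _ => True
  | store a _ _ => z ≠ a
  | wassign _ _ => True
  | wstore _ _ _ => True
  | seq p q => p.KeepsArr z ∧ q.KeepsArr z
  | cond _ p q => p.KeepsArr z ∧ q.KeepsArr z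
  | for_ _ _ p => p.KeepsArr z

/-- `p` does not write the weight variable `z`. -/
@[simp] def KeepsWVar (z : ℕ) : FProg → Prop
  | nop => True
  | assign _ _ => True
  | store _ _ _ => True
  | wassign x _ => z ≠ x
  | wstore _ _ _ => True
  | seq p q => p.KeepsWVar z ∧ q.KeepsWVar z
  | cond _ p q => p.KeepsWVar z ∧ q.KeepsWVar z
  | for_ _ _ p => p.KeepsWVar z

/-- `p` does not write the weight array `z`. -/
@[simp] def KeepsWArr (z : ℕ) : FProg → Prop
  | nop => True
  | assign _ _ => True
  | store _ _ _ => True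
  | wassign _ _ => True
  | wstore a _ _ => z ≠ a
  | seq p q => p.KeepsWArr z ∧ q.KeepsWArr z
  | cond _ p q => p.KeepsWArr z ∧ q.KeepsWArr z
  | for_ _ _ p => p.KeepsWArr z

/-- The memories `s` and `s'` agree on everything that `p` does not write. -/
structure Frame (p : FProg) (s s' : State) : Prop where
  var : ∀ z, p.KeepsVar z → s'.var z = s.var z
  arr : ∀ z, p.KeepsArr z → s'.arr z = s.arr z
  wvar : ∀ z, p.KeepsWVar z → s'.wvar z = s.wvar z
  warr : ∀ z, p.KeepsWArr z → s'.warr z = s.warr z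

/-- What a program leaves alone is read off from its syntax, so that later proofs settle all claims
of the kind "this cell is unchanged" by `simp`. -/
theorem frame_run (p : FProg) (s : State) : Frame p s (run p s) := by
  induction p generalizing s with
  | nop => exact ⟨fun _ _ => rfl, fun _ _ => rfl, fun _ _ => rfl, fun _ _ => rfl⟩
  | assign x e => exact ⟨fun z h => by simp_all [run], fun _ _ => rfl, fun _ _ => rfl, fun _ _ => rfl⟩
  | store a i e =>
    exact ⟨fun _ _ => rfl, fun z h => by simp_all [run, State.setArr_arr], fun _ _ => rfl,
      fun _ _ => rfl⟩
  | wassign x e =>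
    exact ⟨fun _ _ => rfl, fun _ _ => rfl, fun z h => by simp_all [run], fun _ _ => rfl⟩
  | wstore a i e =>
    exact ⟨fun _ _ => rfl, fun _ _ => rfl, fun _ _ => rfl,
      fun z h => by simp_all [run, State.setWArr_warr]⟩
  | seq p q hp hq =>
    exact ⟨fun z h => ((hq _).var z h.2).trans ((hp s).var z h.1),
      fun z h => ((hq _).arr z h.2).trans ((hp s).arr z h.1),
      fun z h => ((hq _).wvar z h.2).trans ((hp s).wvar z h.1),
      fun z h => ((hq _).warr z h.2).trans ((hp s).warr z h.1)⟩
  | cond b p q hp hq =>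
    by_cases hb : b.Holds s
    · simp only [run, hb, if_true]
      exact ⟨fun z h => (hp s).var z h.1, fun z h => (hp s).arr z h.1,
        fun z h => (hp s).wvar z h.1, fun z h => (hp s).warr z h.1⟩
    · simp only [run, hb, if_false]
      exact ⟨fun z h => (hq s).var z h.2, fun z h => (hq s).arr z h.2,
        fun z h => (hq s).wvar z h.2, fun z h => (hq s).warr z h.2⟩
  | for_ x y p hp =>
    simp only [run]
    generalize s.var y = N
    induction N with
    | zero =>
      exact ⟨fun z h => by simp_all, fun _ _ => rfl, fun _ _ => rfl, fun _ _ => rfl⟩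
    | succ N ih =>
      rw [Function.iterate_succ_apply']
      set r := (fun r => (run p r).setVar x ((run p r).var x + 1))^[N] (s.setVar x 0)
      exact ⟨fun z h => by
          have h' : z ≠ x ∧ p.KeepsVar z := h
          simp [h'.1, (hp r).var z h'.2, ih.var z h],
        fun z h => by simp [(hp r).arr z h, ih.arr z h],
        fun z h => by simp [(hp r).wvar z h, ih.wvar z h],
        fun z h => by simp [(hp r).warr z h, ih.warr z h]⟩

/-- The invariant rule for counted loops. -/
theorem run_for {x y : ℕ} {p : FProg} {s : State} (hx : p.KeepsVar x)
    (Inv : ℕ → State → Prop) (h0 : Inv 0 (s.setVar x 0))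
    (hs : ∀ i r, i < s.var y → r.var x = i → Frame (for_ x y p) s r → Inv i r →
      Inv (i + 1) ((run p r).setVar x (i + 1))) :
    Inv (s.var y) (run (for_ x y p) s) := by
  simp only [run]
  -- The counter value and the frame are carried along with the invariant, since the step hypothesis
  -- may use both.
  suffices H : ∀ N ≤ s.var y,
      let r := (fun r => (run p r).setVar x ((run p r).var x + 1))^[N] (s.setVar x 0)
      r.var x = N ∧ Frame (for_ x y p) s r ∧ Inv N r from (H _ le_rfl).2.2
  intro N
  induction N with
  | zero =>
    intro _
    exact ⟨by simp, ⟨fun z h => by simp_all, fun _ _ => rfl, fun _ _ => rfl, fun _ _ => rfl⟩, h0⟩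
  | succ N ih =>
    intro hN
    obtain ⟨h1, h2, h3⟩ := ih (by omega)
    simp only [Function.iterate_succ_apply']
    set r := (fun r => (run p r).setVar x ((run p r).var x + 1))^[N] (s.setVar x 0)
    have hv : (run p r).var x = N := by rw [(frame_run p r).var x hx, h1]
    rw [hv]
    refine ⟨by simp, ?_, hs N r (by omega) h1 h2 h3⟩
    have hp := frame_run p r
    exact ⟨fun z h => by
        have h' : z ≠ x ∧ p.KeepsVar z := h
        simp [h'.1, hp.var z h'.2, h2.var z h],
      fun z h => by simp [hp.arr z h, h2.arr z h],
      fun z h => by simp [hp.wvar z h, h2.wvar z h],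
      fun z h => by simp [hp.warr z h, h2.warr z h]⟩

/-! ### Translation of counted loops and their running time -/

/-- Translation into random access machine programs. -/
def compile : FProg → Program
  | nop => .nop
  | assign x e => .assign x e
  | store a i e => .store a i e
  | wassign x e => .wassign x e
  | wstore a i e => .wstore a i e
  | seq p q => .seq p.compile q.compile
  | cond b p q => .cond b p.compile q.compile
  | for_ x y p => .seq (.assign x (.const 0)) (.loop (.not (.le (.var y) (.var x)))
      (.seq p.compile (.assign x (.add (.var x) (.const 1)))))

/-- All loop bounds of `p` are among the variables in `B`, and `p` writes no variable in `B`;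
loop variables are written by their loops only. -/
def Counted (B : Set ℕ) : FProg → Prop
  | nop => True
  | assign x _ => x ∉ B
  | store _ _ _ => True
  | wassign _ _ => True
  | wstore _ _ _ => True
  | seq p q => p.Counted B ∧ q.Counted B
  | cond _ p q => p.Counted B ∧ q.Counted B
  | for_ x y p => x ∉ B ∧ y ∈ B ∧ p.KeepsVar x ∧ p.Counted B

/-- A bound on the running time of `p` if all loop bounds are at most `K`. -/
def time (K : ℕ) : FProg → ℕ
  | nop => 1
  | assign _ e => e.cost + 1
  | store _ i e => i.cost + e.cost + 1
  | wassign _ e => e.cost + 1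
  | wstore _ i e => i.cost + e.cost + 1
  | seq p q => p.time K + q.time K
  | cond b p q => b.cost + (p.time K + q.time K) + 1
  | for_ _ _ p => K * (p.time K + 9) + 7

theorem Counted.keepsVar {B : Set ℕ} {p : FProg} (h : p.Counted B) {y : ℕ} (hy : y ∈ B) :
    p.KeepsVar y := by
  induction p with
  | nop => trivial
  | assign x e => rintro rfl; exact h hy
  | store a i e => trivial
  | wassign x e => trivial
  | wstore a i e => trivial
  | seq p q hp hq => exact ⟨hp h.1, hq h.2⟩
  | cond b p q hp hq => exact ⟨hp h.1, hq h.2⟩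
  | for_ x z p hp => exact ⟨fun e => h.1 (e ▸ hy), hp h.2.2.2⟩

/-- Nothing writes the variables in `B`, so the bound `K` stays valid throughout, and each while
loop makes exactly as many rounds as its bound says. -/
theorem exec_compile {B : Set ℕ} {K : ℕ} {p : FProg} (h : p.Counted B) {s : State}
    (hK : ∀ y ∈ B, s.var y ≤ K) : ∃ t ≤ p.time K, Exec p.compile s t (p.run s) := by
  induction p generalizing s with
  | nop => exact ⟨_, le_rfl, .nop s⟩
  | assign x e => exact ⟨_, le_rfl, .assign s x e⟩
  | store a i e => exact ⟨_, le_rfl, .store s a i e⟩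
  | wassign x e => exact ⟨_, le_rfl, .wassign s x e⟩
  | wstore a i e => exact ⟨_, le_rfl, .wstore s a i e⟩
  | seq p q hp hq =>
    obtain ⟨t, ht, hp⟩ := hp h.1 hK
    obtain ⟨t', ht', hq⟩ := hq h.2 (s := p.run s) fun y hy => by
      rw [(frame_run p s).var y (h.1.keepsVar hy)]; exact hK y hy
    exact ⟨_, Nat.add_le_add ht ht', .seq hp hq⟩
  | cond b p q hp hq =>
    by_cases hb : b.Holds s
    · obtain ⟨t, ht, hp⟩ := hp h.1 hK
      refine ⟨b.cost + t + 1, ?_, .cond_true hb ?_⟩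
      · simp only [time]; omega
      · simpa only [run, hb, if_true] using hp
    · obtain ⟨t, ht, hq⟩ := hq h.2 hK
      refine ⟨b.cost + t + 1, ?_, .cond_false hb ?_⟩
      · simp only [time]; omega
      · simpa only [run, hb, if_false] using hq
  | for_ x y p hp =>
    obtain ⟨hxB, hyB, hx, hc⟩ := h
    have hxy : y ≠ x := fun e => hxB (e ▸ hyB)
    set f := fun r => (run p r).setVar x ((run p r).var x + 1) with hf
    have hfr : ∀ r, ∀ z ∈ B, (f r).var z = r.var z := fun r z hz => by
      have : z ≠ x := fun e => hxB (e ▸ hz)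
      simp [hf, this, (frame_run p r).var z (hc.keepsVar hz)]
    have hfx : ∀ r, (f r).var x = r.var x + 1 := fun r => by
      simp [hf, (frame_run p r).var x hx]
    have key : ∀ N (r : State), r.var x + N = r.var y → (∀ z ∈ B, r.var z ≤ K) →
        ∃ t ≤ N * (p.time K + 9) + 5, Exec (.loop (.not (.le (.var y) (.var x)))
          (.seq p.compile (.assign x (.add (.var x) (.const 1))))) r t (f^[N] r) := by
      intro N
      induction N with
      | zero =>
        intro r hr _
        exact ⟨5, by omega, .loop_false (by simp; omega)⟩
      | succ N ih =>
        intro r hr hB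
        obtain ⟨t, ht, he⟩ := hp hc hB
        obtain ⟨t', ht', he'⟩ := ih (f r) (by rw [hfx, hfr r y hyB]; omega)
          fun z hz => by rw [hfr r z hz]; exact hB z hz
        refine ⟨_, ?_, .loop_true (by simp; omega) (.seq he (.assign _ _ _)) he'⟩
        -- Besides the body, a round costs 4 for the test, 4 for the increment and 1 for the loop:
        -- the 9 in `time`. The failing test (5) and the initialization (2) make up the 7.
        simp only [Test.cost, Expr.cost]
        rw [Nat.add_mul]
        omega
    obtain ⟨t, ht, he⟩ := key (s.var y) (s.setVar x 0) (by simp [hxy]) fun z hz => by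
      have : z ≠ x := fun e => hxB (e ▸ hz)
      simp [this, hK z hz]
    refine ⟨_, ?_, .seq (.assign _ _ _) he⟩
    have := Nat.mul_le_mul_right (p.time K + 9) (hK y hyB)
    simp only [time, Expr.cost]
    omega

/-- The running time is polynomial in the loop bounds. -/
theorem exists_time_le (p : FProg) : ∃ e, ∀ K, 2 ≤ K → p.time K ≤ K ^ e := by
  -- Functions that are at most a power of `K` for all `K ≥ 2` include the constants and are closed
  -- under sums and under multiplication by `K`.
  have const : ∀ c : ℕ, ∃ e, ∀ K, 2 ≤ K → c ≤ K ^ e := fun c =>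
    ⟨c, fun K hK => (Nat.lt_two_pow_self).le.trans (Nat.pow_le_pow_left hK c)⟩
  have add : ∀ f g : ℕ → ℕ, (∃ e, ∀ K, 2 ≤ K → f K ≤ K ^ e) → (∃ e, ∀ K, 2 ≤ K → g K ≤ K ^ e) →
      ∃ e, ∀ K, 2 ≤ K → f K + g K ≤ K ^ e := by
    rintro f g ⟨a, ha⟩ ⟨b, hb⟩
    refine ⟨max a b + 1, fun K hK => ?_⟩
    have h1 := (ha K hK).trans (Nat.pow_le_pow_right (by omega) (le_max_left a b))
    have h2 := (hb K hK).trans (Nat.pow_le_pow_right (by omega) (le_max_right a b))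
    calc f K + g K ≤ K ^ max a b * 2 := by omega
      _ ≤ K ^ max a b * K := Nat.mul_le_mul_left _ hK
  induction p with
  | nop => exact const _
  | assign x e => exact const _
  | store a i e => exact const _
  | wassign x e => exact const _
  | wstore a i e => exact const _
  | seq p q hp hq => exact add _ _ hp hq
  | cond b p q hp hq => exact add _ _ (add _ _ (const _) (add _ _ hp hq)) (const _)
  | for_ x y p hp =>
    obtain ⟨e, he⟩ := add _ _ hp (const 9)
    refine add _ _ ⟨e + 1, fun K hK => ?_⟩ (const _)
    rw [pow_succ']
    exact Nat.mul_le_mul_left _ (he K hK)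

end FProg
end RAM

/-! ### Weak chains -/

section Chains

variable {V : Type*}

/-- Two tuples touch if they share a vertex or are joined by an edge. -/
def Touch (k : ℕ) (H : SimpleGraph V) (f g : ℕ → V) : Prop :=
  ∃ a < k + 4, ∃ b < k + 4, f a = g b ∨ H.Adj (f a) (g b)

theorem Touch.symm {k : ℕ} {H : SimpleGraph V} {f g : ℕ → V} (h : Touch k H f g) :
    Touch k H g f := by
  obtain ⟨a, ha, b, hb, h⟩ := h
  exact ⟨b, hb, a, ha, h.imp Eq.symm SimpleGraph.Adj.symm⟩

/-- A tuple, as a function on the natural numbers. -/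
def tupleFun {k : ℕ} (f : Fin (k + 4) → V) (i : ℕ) : V := f (Fin.ofNat (k + 4) i)

open Classical in
/-- Remove the closed neighbourhood of `v`. -/
noncomputable def removeNbhd (H : SimpleGraph V) (S : Finset V) (v : V) : Finset V :=
  S.filter fun u => u ≠ v ∧ ¬ H.Adj v u

theorem mem_removeNbhd {H : SimpleGraph V} {S : Finset V} {u v : V} :
    u ∈ removeNbhd H S v ↔ u ∈ S ∧ u ≠ v ∧ ¬ H.Adj v u := by
  simp [removeNbhd]

variable [LinearOrder V]

/-- An edge, `k` vertices and an edge, in weakly increasing order. -/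
def WeakChain (k : ℕ) (H : SimpleGraph V) (g : ℕ → V) : Prop :=
  g 0 < g 1 ∧ (∀ i, 1 ≤ i → i < k + 2 → g i ≤ g (i + 1)) ∧ g (k + 2) < g (k + 3) ∧
    H.Adj (g 0) (g 1) ∧ H.Adj (g (k + 2)) (g (k + 3))

/-- Greedy choice: take a tuple with least entry 0, remove it, and recurse on the entries from
position 1 on. The least entry 0 is at most entry 0 of the next tuple, hence at most its entry 1. -/
theorem exists_greedy_selection {ι : Type*} [Nonempty ι] (m : ℕ) (F : Finset ι) (z : ι → ℕ → V)
    (hF : m ≤ F.card) (hz : ∀ f ∈ F, ∀ i, i + 1 < m → z f i ≤ z f (i + 1)) :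
    ∃ h : ℕ → ι, (∀ i < m, h i ∈ F) ∧ (∀ i < m, ∀ j < m, h i = h j → i = j) ∧
      ∀ i, i + 1 < m → z (h i) i ≤ z (h (i + 1)) (i + 1) := by
  classical
  induction m generalizing F z with
  | zero =>
    exact ⟨fun _ => Classical.arbitrary ι, by simp, by simp, by simp⟩
  | succ m ih =>
    obtain ⟨f₀, hf₀, hmin⟩ := F.exists_min_image (z · 0) (Finset.card_pos.1 (by omega))
    obtain ⟨h, h1, h2, h3⟩ := ih (F.erase f₀) (fun f i => z f (i + 1))
      (by rw [Finset.card_erase_of_mem hf₀]; omega)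
      (fun f hf i hi => hz f (Finset.mem_of_mem_erase hf) (i + 1) (by omega))
    refine ⟨fun i => i.casesOn f₀ h, ?_, ?_, ?_⟩
    · rintro (_ | i) hi
      · exact hf₀
      · exact Finset.mem_of_mem_erase (h1 i (by omega))
    · rintro (_ | i) hi (_ | j) hj hij
      · rfl
      · exact absurd hij.symm (Finset.ne_of_mem_erase (h1 j (by omega)))
      · exact absurd hij (Finset.ne_of_mem_erase (h1 i (by omega)))
      · rw [h2 i (by omega) j (by omega) hij]
    · rintro (_ | i) hi
      · have := Finset.mem_of_mem_erase (h1 0 (by omega))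
        exact (hmin _ this).trans (hz _ this 0 hi)
      · exact h3 i (by omega)

theorem aakbb_adj {k : ℕ} {a b : Fin (k + 4)} : (aakbb k).Adj a b ↔
    (a : ℕ) = 0 ∧ (b : ℕ) = 1 ∨ (a : ℕ) = 1 ∧ (b : ℕ) = 0 ∨
    (a : ℕ) = k + 2 ∧ (b : ℕ) = k + 3 ∨ (a : ℕ) = k + 3 ∧ (b : ℕ) = k + 2 := by
  simp only [aakbb, SimpleGraph.fromEdgeSet_adj, Set.mem_insert_iff, Set.mem_singleton_iff,
    Sym2.eq_iff, Fin.ext_iff, ne_eq]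
  omega

/-- In an `aa(k)bb`-free graph, among `k + 2` weak chains there are two that touch. -/
theorem card_le_of_pairwise_not_touch {k : ℕ} {H : SimpleGraph V} (hH : OrderedFree (aakbb k) H)
    {ι : Type*} (F : Finset ι) (y : ι → ℕ → V) (hy : ∀ f ∈ F, WeakChain k H (y f))
    (hF : ∀ f ∈ F, ∀ g ∈ F, f ≠ g → ¬ Touch k H (y f) (y g)) : F.card ≤ k + 1 := by
  by_contra! hcard
  obtain ⟨f₀, -⟩ := Finset.card_pos.1 (Nat.zero_lt_of_lt hcard)
  have : Nonempty ι := ⟨f₀⟩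
  -- Only positions `1, …, k + 2` take part in the selection, one for each of the `k + 2` chains.
  obtain ⟨h, hm, hinj, hle⟩ := exists_greedy_selection (k + 2) F (fun f i => y f (i + 1)) hcard
    (fun f hf i hi => (hy f hf).2.1 (i + 1) (by omega) (by omega))
  -- Entry `j` of the new tuple comes from the selected chain number `part j`. Truncated subtraction
  -- puts positions 0 and 1 into the same chain, and the minimum does so for `k + 2` and `k + 3`;
  -- thus both end edges survive.
  let part : ℕ → ℕ := fun j => min (j - 1) (k + 1)
  have hpart : ∀ j, part j < k + 2 := fun j => by simp only [part]; omega
  let g : ℕ → V := fun j => y (h (part j)) j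
  -- Entries from different chains are distinct, which makes the weak inequalities strict, and
  -- non-adjacent, which makes the copy induced.
  have hsep : ∀ a < k + 4, ∀ b < k + 4, part a ≠ part b → ¬ (g a = g b ∨ H.Adj (g a) (g b)) :=
    fun a ha b hb hab ht => hF _ (hm _ (hpart a)) _ (hm _ (hpart b))
      (fun e => hab (hinj _ (hpart a) _ (hpart b) e)) ⟨a, ha, b, hb, ht⟩
  have p0 : part 0 = 0 := by simp [part]
  have p1 : part 1 = 0 := by simp [part]
  have p2 : part (k + 2) = k + 1 := by simp only [part]; omega
  have p3 : part (k + 3) = k + 1 := by simp only [part]; omega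
  have h0 := hy _ (hm 0 (by omega))
  have h1 := hy _ (hm (k + 1) (by omega))
  have hlt : ∀ i, i + 1 < k + 4 → g i < g (i + 1) := by
    intro i hi
    rcases Nat.eq_zero_or_pos i with rfl | hi0
    · simpa only [g, p0, p1, zero_add] using h0.1
    rcases Nat.lt_or_ge (k + 1) i with hik | hik
    · obtain rfl : i = k + 2 := by omega
      simpa only [g, p2, p3] using h1.2.2.1
    · have e1 : part i = i - 1 := by simp only [part]; omega
      have e2 : part (i + 1) = i := by simp only [part]; omega
      refine lt_of_le_of_ne ?_ fun e =>
        hsep i (by omega) (i + 1) hi (by omega) (Or.inl e)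
      have := hle (i - 1) (by omega)
      simp only [g, e1, e2]
      rwa [Nat.sub_add_cancel hi0] at this
  have hmono : StrictMono fun j : Fin (k + 4) => g j := by
    refine Fin.strictMono_iff_lt_succ.2 fun i => ?_
    simpa using hlt i (by omega)
  refine hH ⟨⟨⟨fun j => g j, hmono.injective⟩, ?_⟩, hmono⟩
  intro a b
  have ha := a.2
  have hb := b.2
  simp only [Function.Embedding.coeFn_mk, aakbb_adj]
  constructor
  · intro hab
    have hp : part a = part b := by
      by_contra hne
      exact hsep a ha b hb hne (Or.inr hab)
    have : (a : ℕ) ≠ b := fun e => hab.ne (by rw [e])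
    simp only [part] at hp
    omega
  · have e1 : H.Adj (g 0) (g 1) := by simpa only [g, p0, p1] using h0.2.2.2.1
    have e2 : H.Adj (g (k + 2)) (g (k + 3)) := by simpa only [g, p2, p3] using h1.2.2.2.2
    rintro (⟨ea, eb⟩ | ⟨ea, eb⟩ | ⟨ea, eb⟩ | ⟨ea, eb⟩) <;> rw [ea, eb]
    exacts [e1, e1.symm, e2, e2.symm]

open Classical in
/-- The weak chains in the vertex set `S`. -/
noncomputable def chains (k : ℕ) (H : SimpleGraph V) (S : Finset V) :
    Finset (Fin (k + 4) → V) :=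
  (Fintype.piFinset fun _ => S).filter fun f => WeakChain k H (tupleFun f)

theorem mem_chains {k : ℕ} {H : SimpleGraph V} {S : Finset V} {f : Fin (k + 4) → V} :
    f ∈ chains k H S ↔ (∀ i, f i ∈ S) ∧ WeakChain k H (tupleFun f) := by
  simp [chains]

theorem chains_mono {k : ℕ} {H : SimpleGraph V} {S T : Finset V} (h : S ⊆ T) :
    chains k H S ⊆ chains k H T := fun f hf => by
  rw [mem_chains] at hf ⊢
  exact ⟨fun i => h (hf.1 i), hf.2⟩

/-- In an `aa(k)bb`-free graph, some closed neighbourhood meets a constant fraction of the weak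
chains. -/
theorem exists_heavy {k : ℕ} {H : SimpleGraph V} (hH : OrderedFree (aakbb k) H) {S : Finset V}
    (hS : (chains k H S).Nonempty) : ∃ v ∈ S,
      (chains k H (removeNbhd H S v)).card * ((k + 1) * (k + 4)) ≤
        (chains k H S).card * ((k + 1) * (k + 4) - 1) := by
  classical
  set P := chains k H S with hP
  let hit : V → Finset (Fin (k + 4) → V) := fun v =>
    P.filter fun p => ∃ b, v = p b ∨ H.Adj v (p b)
  have hsplit : ∀ v, (hit v).card + (chains k H (removeNbhd H S v)).card = P.card := by
    intro v
    rw [← Finset.card_filter_add_card_filter_not (s := P)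
      (p := fun p => ∃ b, v = p b ∨ H.Adj v (p b))]
    congr 2
    ext p
    simp only [hP, mem_chains, removeNbhd, Finset.mem_filter, not_exists, not_or]
    constructor
    · exact fun h => ⟨⟨fun i => (h.1 i).1, h.2⟩, fun i => ⟨Ne.symm (h.1 i).2.1, (h.1 i).2.2⟩⟩
    · exact fun h => ⟨fun i => ⟨h.1.1 i, Ne.symm (h.2 i).1, (h.2 i).2⟩, h.1.2⟩
  obtain ⟨p₀, hp₀⟩ := hS
  -- The heavy vertex is one whose closed neighbourhood meets the most chains; it does at least as
  -- well as the average over the vertices of the family `F` below.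
  obtain ⟨v, hvS, hv⟩ := S.exists_max_image (fun v => (hit v).card)
    ⟨_, (mem_chains.1 hp₀).1 0⟩
  refine ⟨v, hvS, ?_⟩
  let good : Finset (Finset (Fin (k + 4) → V)) := P.powerset.filter fun F =>
    ∀ f ∈ F, ∀ g ∈ F, f ≠ g → ¬ Touch k H (tupleFun f) (tupleFun g)
  obtain ⟨F, hFgood, hFmax⟩ := good.exists_max_image Finset.card
    ⟨∅, by simp [good]⟩
  have hF := hFgood
  simp only [good, Finset.mem_filter, Finset.mem_powerset] at hF
  have hFcard : F.card ≤ k + 1 := card_le_of_pairwise_not_touch hH F tupleFun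
    (fun f hf => (mem_chains.1 (hF.1 hf)).2) hF.2
  -- Since `F` is maximum, every chain touches a member of `F`, that is, it is hit by a vertex of
  -- `F`.
  have hcover : P ⊆ (F ×ˢ (Finset.univ : Finset (Fin (k + 4)))).biUnion fun q => hit (q.1 q.2) := by
    intro p hp
    have hex : ∃ f ∈ F, Touch k H (tupleFun f) (tupleFun p) := by
      by_contra! hno
      have hpF : p ∉ F := fun h => hno p h ⟨0, by omega, 0, by omega, Or.inl rfl⟩
      have : insert p F ∈ good := by
        simp only [good, Finset.mem_filter, Finset.mem_powerset, Finset.insert_subset_iff]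
        refine ⟨⟨hp, hF.1⟩, ?_⟩
        intro f hf g hg hfg
        rcases Finset.mem_insert.1 hf with hf | hf <;> rcases Finset.mem_insert.1 hg with hg | hg
        · exact absurd (hf.trans hg.symm) hfg
        · exact hf ▸ fun h => hno g hg h.symm
        · exact hg ▸ hno f hf
        · exact hF.2 f hf g hg hfg
      have := hFmax _ this
      rw [Finset.card_insert_of_notMem hpF] at this
      omega
    obtain ⟨f, hf, a, ha, b, hb, h⟩ := hex
    simp only [Finset.mem_biUnion, Finset.mem_product, Finset.mem_univ, and_true, hit,
      Finset.mem_filter]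
    exact ⟨(f, Fin.ofNat _ a), hf, hp, Fin.ofNat _ b, h⟩
  have hle : P.card ≤ (k + 1) * (k + 4) * (hit v).card := by
    refine (Finset.card_le_card hcover).trans
      ((Finset.card_biUnion_le_card_mul _ _ (hit v).card ?_).trans ?_)
    · rintro ⟨f, a⟩ hq
      exact hv _ ((mem_chains.1 (hF.1 (Finset.mem_product.1 hq).1)).1 a)
    · refine Nat.mul_le_mul_right _ ?_
      rw [Finset.card_product, Finset.card_fin]
      exact Nat.mul_le_mul_right _ hFcard
  have h1 := hsplit v
  generalize (k + 1) * (k + 4) = c at *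
  generalize (chains k H (removeNbhd H S v)).card = r at *
  rcases c with _ | c
  · simp
  · simp only [Nat.add_sub_cancel]
    nlinarith

end Chains

/-! ### Branching on heavy vertices -/

section Branching

/-- The number of weak chains in `S` that avoid the closed neighbourhood of `v`. -/
noncomputable def chainCount (k : ℕ) (H : SimpleGraph ℕ) (S : Finset ℕ) (v : ℕ) : ℕ :=
  (chains k H (removeNbhd H S v)).card

open Classical in
/-- The first vertex of `S` below `i` that minimizes the number of remaining chains, or `n` if
no vertex meets a chain. -/
noncomputable def pickBelow (k : ℕ) (H : SimpleGraph ℕ) (n : ℕ) (S : Finset ℕ) : ℕ → ℕ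
  | 0 => n
  | i + 1 => if i ∈ S ∧ chainCount k H S i < chainCount k H S (pickBelow k H n S i) then i
      else pickBelow k H n S i

open Classical in
/-- The remaining vertices and the chosen vertices after `t` rounds of branching, where the heavy
vertices in `X` are chosen and the other ones are discarded. -/
noncomputable def branch (k : ℕ) (H : SimpleGraph ℕ) (n : ℕ) (X : Finset ℕ) :
    ℕ → Finset ℕ × Finset ℕ
  | 0 => (Finset.range n, ∅)
  | t + 1 =>
    let S := (branch k H n X t).1
    let A := (branch k H n X t).2
    let v := pickBelow k H n S n
    if v < n then if v ∈ X then (removeNbhd H S v, insert v A) else (S.erase v, A) else (S, A)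

variable {k n : ℕ} {H : SimpleGraph ℕ}

theorem removeNbhd_subset {S : Finset ℕ} {v : ℕ} : removeNbhd H S v ⊆ S :=
  fun _ hu => (mem_removeNbhd.1 hu).1

/-- The number `n` stands for "no vertex". As it lies outside the graph, the chain count at `n` is
the total number of chains, which a picked vertex has to beat. -/
theorem removeNbhd_of_isolated {S : Finset ℕ} (hS : S ⊆ Finset.range n)
    (hn : ∀ u v, H.Adj u v → u < n) : removeNbhd H S n = S := by
  refine removeNbhd_subset.antisymm fun u hu =>
    mem_removeNbhd.2 ⟨hu, ?_, fun h => absurd (hn _ _ h) (lt_irrefl n)⟩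
  have := Finset.mem_range.1 (hS hu)
  omega

theorem pickBelow_spec (S : Finset ℕ) (i : ℕ) :
    (pickBelow k H n S i = n ∨ pickBelow k H n S i ∈ S ∧
      chainCount k H S (pickBelow k H n S i) < chainCount k H S n) ∧
    (∀ v ∈ S, v < i → chainCount k H S (pickBelow k H n S i) ≤ chainCount k H S v) := by
  induction i with
  | zero => exact ⟨Or.inl rfl, by simp⟩
  | succ i ih =>
    obtain ⟨h1, h2⟩ := ih
    rw [pickBelow]
    split_ifs with h
    · refine ⟨Or.inr ⟨h.1, h.2.trans_le ?_⟩, fun v hv hvi => ?_⟩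
      · rcases h1 with h1 | h1
        · rw [h1]
        · exact h1.2.le
      · rcases Nat.lt_succ_iff_lt_or_eq.1 hvi with hlt | rfl
        · exact h.2.le.trans (h2 v hv hlt)
        · exact le_rfl
    · refine ⟨h1, fun v hv hvi => ?_⟩
      rcases Nat.lt_succ_iff_lt_or_eq.1 hvi with hlt | rfl
      · exact h2 v hv hlt
      · exact not_lt.1 fun hc => h ⟨hv, hc⟩

/-- Either no chain is left, or the picked vertex is heavy. -/
theorem pick_cases (hH : OrderedFree (aakbb k) H) (hn : ∀ u v, H.Adj u v → u < n)
    {S : Finset ℕ} (hS : S ⊆ Finset.range n) :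
    (pickBelow k H n S n = n ∧ chains k H S = ∅) ∨
    (pickBelow k H n S n ∈ S ∧ pickBelow k H n S n < n ∧ (chains k H S).Nonempty ∧
      (chains k H (removeNbhd H S (pickBelow k H n S n))).card * ((k + 1) * (k + 4)) ≤
        (chains k H S).card * ((k + 1) * (k + 4) - 1)) := by
  obtain ⟨h1, h2⟩ := pickBelow_spec (k := k) (H := H) (n := n) S n
  have htot : chainCount k H S n = (chains k H S).card := by
    rw [chainCount, removeNbhd_of_isolated hS hn]
  have hlt : pickBelow k H n S n ∈ S → pickBelow k H n S n < n := fun h =>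
    Finset.mem_range.1 (hS h)
  rcases (chains k H S).eq_empty_or_nonempty with he | hne
  · left
    refine ⟨?_, he⟩
    rcases h1 with h1 | h1
    · exact h1
    · rw [htot, he] at h1
      exact absurd h1.2 (by simp)
  · right
    obtain ⟨v, hv, hheavy⟩ := exists_heavy hH hne
    have hle : chainCount k H S (pickBelow k H n S n) ≤ chainCount k H S v :=
      h2 v hv (Finset.mem_range.1 (hS hv))
    have hmem : pickBelow k H n S n ∈ S := by
      rcases h1 with h1 | h1
      -- If the pick were still the default `n`, the number of chains would be at most a proper
      -- fraction of itself, although it is positive.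
      · exfalso
        rw [h1, htot] at hle
        have hpos := hne.card_pos
        have hc : 0 < (k + 1) * (k + 4) := by positivity
        have h3 := (Nat.mul_le_mul_right _ hle).trans hheavy
        have h4 := Nat.le_of_mul_le_mul_left h3 hpos
        omega
      · exact h1.1
    exact ⟨hmem, hlt hmem, hne, (Nat.mul_le_mul_right _ hle).trans hheavy⟩

/-- The last clause ensures termination: every round that starts with a chain removes at least the
picked vertex, so `n` rounds exhaust all chains. -/
theorem branch_invariant (hH : OrderedFree (aakbb k) H) (hn : ∀ u v, H.Adj u v → u < n)
    (X : Finset ℕ) (t : ℕ) :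
    (branch k H n X t).1 ⊆ Finset.range n ∧ (branch k H n X t).2 ⊆ Finset.range n ∧
    H.IsIndepSet ((branch k H n X t).2 : Set ℕ) ∧
    (∀ a ∈ (branch k H n X t).2, ∀ u ∈ (branch k H n X t).1, a ≠ u ∧ ¬ H.Adj a u) ∧
    (chains k H (branch k H n X t).1 = ∅ ∨ (branch k H n X t).1.card + t ≤ n) := by
  induction t with
  | zero => simp [branch]
  | succ t ih =>
    obtain ⟨h1, h2, h3, h4, h5⟩ := ih
    simp only [branch]
    set S := (branch k H n X t).1
    set A := (branch k H n X t).2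
    rcases pick_cases hH hn h1 with ⟨hp, he⟩ | ⟨hmem, hlt, hne, -⟩
    · rw [hp, if_neg (lt_irrefl n)]
      exact ⟨h1, h2, h3, h4, Or.inl he⟩
    · set v := pickBelow k H n S n
      have h5 : S.card + t ≤ n := h5.resolve_left hne.ne_empty
      have hcard : (S.erase v).card + 1 = S.card := Finset.card_erase_add_one hmem
      rw [if_pos hlt]
      split_ifs with hX
      · refine ⟨removeNbhd_subset.trans h1, ?_, ?_, ?_, Or.inr ?_⟩
        · exact Finset.insert_subset (h1 hmem) h2
        · intro a ha b hb hab
          rcases Finset.mem_insert.1 (Finset.mem_coe.1 ha) with ha | ha <;>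
            rcases Finset.mem_insert.1 (Finset.mem_coe.1 hb) with hb | hb
          · exact absurd (ha.trans hb.symm) hab
          · exact fun h => (h4 b hb v hmem).2 (ha ▸ h.symm)
          · exact fun h => (h4 a ha v hmem).2 (hb ▸ h)
          · exact h3 ha hb hab
        · intro a ha u hu
          have hu' := mem_removeNbhd.1 hu
          rcases Finset.mem_insert.1 ha with rfl | ha
          · exact ⟨hu'.2.1.symm, hu'.2.2⟩
          · exact h4 a ha u hu'.1
        · have : removeNbhd H S v ⊆ S.erase v := fun u hu => by
            have hu' := mem_removeNbhd.1 hu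
            exact Finset.mem_erase.2 ⟨hu'.2.1, hu'.1⟩
          have := Finset.card_le_card this
          simp only at *
          omega
      · refine ⟨(Finset.erase_subset _ _).trans h1, h2, h3, fun a ha u hu =>
          h4 a ha u (Finset.mem_of_mem_erase hu), Or.inr ?_⟩
        simp only at *
        omega

/-- After `n` rounds no chain is left. -/
theorem chains_branch (hH : OrderedFree (aakbb k) H) (hn : ∀ u v, H.Adj u v → u < n)
    (X : Finset ℕ) : chains k H (branch k H n X n).1 = ∅ := by
  rcases (branch_invariant hH hn X n).2.2.2.2 with h | h
  · exact h
  · have : (branch k H n X n).1 = ∅ := by rw [← Finset.card_eq_zero]; omega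
    rw [this]
    ext f
    simp [mem_chains]

/-- Branching along an independent set `I` keeps `I`, and it chooses few vertices. -/
theorem branch_along (hH : OrderedFree (aakbb k) H) (hn : ∀ u v, H.Adj u v → u < n)
    {I : Finset ℕ} (hI : H.IsIndepSet (I : Set ℕ)) (hIn : I ⊆ Finset.range n) (t : ℕ) :
    I ⊆ (branch k H n I t).2 ∪ (branch k H n I t).1 ∧ (branch k H n I t).2 ⊆ I ∧
    (chains k H (branch k H n I t).1).card * ((k + 1) * (k + 4)) ^ (branch k H n I t).2.card ≤
      n ^ (k + 4) * ((k + 1) * (k + 4) - 1) ^ (branch k H n I t).2.card ∧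
    ((branch k H n I t).2.card = 0 ∨
      ((k + 1) * (k + 4)) ^ ((branch k H n I t).2.card - 1) ≤
      n ^ (k + 4) * ((k + 1) * (k + 4) - 1) ^ ((branch k H n I t).2.card - 1)) := by
  -- With `c = (k + 1)(k + 4)`, the third clause is the bound `n ^ (k + 4) * (1 - 1 / c) ^ m` on the
  -- number of chains after `m` choices, written without fractions.
  induction t with
  | zero =>
    refine ⟨by simpa [branch] using hIn, by simp [branch], ?_, by simp [branch]⟩
    simp only [branch, Finset.card_empty, pow_zero, mul_one]
    classical
    refine (Finset.card_filter_le _ _).trans ?_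
    simp
  | succ t ih =>
    obtain ⟨-, -, -, hdisj, -⟩ := branch_invariant hH hn I t
    obtain ⟨h1, h2, h3, h4⟩ := ih
    have hS := (branch_invariant hH hn I t).1
    simp only [branch]
    set S := (branch k H n I t).1
    set A := (branch k H n I t).2
    set c := (k + 1) * (k + 4)
    rcases pick_cases hH hn hS with ⟨hp, he⟩ | ⟨hmem, hlt, hne, hheavy⟩
    · rw [hp, if_neg (lt_irrefl n)]
      exact ⟨h1, h2, h3, h4⟩
    · set v := pickBelow k H n S n
      rw [if_pos hlt]
      split_ifs with hX
      · have hvA : v ∉ A := fun h => (hdisj v h v hmem).1 rfl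
        simp only [Finset.card_insert_of_notMem hvA]
        refine ⟨fun u hu => ?_, Finset.insert_subset hX h2, ?_, Or.inr ?_⟩
        · rw [Finset.mem_union, Finset.mem_insert]
          by_cases huv : u = v
          · exact Or.inl (Or.inl huv)
          rcases Finset.mem_union.1 (h1 hu) with h | h
          · exact Or.inl (Or.inr h)
          · exact Or.inr (mem_removeNbhd.2 ⟨h, huv, hI hX hu (Ne.symm huv)⟩)
        · calc (chains k H (removeNbhd H S v)).card * c ^ (A.card + 1)
              = (chains k H (removeNbhd H S v)).card * c * c ^ A.card := by ring
            _ ≤ (chains k H S).card * (c - 1) * c ^ A.card := Nat.mul_le_mul_right _ hheavy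
            _ = (chains k H S).card * c ^ A.card * (c - 1) := by ring
            _ ≤ n ^ (k + 4) * (c - 1) ^ A.card * (c - 1) := Nat.mul_le_mul_right _ h3
            _ = n ^ (k + 4) * (c - 1) ^ (A.card + 1) := by ring
        -- Just before this choice at least one chain was left, so the factor that counts the chains
        -- can be dropped.
        · rw [Nat.add_sub_cancel]
          exact (Nat.le_mul_of_pos_left _ hne.card_pos).trans h3
      · refine ⟨fun u hu => ?_, h2, ?_, h4⟩
        · rcases Finset.mem_union.1 (h1 hu) with h | h
          · exact Finset.mem_union_left _ h
          · exact Finset.mem_union_right _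
              (Finset.mem_erase.2 ⟨fun e => hX (e ▸ hu), h⟩)
        · refine (Nat.mul_le_mul_right _ (Finset.card_le_card ?_)).trans h3
          exact chains_mono (Finset.erase_subset _ _)

/-- Bernoulli's inequality `(1 + 1 / m) ^ j ≥ 1 + j / m` at `j = m + 1`, cleared of denominators. It
says that `m + 1` reductions by the factor `m / (m + 1)` at least halve a number. -/
theorem two_mul_pow_le (m : ℕ) : 2 * m ^ (m + 1) ≤ (m + 1) ^ (m + 1) := by
  rcases Nat.eq_zero_or_pos m with rfl | hm
  · simp
  have key : ∀ j, m ^ j * (m + j) ≤ (m + 1) ^ j * m := by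
    intro j
    induction j with
    | zero => simp
    | succ j ih =>
      calc m ^ (j + 1) * (m + (j + 1)) ≤ m ^ j * (m + j) * (m + 1) := by
            rw [pow_succ, mul_assoc, mul_assoc]
            exact Nat.mul_le_mul_left _ (by nlinarith)
        _ ≤ (m + 1) ^ j * m * (m + 1) := Nat.mul_le_mul_right _ ih
        _ = (m + 1) ^ (j + 1) * m := by ring
  refine Nat.le_of_mul_le_mul_right ((?_ : _ ≤ _).trans (key (m + 1))) hm
  rw [mul_comm 2, mul_assoc]
  exact Nat.mul_le_mul_left _ (by omega)

/-- Each block of `(k + 1)(k + 4)` choices at least halves the number of chains, which is at most `2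
^ ((k + 4) * j)` initially. After `(k + 4) * j + 1` such blocks no chain could be left, so there is
no further choice. -/
theorem card_branch_le (hH : OrderedFree (aakbb k) H) (hn : ∀ u v, H.Adj u v → u < n)
    {I : Finset ℕ} (hI : H.IsIndepSet (I : Set ℕ)) (hIn : I ⊆ Finset.range n) (t : ℕ) {j : ℕ}
    (hj : n ≤ 2 ^ j) :
    (branch k H n I t).2.card ≤ (k + 1) * (k + 4) * ((k + 4) * j + 1) := by
  rcases (branch_along hH hn hI hIn t).2.2.2 with h | h
  · omega
  by_contra! hlt
  set q := (k + 4) * j + 1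
  obtain ⟨m, hm⟩ : ∃ m, (k + 1) * (k + 4) = m + 1 := ⟨k * (k + 5) + 3, by ring⟩
  have hm0 : 0 < m := by nlinarith
  rw [hm] at h hlt
  rw [Nat.add_sub_cancel] at h
  obtain ⟨r, hr⟩ : ∃ r, (branch k H n I t).2.card - 1 = (m + 1) * q + r :=
    ⟨(branch k H n I t).2.card - 1 - (m + 1) * q, by omega⟩
  rw [hr] at h
  have h1 : 2 ^ q * m ^ ((m + 1) * q + r) ≤ (m + 1) ^ ((m + 1) * q + r) := by
    calc 2 ^ q * m ^ ((m + 1) * q + r) = (2 * m ^ (m + 1)) ^ q * m ^ r := by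
          rw [mul_pow, ← pow_mul, pow_add m, mul_assoc]
      _ ≤ ((m + 1) ^ (m + 1)) ^ q * (m + 1) ^ r :=
          Nat.mul_le_mul (Nat.pow_le_pow_left (two_mul_pow_le m) q)
            (Nat.pow_le_pow_left (Nat.le_succ m) r)
      _ = _ := by rw [← pow_mul, pow_add]
  have h2 : n ^ (k + 4) ≤ 2 ^ ((k + 4) * j) := by
    rw [mul_comm, pow_mul]; exact Nat.pow_le_pow_left hj _
  have h3 : 2 ^ q ≤ 2 ^ ((k + 4) * j) :=
    Nat.le_of_mul_le_mul_right ((h1.trans h).trans (Nat.mul_le_mul_right _ h2)) (pow_pos hm0 _)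
  have := (Nat.pow_le_pow_iff_right (by norm_num : 1 < 2)).1 h3
  omega

/-- Branching along `I` is the same as branching along the vertices chosen that way. -/
theorem branch_eq_of_chosen (hH : OrderedFree (aakbb k) H) (hn : ∀ u v, H.Adj u v → u < n)
    {I X : Finset ℕ} (hI : H.IsIndepSet (I : Set ℕ)) (hIn : I ⊆ Finset.range n) {T : ℕ}
    (hX : ∀ v < n, v ∈ X ↔ v ∈ (branch k H n I T).2) (t : ℕ) (ht : t ≤ T) :
    branch k H n X t = branch k H n I t := by
  -- Chosen vertices stay chosen, so everything chosen in an earlier round is in the set of round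
  -- `T`.
  have hmono : ∀ d t, (branch k H n I t).2 ⊆ (branch k H n I (t + d)).2 := by
    intro d t
    induction d with
    | zero => exact subset_rfl
    | succ d ih =>
      refine ih.trans ?_
      rw [← add_assoc, branch]
      split_ifs
      · exact Finset.subset_insert _ _
      · exact subset_rfl
      · exact subset_rfl
  induction t with
  | zero => rfl
  | succ t ih =>
    have hsub := hmono (T - (t + 1)) (t + 1)
    rw [Nat.add_sub_cancel' ht] at hsub
    rw [branch] at hsub
    simp only [branch, ih (by omega)]
    -- The two runs could part only at a picked vertex in exactly one of `X` and `I`. But a vertex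
    -- of `X` was chosen, hence is in `I`; and a picked vertex of `I` gets chosen, hence is in `X`.
    split_ifs with h1 h2 h3 h3
    · rfl
    · exact absurd ((branch_along hH hn hI hIn T).2.1 ((hX _ h1).1 h2)) h3
    · rw [if_pos h1, if_pos h3] at hsub
      exact absurd ((hX _ h1).2 (hsub (Finset.mem_insert_self _ _))) h2
    · rfl
    · rfl

/-! ### Coding small vertex sets by numbers -/

open Classical in
/-- The digits in base `n + 1` of a number, as a set of vertices. -/
noncomputable def digitSet (n L c : ℕ) : Finset ℕ :=
  (Finset.range n).filter fun v => ∃ j < L, c / (n + 1) ^ j % (n + 1) = v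

/-- The elements of `A` serve as digits, padded to length `L` with the digit `n`, which is not a
vertex; hence the base `n + 1`. -/
theorem exists_digitSet_eq {A : Finset ℕ} {L : ℕ} (hA : A ⊆ Finset.range n) (hL : A.card ≤ L) :
    ∃ c < (n + 1) ^ L, digitSet n L c = A := by
  have hlt : ∀ j, A.toList.getD j n < n + 1 := by
    intro j
    by_cases hj : j < A.toList.length
    · rw [List.getD_eq_getElem _ _ hj]
      have := Finset.mem_range.1 (hA (Finset.mem_toList.1 (List.getElem_mem hj)))
      omega
    · rw [List.getD_eq_default _ _ (by omega)]
      omega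
  let f : Fin L → Fin (n + 1) := fun j => ⟨A.toList.getD j n, hlt j⟩
  refine ⟨finFunctionFinEquiv f, (finFunctionFinEquiv f).2, ?_⟩
  have hdig : ∀ j (hj : j < L), (finFunctionFinEquiv f : ℕ) / (n + 1) ^ j % (n + 1) =
      A.toList.getD j n := by
    intro j hj
    have h : (finFunctionFinEquiv.symm (finFunctionFinEquiv f)) ⟨j, hj⟩ = f ⟨j, hj⟩ := by
      rw [Equiv.symm_apply_apply]
    exact congrArg Fin.val h
  ext v
  rw [digitSet, Finset.mem_filter, Finset.mem_range]
  constructor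
  · rintro ⟨hv, j, hj, h⟩
    rw [hdig j hj] at h
    by_cases hj' : j < A.toList.length
    · rw [List.getD_eq_getElem _ _ hj'] at h
      rw [← h]
      exact Finset.mem_toList.1 (List.getElem_mem hj')
    · rw [List.getD_eq_default _ _ (by omega)] at h
      omega
  · intro hv
    refine ⟨Finset.mem_range.1 (hA hv), ?_⟩
    obtain ⟨j, hj, h⟩ := List.getElem_of_mem (Finset.mem_toList.2 hv)
    have hjL : j < L := by rw [Finset.length_toList] at hj; omega
    exact ⟨j, hjL, by rw [hdig j hjL, List.getD_eq_getElem _ _ hj, h]⟩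

/-- Every independent set is found by branching along one of `(n + 1) ^ L` sets. -/
theorem exists_branch_code (hH : OrderedFree (aakbb k) H) (hn : ∀ u v, H.Adj u v → u < n)
    {I : Finset ℕ} (hI : H.IsIndepSet (I : Set ℕ)) (hIn : I ⊆ Finset.range n) {j L : ℕ}
    (hj : n ≤ 2 ^ j) (hL : (k + 1) * (k + 4) * ((k + 4) * j + 1) ≤ L) :
    ∃ c < (n + 1) ^ L, I ⊆ (branch k H n (digitSet n L c) n).2 ∪
      (branch k H n (digitSet n L c) n).1 ∧ (branch k H n (digitSet n L c) n).2 ⊆ I := by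
  obtain ⟨c, hc, hX⟩ := exists_digitSet_eq (branch_invariant hH hn I n).2.1
    ((card_branch_le hH hn hI hIn n hj).trans hL)
  refine ⟨c, hc, ?_⟩
  rw [branch_eq_of_chosen hH hn hI hIn (T := n) (fun v _ => by rw [hX]) n le_rfl]
  exact ⟨(branch_along hH hn hI hIn n).1, (branch_along hH hn hI hIn n).2.1⟩

/-! ### Graphs without weak chains are bipartite -/

/-- The least right end of an edge in `S`, or `n`. -/
def IsSplit (H : SimpleGraph ℕ) (S : Finset ℕ) (p : ℕ) : Prop :=
  (∀ x ∈ S, ∀ y ∈ S, x < y → H.Adj x y → p ≤ y) ∧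
    ((∃ x ∈ S, ∃ y ∈ S, x < y ∧ H.Adj x y ∧ p = y) ∨ ∀ x ∈ S, x < p)

/-- If no chain is left, the graph is bipartite. -/
theorem IsSplit.adj {S : Finset ℕ} {p : ℕ} (hp : IsSplit H S p) (hS : chains k H S = ∅)
    {u v : ℕ} (hu : u ∈ S) (hv : v ∈ S) (huv : u < v) (h : H.Adj u v) : u < p ∧ p ≤ v := by
  refine ⟨?_, hp.1 u hu v hv huv h⟩
  rcases hp.2 with ⟨x, hx, y, hy, hxy, hadj, rfl⟩ | hall
  -- If `p ≤ u`, then the edge `xp`, repetitions of `p`, and the edge `uv` form a weak chain. This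
  -- is why chains are allowed to repeat vertices.
  · by_contra! hpu
    let g : ℕ → ℕ := fun i => if i = 0 then x else if i < k + 2 then p else
      if i = k + 2 then u else v
    let f : Fin (k + 4) → ℕ := fun i => g i
    have hf : ∀ i < k + 4, tupleFun f i = g i := fun i hi => by
      simp [tupleFun, f, Nat.mod_eq_of_lt hi]
    have g0 : g 0 = x := by simp [g]
    have g1 : g 1 = p := by simp [g]
    have g2 : g (k + 2) = u := by simp [g]
    have g3 : g (k + 3) = v := by simp [g]
    have : f ∈ chains k H S := by
      rw [mem_chains]
      refine ⟨fun i => ?_, ?_⟩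
      · simp only [f, g]; split_ifs <;> assumption
      · rw [WeakChain, hf 0 (by omega), hf 1 (by omega), hf (k + 2) (by omega),
          hf (k + 3) (by omega), g0, g1, g2, g3]
        refine ⟨hxy, fun i h1 h2 => ?_, huv, hadj, h⟩
        rw [hf i (by omega), hf (i + 1) (by omega)]
        have e1 : g i = p := by simp only [g]; rw [if_neg (by omega), if_pos (by omega)]
        rw [e1]
        simp only [g]
        split_ifs <;> first | omega | contradiction
    rw [hS] at this
    simp at this
  · exact hall u hu

end Branching

/-! ### Maximum weight independent sets in bipartite graphs by the push-relabel method -/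

section Flow

/-- A preflow with heights: the excesses, the residual capacities and the heights. -/
structure Preflow where
  E : ℕ → ℚ
  r : ℕ → ℕ → ℚ
  d : ℕ → ℕ

namespace Preflow

/-- The invariant of the push-relabel method with initial excesses `E₀` and capacities `r₀`. -/
structure Valid (n : ℕ) (E₀ : ℕ → ℚ) (r₀ : ℕ → ℕ → ℚ) (F : Preflow) : Prop where
  nonneg : ∀ i < n, ∀ j < n, 0 ≤ F.r i j
  steep : ∀ i < n, ∀ j < n, 0 < F.r i j → F.d i ≤ F.d j + 1
  height : ∀ i < n, F.d i ≤ n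
  symm : ∀ i < n, ∀ j < n, F.r i j + F.r j i = r₀ i j + r₀ j i
  excess : ∀ i < n, F.E i = E₀ i - ∑ j ∈ Finset.range n, (r₀ i j - F.r i j)
  deficit : ∀ i < n, F.E i < 0 → F.d i = 0 ∧ E₀ i < 0

/-- `F'` results from `F` by raising `u`. -/
structure Relabel (n : ℕ) (F F' : Preflow) (u : ℕ) : Prop where
  hu : u < n
  pos : 0 < F.E u
  low : F.d u < n
  stuck : ∀ j < n, 0 < F.r u j → F.d u ≠ F.d j + 1
  E : ∀ i < n, F'.E i = F.E i
  r : ∀ i < n, ∀ j < n, F'.r i j = F.r i j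
  d : ∀ i < n, F'.d i = if i = u then F.d u + 1 else F.d i

/-- `F'` results from `F` by pushing as much as possible from `u` to `v`. -/
structure Push (n : ℕ) (F F' : Preflow) (u v : ℕ) : Prop where
  hu : u < n
  hv : v < n
  pos : 0 < F.E u
  low : F.d u < n
  res : 0 < F.r u v
  down : F.d u = F.d v + 1
  E : ∀ i < n, F'.E i = if i = u then F.E u - min (F.E u) (F.r u v)
    else if i = v then F.E v + min (F.E u) (F.r u v) else F.E i
  r : ∀ i < n, ∀ j < n, F'.r i j = if i = u ∧ j = v then F.r u v - min (F.E u) (F.r u v)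
    else if i = v ∧ j = u then F.r v u + min (F.E u) (F.r u v) else F.r i j
  d : ∀ i < n, F'.d i = F.d i

variable {n : ℕ} {E₀ : ℕ → ℚ} {r₀ : ℕ → ℕ → ℚ} {F F' : Preflow} {u v : ℕ}

/-- No residual arc out of `u` leads exactly one level down, so after raising `u` all of them still
descend at most one level. Only vertices with positive excess rise, so deficits stay at height 0. -/
theorem Valid.relabel (hF : F.Valid n E₀ r₀) (h : Relabel n F F' u) : F'.Valid n E₀ r₀ where
  nonneg i hi j hj := by rw [h.r i hi j hj]; exact hF.nonneg i hi j hj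
  steep i hi j hj hr := by
    rw [h.r i hi j hj] at hr
    have := hF.steep i hi j hj hr
    rw [h.d i hi, h.d j hj]
    split_ifs with h1 h2 h2
    · omega
    · subst h1
      have := h.stuck j hj hr
      omega
    · subst h2; omega
    · exact this
  height i hi := by
    rw [h.d i hi]
    have := h.low
    have := hF.height i hi
    split_ifs <;> omega
  symm i hi j hj := by rw [h.r i hi j hj, h.r j hj i hi]; exact hF.symm i hi j hj
  excess i hi := by
    rw [h.E i hi, hF.excess i hi]
    congr 1
    exact Finset.sum_congr rfl fun j hj => by rw [h.r i hi j (Finset.mem_range.1 hj)]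
  deficit i hi hneg := by
    rw [h.E i hi] at hneg
    have : i ≠ u := fun e => absurd (e ▸ hneg) (not_lt.2 h.pos.le)
    rw [h.d i hi, if_neg this]
    exact hF.deficit i hi hneg

/-- The only arc that can become residual is the one from `v` to `u`, which goes up. The amount
pushed is at most the excess of `u`, so `u` gets no deficit, and `v` only gains. -/
theorem Valid.push (hF : F.Valid n E₀ r₀) (h : Push n F F' u v) : F'.Valid n E₀ r₀ := by
  have huv : u ≠ v := fun e => by have := h.down; subst e; omega
  have hδ : 0 < min (F.E u) (F.r u v) := lt_min h.pos h.res
  have hδE := min_le_left (F.E u) (F.r u v)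
  have hδr := min_le_right (F.E u) (F.r u v)
  have hE := h.E
  have hr := h.r
  generalize min (F.E u) (F.r u v) = δ at hE hr hδ hδE hδr
  refine ⟨fun i hi j hj => ?_, fun i hi j hj hpos => ?_, fun i hi => ?_, fun i hi j hj => ?_,
    fun i hi => ?_, fun i hi hneg => ?_⟩
  · have h1 := hF.nonneg i hi j hj
    have h2 := hF.nonneg v h.hv u h.hu
    rw [hr i hi j hj]
    split_ifs <;> linarith
  · rw [h.d i hi, h.d j hj]
    rw [hr i hi j hj] at hpos
    split_ifs at hpos with h1 h2
    · rw [h1.1, h1.2, h.down]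
    · rw [h2.1, h2.2]; have := h.down; omega
    · exact hF.steep i hi j hj hpos
  · rw [h.d i hi]; exact hF.height i hi
  · have h1 := hF.symm i hi j hj
    rw [hr i hi j hj, hr j hj i hi]
    by_cases e1 : i = u ∧ j = v
    · obtain ⟨rfl, rfl⟩ := e1
      simp only [and_self, if_true]
      rw [if_neg (fun e => huv e.1.symm)]
      linarith
    · by_cases e2 : i = v ∧ j = u
      · obtain ⟨rfl, rfl⟩ := e2
        simp only [and_self, if_true]
        rw [if_neg e1]
        linarith
      · rw [if_neg e1, if_neg e2, if_neg (fun e => e2 ⟨e.2, e.1⟩), if_neg (fun e => e1 ⟨e.2, e.1⟩)]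
        exact h1
  · have h1 := hF.excess i hi
    have key : ∀ j ∈ Finset.range n, r₀ i j - F'.r i j = (r₀ i j - F.r i j) +
        ((if j = v then (if i = u then δ else 0) else 0) -
          (if j = u then (if i = v then δ else 0) else 0)) := by
      intro j hj
      rw [hr i hi j (Finset.mem_range.1 hj)]
      by_cases e1 : i = u ∧ j = v
      · obtain ⟨rfl, rfl⟩ := e1
        rw [if_pos ⟨rfl, rfl⟩, if_pos rfl, if_pos rfl, if_neg huv.symm]
        ring
      · by_cases e2 : i = v ∧ j = u
        · obtain ⟨rfl, rfl⟩ := e2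
          rw [if_neg e1, if_pos ⟨rfl, rfl⟩, if_neg huv, if_pos rfl, if_pos rfl]
          ring
        · rw [if_neg e1, if_neg e2]
          have z1 : (if j = v then (if i = u then δ else 0) else 0) = 0 := by
            split_ifs with a b
            · exact absurd ⟨b, a⟩ e1
            all_goals rfl
          have z2 : (if j = u then (if i = v then δ else 0) else 0) = 0 := by
            split_ifs with a b
            · exact absurd ⟨b, a⟩ e2
            all_goals rfl
          rw [z1, z2]
          ring
    have hs : ∑ j ∈ Finset.range n, ((if j = v then (if i = u then δ else 0) else 0) -
        (if j = u then (if i = v then δ else 0) else 0)) =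
        (if i = u then δ else 0) - (if i = v then δ else 0) := by
      rw [Finset.sum_sub_distrib, Finset.sum_ite_eq', Finset.sum_ite_eq',
        if_pos (Finset.mem_range.2 h.hv), if_pos (Finset.mem_range.2 h.hu)]
    rw [Finset.sum_congr rfl key, Finset.sum_add_distrib, hs, hE i hi]
    by_cases e1 : i = u
    · subst e1
      rw [if_pos rfl, if_pos rfl, if_neg huv]
      linarith
    · rw [if_neg e1, if_neg e1]
      by_cases e2 : i = v
      · subst e2
        rw [if_pos rfl, if_pos rfl]
        linarith
      · rw [if_neg e2, if_neg e2]
        linarith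
  · rw [h.d i hi]
    rw [hE i hi] at hneg
    split_ifs at hneg with e1 e2
    · linarith
    · subst e2
      exact hF.deficit i hi (by linarith)
    · exact hF.deficit i hi hneg

/-! ### Termination of the push-relabel method -/

open Classical in
/-- The contribution of the active vertices to the potential. -/
noncomputable def actives (n : ℕ) (F : Preflow) : ℕ :=
  ∑ i ∈ Finset.range n, if 0 < F.E i then F.d i else 0

open Classical in
/-- The contribution of the pairs of vertices to the potential. -/
noncomputable def pairs (n : ℕ) (F : Preflow) : ℕ :=
  ∑ q ∈ Finset.range n ×ˢ Finset.range n,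
    ((if 0 < F.r q.1 q.2 ∨ F.d q.1 < F.d q.2 then 1 else 0) + 2 * (2 * n - F.d q.1 - F.d q.2))

/-- A potential that decreases with each operation. -/
noncomputable def potential (n : ℕ) (F : Preflow) : ℕ := actives n F + (n + 1) * pairs n F

/-- Raising `u` can switch on the indicator of a pair that contains `u`, but the height term of that
pair drops by at least 2. The pair `(u, u)` gives a strict decrease, and the factor `n + 1`
outweighs the increase of `actives` by 1. -/
theorem potential_relabel_lt (hF : F.Valid n E₀ r₀) (h : Relabel n F F' u) :
    potential n F' < potential n F := by
  classical
  have h1 : actives n F' ≤ actives n F + 1 := by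
    calc actives n F' ≤ ∑ i ∈ Finset.range n, ((if 0 < F.E i then F.d i else 0) +
          if i = u then 1 else 0) := by
          refine Finset.sum_le_sum fun i hi => ?_
          rw [h.E i (Finset.mem_range.1 hi), h.d i (Finset.mem_range.1 hi)]
          split_ifs with a b
          · rw [b]
          all_goals omega
      _ = actives n F + 1 := by
          rw [Finset.sum_add_distrib, Finset.sum_ite_eq', if_pos (Finset.mem_range.2 h.hu), actives]
  have h2 : pairs n F' + 1 ≤ pairs n F := by
    calc pairs n F' + 1 = ∑ q ∈ Finset.range n ×ˢ Finset.range n,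
          (((if 0 < F'.r q.1 q.2 ∨ F'.d q.1 < F'.d q.2 then 1 else 0) +
            2 * (2 * n - F'.d q.1 - F'.d q.2)) + if q = (u, u) then 1 else 0) := by
          rw [Finset.sum_add_distrib, Finset.sum_ite_eq', if_pos, pairs]
          exact Finset.mem_product.2 ⟨Finset.mem_range.2 h.hu, Finset.mem_range.2 h.hu⟩
      _ ≤ pairs n F := by
          refine Finset.sum_le_sum fun q hq => ?_
          obtain ⟨i, j⟩ := q
          obtain ⟨hi, hj⟩ := Finset.mem_product.1 hq
          replace hi := Finset.mem_range.1 hi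
          replace hj := Finset.mem_range.1 hj
          have := h.low
          have := hF.height i hi
          have := hF.height j hj
          simp only at *
          rw [h.r i hi j hj, h.d i hi, h.d j hj]
          by_cases a : i = u <;> by_cases b : j = u
          · subst a; subst b
            simp only [if_true]
            split_ifs <;> omega
          · subst a
            have c : ¬ ((i, j) = (i, i)) := fun e => b (Prod.ext_iff.1 e).2
            simp only [if_true, if_neg b, if_neg c]
            split_ifs <;> omega
          · subst b
            have c : ¬ ((i, j) = (j, j)) := fun e => a (Prod.ext_iff.1 e).1
            simp only [if_true, if_neg a, if_neg c]
            split_ifs <;> omega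
          · have c : ¬ ((i, j) = (u, u)) := fun e => a (Prod.ext_iff.1 e).1
            simp only [if_neg a, if_neg b, if_neg c]
            omega
  have h3 := Nat.mul_le_mul_left (n + 1) h2
  have := h.hu
  rw [mul_add] at h3
  simp only [potential]
  omega

/-- A push that does not use up the arc empties `u` and moves activity one level down. A saturating
push may activate `v`, at a price of at most `n`, but it switches off the pair `(u, v)`. The reverse
pair `(v, u)` counted before, since `v` is below `u`; this is the purpose of the height condition in
the indicator. -/
theorem potential_push_lt (hF : F.Valid n E₀ r₀) (h : Push n F F' u v) :
    potential n F' < potential n F := by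
  classical
  have huv : u ≠ v := fun e => by have := h.down; subst e; omega
  have hle : ∀ i < n, ∀ j < n,
      (if 0 < F'.r i j ∨ F'.d i < F'.d j then 1 else 0) + 2 * (2 * n - F'.d i - F'.d j) ≤
      (if 0 < F.r i j ∨ F.d i < F.d j then 1 else 0) + 2 * (2 * n - F.d i - F.d j) := by
    intro i hi j hj
    rw [h.d i hi, h.d j hj, h.r i hi j hj]
    refine Nat.add_le_add_right ?_ _
    by_cases e1 : i = u ∧ j = v
    · rw [e1.1, e1.2, if_pos (Or.inl h.res)]
      split_ifs <;> omega
    · rw [if_neg e1]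
      by_cases e2 : i = v ∧ j = u
      · have : F.d v < F.d u := by rw [h.down]; omega
        rw [e2.1, e2.2, if_pos (Or.inr this), if_pos (Or.inr this)]
      · rw [if_neg e2]
  have hheight := hF.height u h.hu
  have hdown := h.down
  have hEle : ∀ i < n, i ≠ u → i ≠ v → F'.E i = F.E i := fun i hi e1 e2 => by
    rw [h.E i hi, if_neg e1, if_neg e2]
  rcases lt_or_ge (F.E u) (F.r u v) with hlt | hge
  · have hEu : F'.E u = 0 := by
      rw [h.E u h.hu, if_pos rfl, min_eq_left hlt.le, sub_self]
    have h1 : actives n F' + F.d u ≤ actives n F + F.d v := by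
      have e1 : actives n F' + F.d u = ∑ i ∈ Finset.range n,
          ((if 0 < F'.E i then F'.d i else 0) + if i = u then F.d u else 0) := by
        rw [Finset.sum_add_distrib, Finset.sum_ite_eq', if_pos (Finset.mem_range.2 h.hu), actives]
      have e2 : actives n F + F.d v = ∑ i ∈ Finset.range n,
          ((if 0 < F.E i then F.d i else 0) + if i = v then F.d v else 0) := by
        rw [Finset.sum_add_distrib, Finset.sum_ite_eq', if_pos (Finset.mem_range.2 h.hv), actives]
      rw [e1, e2]
      refine Finset.sum_le_sum fun i hi => ?_
      replace hi := Finset.mem_range.1 hi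
      rw [h.d i hi]
      by_cases a : i = u
      · subst a
        rw [if_neg (by rw [hEu]; exact lt_irrefl 0), if_pos rfl, if_pos h.pos]
        omega
      · rw [if_neg a]
        by_cases b : i = v
        · subst b
          rw [if_pos rfl]
          split_ifs <;> omega
        · rw [hEle i hi a b, if_neg b]
    have h2 : pairs n F' ≤ pairs n F := Finset.sum_le_sum fun q hq => by
      obtain ⟨hi, hj⟩ := Finset.mem_product.1 hq
      exact hle _ (Finset.mem_range.1 hi) _ (Finset.mem_range.1 hj)
    have := Nat.mul_le_mul_left (n + 1) h2
    simp only [potential]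
    omega
  · have hr : F'.r u v = 0 := by
      rw [h.r u h.hu v h.hv, if_pos ⟨rfl, rfl⟩, min_eq_right hge, sub_self]
    have h1 : actives n F' ≤ actives n F + F.d v := by
      have e2 : actives n F + F.d v = ∑ i ∈ Finset.range n,
          ((if 0 < F.E i then F.d i else 0) + if i = v then F.d v else 0) := by
        rw [Finset.sum_add_distrib, Finset.sum_ite_eq', if_pos (Finset.mem_range.2 h.hv), actives]
      rw [e2]
      refine Finset.sum_le_sum fun i hi => ?_
      replace hi := Finset.mem_range.1 hi
      rw [h.d i hi]
      by_cases a : i = u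
      · subst a
        rw [if_pos h.pos]
        split_ifs <;> omega
      · by_cases b : i = v
        · subst b
          rw [if_pos rfl]
          split_ifs <;> omega
        · rw [hEle i hi a b, if_neg b]
          omega
    have h2 : pairs n F' + 1 ≤ pairs n F := by
      calc pairs n F' + 1 = ∑ q ∈ Finset.range n ×ˢ Finset.range n,
            (((if 0 < F'.r q.1 q.2 ∨ F'.d q.1 < F'.d q.2 then 1 else 0) +
              2 * (2 * n - F'.d q.1 - F'.d q.2)) + if q = (u, v) then 1 else 0) := by
            rw [Finset.sum_add_distrib, Finset.sum_ite_eq', if_pos, pairs]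
            exact Finset.mem_product.2 ⟨Finset.mem_range.2 h.hu, Finset.mem_range.2 h.hv⟩
        _ ≤ pairs n F := by
            refine Finset.sum_le_sum fun q hq => ?_
            obtain ⟨i, j⟩ := q
            obtain ⟨hi, hj⟩ := Finset.mem_product.1 hq
            have hi : i < n := Finset.mem_range.1 hi
            have hj : j < n := Finset.mem_range.1 hj
            by_cases e : (i, j) = (u, v)
            · have e1 : i = u := congrArg Prod.fst e
              have e2 : j = v := congrArg Prod.snd e
              subst e1 e2
              simp only
              rw [if_pos trivial, if_pos (Or.inl h.res), hr, h.d _ hi, h.d _ hj, if_neg (by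
                simp only [lt_irrefl, false_or]; omega)]
              omega
            · rw [if_neg e]
              exact hle i hi j hj
    have := Nat.mul_le_mul_left (n + 1) h2
    rw [mul_add] at this
    simp only [potential]
    omega

theorem Valid.potential_le (hF : F.Valid n E₀ r₀) : potential n F ≤ (n + 1) ^ 8 := by
  classical
  have h1 : actives n F ≤ n * n := by
    refine (Finset.sum_le_card_nsmul _ _ n fun i hi => ?_).trans (by simp)
    have := hF.height i (Finset.mem_range.1 hi)
    split_ifs <;> omega
  have h2 : pairs n F ≤ n * n * (4 * n + 1) := by
    refine (Finset.sum_le_card_nsmul _ _ (4 * n + 1) fun q _ => ?_).trans (by simp)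
    split_ifs <;> omega
  rcases Nat.eq_zero_or_pos n with rfl | hn
  · simp only [potential]; omega
  have h3 := Nat.mul_le_mul_left (n + 1) h2
  -- The exponent 8 is generous: four powers of `n + 1` absorb the constant 5.
  have h4 : 5 ≤ (n + 1) ^ 4 :=
    (by norm_num : 5 ≤ 2 ^ 4).trans (Nat.pow_le_pow_left (by omega) 4)
  calc potential n F ≤ n * n + (n + 1) * (n * n * (4 * n + 1)) := by
        simp only [potential]; omega
    _ ≤ 5 * (n + 1) ^ 4 := by nlinarith [Nat.zero_le (n ^ 3), Nat.zero_le (n ^ 2)]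
    _ ≤ (n + 1) ^ 4 * (n + 1) ^ 4 := Nat.mul_le_mul_right _ h4
    _ = (n + 1) ^ 8 := by ring

/-! ### Optimality of the cut at an empty level -/

/-- No operation applies. -/
def Final (n : ℕ) (F : Preflow) : Prop := ∀ i < n, 0 < F.E i → n ≤ F.d i

/-- Pigeonhole: `n` vertices cannot occupy all of the `n + 1` levels `0, …, n`. Residual arcs
descend at most one level, so none descends across an empty level, which thus yields a minimum cut
without a reachability search. -/
theorem exists_empty_level (n : ℕ) (d : ℕ → ℕ) : ∃ l ≤ n, ∀ i < n, d i ≠ l := by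
  by_contra! h
  have hsub : Finset.range (n + 1) ⊆ (Finset.range n).image d := fun l hl => by
    obtain ⟨i, hi, e⟩ := h l (Nat.lt_succ_iff.1 (Finset.mem_range.1 hl))
    exact Finset.mem_image.2 ⟨i, Finset.mem_range.2 hi, e⟩
  have := (Finset.card_le_card hsub).trans Finset.card_image_le
  simp at this

end Preflow

open Classical in
/-- The initial excesses for the bipartite graph on `S` with sides split at `p`. -/
noncomputable def initExcess (S : Finset ℕ) (p : ℕ) (w : ℕ → ℚ) (i : ℕ) : ℚ :=
  if i ∈ S then if i < p then w i else - w i else 0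

open Classical in
/-- The initial capacities for the bipartite graph on `S` with sides split at `p`. -/
noncomputable def initCapacity (H : SimpleGraph ℕ) (S : Finset ℕ) (p : ℕ) (w : ℕ → ℚ)
    (i j : ℕ) : ℚ :=
  if i ∈ S ∧ j ∈ S ∧ H.Adj i j ∧ i < p ∧ p ≤ j then w i + w j else 0

/-- The independent set that is read off from an empty level `l`. -/
def cutSet (S : Finset ℕ) (p l : ℕ) (d : ℕ → ℕ) : Finset ℕ :=
  S.filter fun i => i < p ∧ l < d i ∨ p ≤ i ∧ d i ≤ l

/-- Weighted König duality. For `a` on the left side `A` and `b` on the right side `B`, `F.r b a` is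
the flow from `a` to `b`. Complements of independent sets are vertex covers. Each cover weighs at
least the sum over `b` of `w b` (if `b` is above level `l`) or of the inflow of `b` (if below), and
the complement of the cut set attains this value. -/
theorem cutSet_isMax {n p l : ℕ} {H : SimpleGraph ℕ} {S : Finset ℕ} {w : ℕ → ℚ} {F : Preflow}
    (hS : S ⊆ Finset.range n) (hw : ∀ i ∈ S, 0 < w i)
    (hbip : ∀ u ∈ S, ∀ v ∈ S, u < v → H.Adj u v → u < p ∧ p ≤ v)
    (hF : F.Valid n (initExcess S p w) (initCapacity H S p w)) (hfin : F.Final n)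
    (hl : l ≤ n) (hempty : ∀ i < n, F.d i ≠ l) :
    H.IsIndepSet (cutSet S p l F.d : Set ℕ) ∧
    ∀ T ⊆ S, H.IsIndepSet (T : Set ℕ) → ∑ i ∈ T, w i ≤ ∑ i ∈ cutSet S p l F.d, w i := by
  classical
  set A := S.filter (· < p) with hA
  set B := S.filter (fun i => ¬ i < p) with hB
  have hAn : ∀ a ∈ A, a < n := fun a ha => Finset.mem_range.1 (hS (Finset.mem_filter.1 ha).1)
  have hBn : ∀ a ∈ B, a < n := fun a ha => Finset.mem_range.1 (hS (Finset.mem_filter.1 ha).1)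
  have hAS : ∀ a ∈ A, a ∈ S ∧ a < p := fun a ha => Finset.mem_filter.1 ha
  have hBS : ∀ b ∈ B, b ∈ S ∧ p ≤ b := fun b hb => by
    simpa [hB] using hb
  have hcap0 : ∀ i j, (j < p ∨ p ≤ i) → initCapacity H S p w i j = 0 := fun i j h => by
    rw [initCapacity, if_neg]; rintro ⟨-, -, -, h1, h2⟩; omega
  have hzero : ∀ i < n, ∀ j < n, initCapacity H S p w i j = 0 → initCapacity H S p w j i = 0 →
      F.r i j = 0 := fun i hi j hj h1 h2 => by
    have := hF.symm i hi j hj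
    have := hF.nonneg i hi j hj
    have := hF.nonneg j hj i hi
    linarith
  have hEA : ∀ a ∈ A, F.E a = w a - ∑ b ∈ B, F.r b a := by
    intro a ha
    rw [hF.excess a (hAn a ha), initExcess, if_pos (hAS a ha).1, if_pos (hAS a ha).2]
    congr 1
    have h1 : ∑ b ∈ B, F.r b a = ∑ b ∈ Finset.range n, F.r b a := by
      refine Finset.sum_subset (fun b hb => Finset.mem_range.2 (hBn b hb)) fun b hb hbB => ?_
      refine hzero b (Finset.mem_range.1 hb) a (hAn a ha) (hcap0 _ _ (Or.inl (hAS a ha).2)) ?_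
      rw [initCapacity, if_neg]
      rintro ⟨-, h2, -, -, h3⟩
      exact hbB (Finset.mem_filter.2 ⟨h2, not_lt.2 h3⟩)
    rw [h1]
    refine Finset.sum_congr rfl fun b hb => ?_
    have h2 := hF.symm a (hAn a ha) b (Finset.mem_range.1 hb)
    have h3 := hcap0 b a (Or.inl (hAS a ha).2)
    linarith
  have hEB : ∀ b ∈ B, F.E b = ∑ a ∈ A, F.r b a - w b := by
    intro b hb
    rw [hF.excess b (hBn b hb), initExcess, if_pos (hBS b hb).1, if_neg (not_lt.2 (hBS b hb).2)]
    have h1 : ∑ a ∈ A, F.r b a = ∑ a ∈ Finset.range n, F.r b a := by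
      refine Finset.sum_subset (fun a ha => Finset.mem_range.2 (hAn a ha)) fun a ha haA => ?_
      refine hzero b (hBn b hb) a (Finset.mem_range.1 ha) (hcap0 _ _ (Or.inr (hBS b hb).2)) ?_
      rw [initCapacity, if_neg]
      rintro ⟨h2, -, -, h3, -⟩
      exact haA (Finset.mem_filter.2 ⟨h2, h3⟩)
    rw [h1, Finset.sum_congr rfl fun a _ => by
      rw [hcap0 b a (Or.inr (hBS b hb).2), zero_sub], Finset.sum_neg_distrib]
    ring
  -- Deficits occur only where there was one initially, that is, on the right side.
  have hEAnn : ∀ a ∈ A, 0 ≤ F.E a := by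
    intro a ha
    by_contra! hneg
    have := (hF.deficit a (hAn a ha) hneg).2
    rw [initExcess, if_pos (hAS a ha).1, if_pos (hAS a ha).2] at this
    exact absurd this (not_lt.2 (hw a (hAS a ha).1).le)
  -- In a final preflow, vertices with excess have height at least `n ≥ l`, hence lie above the
  -- empty level.
  have hlow : ∀ i < n, ¬ l < F.d i → F.E i ≤ 0 := by
    intro i hi h
    by_contra! hpos
    have := hfin i hi hpos
    have := hempty i hi
    omega
  have hrnn : ∀ b ∈ B, ∀ a ∈ A, 0 ≤ F.r b a := fun b hb a ha =>
    hF.nonneg b (hBn b hb) a (hAn a ha)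
  -- Otherwise the arc from `a` to `b` would be saturated and carry its capacity `w a + w b`, more
  -- than `a` can ever send. The capacities are thus as good as infinite.
  have hup : ∀ a ∈ A, ∀ b ∈ B, H.Adj a b → l < F.d a → l < F.d b := by
    intro a ha b hb hab hla
    by_contra! hlb
    have h1 : F.r a b = 0 := by
      refine le_antisymm (not_lt.1 fun hpos => ?_) (hF.nonneg a (hAn a ha) b (hBn b hb))
      have := hF.steep a (hAn a ha) b (hBn b hb) hpos
      have := hempty b (hBn b hb)
      omega
    have h2 := hF.symm a (hAn a ha) b (hBn b hb)
    rw [h1, hcap0 b a (Or.inl (hAS a ha).2), initCapacity,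
      if_pos ⟨(hAS a ha).1, (hBS b hb).1, hab, (hAS a ha).2, (hBS b hb).2⟩] at h2
    have h3 := Finset.single_le_sum (f := fun b => F.r b a) (fun b hb => hrnn b hb a ha) hb
    have h4 := hEAnn a ha
    have h5 := hw b (hBS b hb).1
    rw [hEA a ha] at h4
    linarith
  have hcross : ∀ u ∈ S, ∀ v ∈ S, H.Adj u v → u ∈ A ∧ v ∈ B ∨ u ∈ B ∧ v ∈ A := by
    intro u hu v hv huv
    rcases lt_trichotomy u v with h | h | h
    · have := hbip u hu v hv h huv
      exact Or.inl ⟨Finset.mem_filter.2 ⟨hu, this.1⟩, Finset.mem_filter.2 ⟨hv, not_lt.2 this.2⟩⟩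
    · exact absurd h huv.ne
    · have := hbip v hv u hu h huv.symm
      exact Or.inr ⟨Finset.mem_filter.2 ⟨hu, not_lt.2 this.2⟩, Finset.mem_filter.2 ⟨hv, this.1⟩⟩
  constructor
  · have key : ∀ a ∈ A, ∀ b ∈ B, a ∈ cutSet S p l F.d → b ∈ cutSet S p l F.d → ¬ H.Adj a b := by
      intro a ha b hb hac hbc hab
      have h1 := (Finset.mem_filter.1 hac).2
      have h2 := (Finset.mem_filter.1 hbc).2
      have := hAS a ha
      have := hBS b hb
      have := hup a ha b hb hab (by omega)
      omega
    intro u hu v hv _ huv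
    have hu' := Finset.mem_coe.1 hu
    have hv' := Finset.mem_coe.1 hv
    rcases hcross u (Finset.mem_filter.1 hu').1 v (Finset.mem_filter.1 hv').1 huv with h | h
    · exact key u h.1 v h.2 hu' hv' huv
    · exact key v h.2 u h.1 hv' hu' huv.symm
  · intro T hTS hT
    have hsum : ∀ X : Finset ℕ, X ⊆ S → ∑ i ∈ X, w i =
        ∑ i ∈ S, w i - (∑ a ∈ A, (if a ∈ X then 0 else w a) + ∑ b ∈ B, if b ∈ X then 0 else w b) := by
      intro X hX
      rw [hA, hB, Finset.sum_filter_add_sum_filter_not, ← Finset.sum_sub_distrib,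
        ← Finset.sum_subset hX]
      · refine Finset.sum_congr rfl fun i hi => ?_
        rw [if_pos hi, sub_zero]
      · intro i _ hi
        rw [if_neg hi, sub_self]
    rw [hsum T hTS, hsum (cutSet S p l F.d) (Finset.filter_subset _ _)]
    -- A left vertex outside `T` pays for the flow it sends, at most its weight. If `b ∈ T`, all
    -- neighbours of `b` are outside `T`, so its whole inflow is paid for, and above `l` this is at
    -- least `w b` since deficits have height 0. If `b ∉ T`, then `b` pays `w b`, and below `l` its
    -- inflow is at most that.
    have hTle : ∑ b ∈ B, (if l < F.d b then w b else ∑ a ∈ A, F.r b a) ≤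
        ∑ a ∈ A, (if a ∈ T then 0 else w a) + ∑ b ∈ B, if b ∈ T then 0 else w b := by
      have h1 : ∑ a ∈ A, ∑ b ∈ B, (if a ∈ T then 0 else F.r b a) ≤
          ∑ a ∈ A, if a ∈ T then 0 else w a := by
        refine Finset.sum_le_sum fun a ha => ?_
        split_ifs with h
        · simp
        · have := hEAnn a ha
          rw [hEA a ha] at this
          linarith
      refine le_trans ?_ (add_le_add_left h1 _)
      rw [Finset.sum_comm, ← Finset.sum_add_distrib]
      refine Finset.sum_le_sum fun b hb => ?_
      have hE := hEB b hb
      by_cases hbT : b ∈ T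
      · rw [if_pos hbT, add_zero]
        have h2 : ∑ a ∈ A, (if a ∈ T then 0 else F.r b a) = ∑ a ∈ A, F.r b a := by
          refine Finset.sum_congr rfl fun a ha => ?_
          split_ifs with haT
          · have hnadj : ¬ H.Adj a b := fun h => hT haT hbT h.ne h
            refine (hzero b (hBn b hb) a (hAn a ha) (hcap0 _ _ (Or.inl (hAS a ha).2)) ?_).symm
            rw [initCapacity, if_neg fun h => hnadj h.2.2.1]
          · rfl
        rw [h2]
        split_ifs with hbl
        · have : 0 ≤ F.E b := by
            by_contra! hneg
            have := (hF.deficit b (hBn b hb) hneg).1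
            omega
          linarith
        · exact le_rfl
      · rw [if_neg hbT]
        have h2 : 0 ≤ ∑ a ∈ A, (if a ∈ T then 0 else F.r b a) :=
          Finset.sum_nonneg fun a ha => by
            split_ifs
            · exact le_rfl
            · exact hrnn b hb a ha
        split_ifs with hbl
        · linarith
        · have := hlow b (hBn b hb) hbl
          linarith
    -- A left vertex below `l` has excess 0, so its weight is exactly what it sends. It sends
    -- nothing to a right vertex above `l`, since the residual arc back would descend across the
    -- empty level.
    have hcut : ∑ a ∈ A, (if a ∈ cutSet S p l F.d then 0 else w a) +
        ∑ b ∈ B, (if b ∈ cutSet S p l F.d then 0 else w b) ≤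
        ∑ b ∈ B, (if l < F.d b then w b else ∑ a ∈ A, F.r b a) := by
      have h1 : ∑ a ∈ A, (if a ∈ cutSet S p l F.d then 0 else w a) =
          ∑ a ∈ A, ∑ b ∈ B, if l < F.d a then 0 else F.r b a := by
        refine Finset.sum_congr rfl fun a ha => ?_
        have hmem : a ∈ cutSet S p l F.d ↔ l < F.d a := by
          have := hAS a ha
          rw [cutSet, Finset.mem_filter]
          constructor
          · rintro ⟨-, h⟩; omega
          · exact fun h => ⟨this.1, Or.inl ⟨this.2, h⟩⟩
        by_cases h : l < F.d a
        · rw [if_pos (hmem.2 h)]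
          simp [h]
        · rw [if_neg (mt hmem.1 h)]
          simp only [h, if_false]
          have h2 := hEAnn a ha
          have h3 := hlow a (hAn a ha) h
          rw [hEA a ha] at h2 h3
          linarith
      rw [h1, Finset.sum_comm, ← Finset.sum_add_distrib]
      refine Finset.sum_le_sum fun b hb => ?_
      have hmem : b ∈ cutSet S p l F.d ↔ ¬ l < F.d b := by
        have := hBS b hb
        rw [cutSet, Finset.mem_filter]
        constructor
        · rintro ⟨-, h⟩; omega
        · exact fun h => ⟨this.1, Or.inr ⟨this.2, not_lt.1 h⟩⟩
      by_cases h : l < F.d b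
      · rw [if_neg (fun h' => hmem.1 h' h), if_pos h, Finset.sum_eq_zero, zero_add]
        intro a ha
        split_ifs with hal
        · rfl
        · refine le_antisymm (not_lt.1 fun hpos => ?_) (hrnn b hb a ha)
          have := hF.steep b (hBn b hb) a (hAn a ha) hpos
          have := hempty a (hAn a ha)
          omega
      · rw [if_pos (hmem.2 h), if_neg h, add_zero]
        refine Finset.sum_le_sum fun a ha => ?_
        split_ifs
        · exact hrnn b hb a ha
        · exact le_rfl
    linarith

end Flow

namespace RAM
open FProg

/-! ### The program: basic pieces

Integer variables: `0` holds `n`, `1` holds `n + 1`, `2` holds the number `L` of digits, `3` holds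
`M = (n + 1) ^ L`, `4` is the current code; the others are local. Integer arrays: `0` is the
adjacency matrix, `1` the output, `2` the row offsets, `3` the marked vertices, `4` the remaining
vertices, `5` the chosen vertices, `6` the chain counts, `7` the heights. Weight variables: `0` is
the weight of the output. Weight arrays: `0` holds the weights, `1` the excesses and `2` the residual
capacities. -/

/-- Strict comparison of integers. -/
@[simp] def Test.lt (e f : Expr) : Test := .not (.le f e)

/-- Equality of integers. -/
@[simp] def Test.eq (e f : Expr) : Test := .and (.le e f) (.le f e)

/-- Strict comparison of weights. -/
@[simp] def Test.wlt (e f : WExpr) : Test := .not (.wle f e)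

/-- Membership in the set stored in an array. -/
@[simp] def Test.mem (a : ℕ) (e : Expr) : Test := .le (.const 1) (.get a e)

/-- The adjacency test. -/
@[simp] def Test.adj (e f : Expr) : Test := .le (.const 1) (.get 0 (.add (.get 2 e) f))

/-- Conjunction of a list of tests. -/
def Test.all : List Test → Test
  | [] => .le (.const 0) (.const 0)
  | b :: l => .and b (Test.all l)

@[simp] theorem Test.all_holds (s : State) (l : List Test) :
    (Test.all l).Holds s ↔ ∀ b ∈ l, b.Holds s := by
  induction l with
  | nil => simp [Test.all]
  | cons b l ih => simp [Test.all, ih]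

/-- The memory contains the graph `H`, the weights `w` and the parameters of the algorithm. -/
structure Input (n : ℕ) (H : SimpleGraph ℕ) (w : ℕ → ℚ) (L M : ℕ) (s : State) : Prop where
  size : s.var 0 = n
  size' : s.var 1 = n + 1
  digits : s.var 2 = L
  codes : s.var 3 = M
  row : ∀ i ≤ n, s.arr 2 i = i * n
  adj : ∀ i ≤ n, ∀ j < n, 1 ≤ s.arr 0 (i * n + j) ↔ H.Adj i j
  weight : ∀ i < n, s.warr 0 i = w i

/-- `p` does not write the input and the parameters of the algorithm. -/
@[simp] def FProg.KeepsInput (p : FProg) : Prop :=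
  p.KeepsVar 0 ∧ p.KeepsVar 1 ∧ p.KeepsVar 2 ∧ p.KeepsVar 3 ∧ p.KeepsArr 0 ∧ p.KeepsArr 2 ∧
    p.KeepsWArr 0

variable {n : ℕ} {H : SimpleGraph ℕ} {w : ℕ → ℚ} {L M : ℕ} {s r : State}

theorem Input.of_frame (h : Input n H w L M s) {p : FProg} (hp : p.KeepsInput)
    (hf : Frame p s r) : Input n H w L M r := by
  obtain ⟨h0, h1, h2, h3, h4, h5, h6⟩ := hp
  refine ⟨?_, ?_, ?_, ?_, ?_, ?_, ?_⟩
  · rw [hf.var 0 h0, h.size]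
  · rw [hf.var 1 h1, h.size']
  · rw [hf.var 2 h2, h.digits]
  · rw [hf.var 3 h3, h.codes]
  · rw [hf.arr 2 h5]; exact h.row
  · rw [hf.arr 0 h4]; exact h.adj
  · rw [hf.warr 0 h6]; exact h.weight

theorem Input.run (h : Input n H w L M s) {p : FProg} (hp : p.KeepsInput) :
    Input n H w L M (p.run s) := h.of_frame hp (frame_run p s)

theorem Input.adj_get (h : Input n H w L M s) {i j : ℕ} (hi : i ≤ n) (hj : j < n) :
    1 ≤ s.arr 0 (s.arr 2 i + j) ↔ H.Adj i j := by
  rw [h.row i hi, h.adj i hi j hj]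

/-- The set of vertices stored in an array. -/
def vset (n : ℕ) (s : State) (a : ℕ) : Finset ℕ := (Finset.range n).filter fun v => 1 ≤ s.arr a v

theorem mem_vset {a v : ℕ} : v ∈ vset n s a ↔ v < n ∧ 1 ≤ s.arr a v := by
  simp [vset]

theorem vset_congr {a : ℕ} (h : r.arr a = s.arr a) : vset n r a = vset n s a := by
  simp [vset, h]

theorem vset_subset {a : ℕ} : vset n s a ⊆ Finset.range n := Finset.filter_subset _ _

/-- Fill the first cells of an array. -/
def fillP (a c y : ℕ) : FProg := .for_ 5 y (.store a (.var 5) (.const c))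

theorem run_fillP {a c y : ℕ} :
    ∀ i < s.var y, (run (fillP a c y) s).arr a i = c := by
  refine run_for (p := .store a (.var 5) (.const c)) (x := 5) (by simp)
    (fun j r => ∀ i < j, r.arr a i = c) (by simp) ?_
  intro j r _ hj _ ih i hi
  simp only [run, State.setVar_arr, State.setArr_arr_apply, Expr.eval, hj, true_and]
  split_ifs with h
  · rfl
  · exact ih i (by omega)

/-- Division of variable `9` by variable `1`, with the quotient in variable `10`. -/
def divP : FProg :=
  .seq (.assign 10 (.const 0)) (.for_ 5 3 (.cond (.le (.var 1) (.var 9))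
    (.seq (.assign 9 (.sub (.var 9) (.var 1))) (.assign 10 (.add (.var 10) (.const 1)))) .nop))

/-- The bound of the loop exceeds `x`, hence the quotient; once the remainder is less than the
divisor, the rounds are idle. -/
theorem run_divP {x b : ℕ} (hx : s.var 9 = x) (hb : s.var 1 = b) (hb0 : 0 < b)
    (hM : x < s.var 3) :
    (run divP s).var 9 = x % b ∧ (run divP s).var 10 = x / b := by
  have key := run_for (x := 5) (y := 3) (s := run (.assign 10 (.const 0)) s)
    (p := .cond (.le (.var 1) (.var 9))
    (.seq (.assign 9 (.sub (.var 9) (.var 1))) (.assign 10 (.add (.var 10) (.const 1)))) .nop)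
    (by simp)
    (fun i r => r.var 1 = b ∧ r.var 9 + b * r.var 10 = x ∧ (r.var 10 = i ∨ r.var 9 < b))
    (by simp [run, hx, hb]) (by
      rintro i r - - - ⟨h1, h2, h3⟩
      simp only [run, Test.Holds, Expr.eval, h1]
      split_ifs with h
      · simp [h1]
        refine ⟨?_, ?_⟩
        · rw [mul_add, mul_one]; omega
        · omega
      · simp [h1, h2]; omega)
  obtain ⟨-, h2, h3⟩ := key
  change _ + b * (run divP s).var 10 = x at h2
  change (run divP s).var 10 = _ ∨ (run divP s).var 9 < b at h3
  change (run divP s).var 9 + _ = x at h2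
  have hlt : (run divP s).var 9 < b := by
    rcases h3 with h3 | h3
    · simp only [run, State.setVar_var] at h3
      norm_num at h3
      have := Nat.le_mul_of_pos_left (s.var 3) hb0
      rw [h3] at h2
      omega
    · exact h3
  rw [← h2]
  constructor
  · rw [Nat.add_mul_mod_self_left, Nat.mod_eq_of_lt hlt]
  · rw [Nat.add_mul_div_left _ _ hb0, Nat.div_eq_of_lt hlt, zero_add]

/-- Mark the digits of the current code. -/
def decodeP : FProg :=
  .seq (fillP 3 0 1) (.seq (.assign 9 (.var 4)) (.for_ 6 2
    (.seq divP (.seq (.store 3 (.var 9) (.const 1)) (.assign 9 (.var 10))))))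

/-- A padding digit `n` marks cell `n`, which `vset` ignores. -/
theorem run_decodeP {c : ℕ} (h : Input n H w L M s) (hc : s.var 4 = c) (hM : c < M) :
    vset n (run decodeP s) 3 = digitSet n L c := by
  have h0 := h.run (p := fillP 3 0 1) (by simp [fillP])
  have hc0 : (run (fillP 3 0 1) s).var 4 = c := by
    rw [(frame_run _ _).var 4 (by simp [fillP]), hc]
  have hfill : ∀ v < n, (run (fillP 3 0 1) s).arr 3 v = 0 := fun v hv =>
    run_fillP v (by rw [h.size']; omega)
  simp only [decodeP, run]
  have key := run_for (x := 6) (y := 2) (s := (run (fillP 3 0 1) s).setVar 9 c)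
    (p := .seq divP (.seq (.store 3 (.var 9) (.const 1)) (.assign 9 (.var 10))))
    (by simp [divP])
    (fun i r => r.var 9 = c / (n + 1) ^ i ∧
      ∀ v < n, 1 ≤ r.arr 3 v ↔ ∃ j < i, c / (n + 1) ^ j % (n + 1) = v)
    (by
      refine ⟨by simp, fun v hv => ?_⟩
      simp [hfill v hv]) (by
      rintro i r - - hf ⟨h1, h2⟩
      have e1 : r.var 1 = n + 1 := by
        rw [hf.var 1 (by simp [divP])]
        simp [h0.size']
      have e3 : r.var 3 = M := by
        rw [hf.var 3 (by simp [divP])]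
        simp [h0.codes]
      obtain ⟨d1, d2⟩ := run_divP h1 e1 (Nat.succ_pos n)
        (by rw [e3]; exact (Nat.div_le_self _ _).trans_lt hM)
      have d3 : (run divP r).arr 3 = r.arr 3 := (frame_run _ _).arr 3 (by simp [divP])
      simp only [run, Expr.eval, d1]
      refine ⟨by simp [Nat.div_div_eq_div_mul, pow_succ, d2], fun v hv => ?_⟩
      simp only [State.setVar_arr, State.setArr_arr_apply, true_and, d3]
      split_ifs with hv'
      · simp only [le_refl, true_iff]
        exact ⟨i, by omega, hv'.symm⟩
      · rw [h2 v hv]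
        constructor
        · rintro ⟨j, hj, e⟩; exact ⟨j, by omega, e⟩
        · rintro ⟨j, hj, e⟩
          rcases Nat.lt_succ_iff_lt_or_eq.1 hj with hj | rfl
          · exact ⟨j, hj, e⟩
          · exact absurd e.symm hv')
  have eL : ((run (fillP 3 0 1) s).setVar 9 c).var 2 = L := by simp [h0.digits]
  rw [eL] at key
  ext v
  rw [mem_vset, digitSet, Finset.mem_filter, Finset.mem_range, Expr.eval, hc0]
  constructor
  · rintro ⟨hv, hm⟩; exact ⟨hv, (key.2 v hv).1 hm⟩
  · rintro ⟨hv, hm⟩; exact ⟨hv, (key.2 v hv).2 hm⟩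

/-! ### Counting chains -/

/-- Run `p` for all values of the variables `20, …, 20 + m - 1`. -/
def tupleLoop (p : FProg) : ℕ → FProg
  | 0 => p
  | m + 1 => .for_ (20 + m) 0 (tupleLoop p m)

open Classical in
/-- The number of ways to choose the first `m` entries of `g` below `n` such that `Q` holds. -/
noncomputable def countTuples (n : ℕ) (Q : (ℕ → ℕ) → Prop) : ℕ → (ℕ → ℕ) → ℕ
  | 0, g => if Q g then 1 else 0
  | m + 1, g => ∑ x ∈ Finset.range n, countTuples n Q m (Function.update g m x)

theorem countTuples_congr {Q : (ℕ → ℕ) → Prop} {m : ℕ} {g g' : ℕ → ℕ}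
    (h : ∀ j, m ≤ j → g j = g' j) : countTuples n Q m g = countTuples n Q m g' := by
  induction m generalizing g g' with
  | zero => rw [funext fun j => h j (Nat.zero_le j)]
  | succ m ih =>
    refine Finset.sum_congr rfl fun x _ => ih fun j hj => ?_
    rcases Nat.eq_or_lt_of_le hj with rfl | hlt
    · simp
    · rw [Function.update_of_ne (by omega), Function.update_of_ne (by omega), h j hlt]

theorem tupleLoop_keepsVar {p : FProg} {m z : ℕ} (hp : p.KeepsVar z) (hz : z < 20 ∨ 20 + m ≤ z) :
    (tupleLoop p m).KeepsVar z := by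
  induction m with
  | zero => exact hp
  | succ m ih => exact ⟨by omega, ih (by omega)⟩

theorem tupleLoop_keepsArr {p : FProg} {m z : ℕ} (hp : p.KeepsArr z) :
    (tupleLoop p m).KeepsArr z := by
  induction m with
  | zero => exact hp
  | succ m ih => exact ih

theorem tupleLoop_keepsWVar {p : FProg} {m z : ℕ} (hp : p.KeepsWVar z) :
    (tupleLoop p m).KeepsWVar z := by
  induction m with
  | zero => exact hp
  | succ m ih => exact ih

theorem tupleLoop_keepsWArr {p : FProg} {m z : ℕ} (hp : p.KeepsWArr z) :
    (tupleLoop p m).KeepsWArr z := by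
  induction m with
  | zero => exact hp
  | succ m ih => exact ih

/-- Count one tuple in the cell `6, v`, where `v` is the variable `7`. -/
def tallyP (b : Test) : FProg :=
  .cond b (.store 6 (.var 7) (.add (.get 6 (.var 7)) (.const 1))) .nop

/-- `s` and `r` agree on everything but tuple variables and counts. -/
def TallyFrame (s r : State) : Prop :=
  (∀ z < 20, r.var z = s.var z) ∧ (∀ a, a ≠ 6 → r.arr a = s.arr a) ∧ ∀ a, r.warr a = s.warr a

/-- The outermost loop has the largest index, so while the inner `m` loops run, the variables `20 +
j` with `m ≤ j` are fixed. The induction on `m` thus follows the recursion of `countTuples`. -/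
theorem run_tupleLoop {b : Test} {Q : (ℕ → ℕ) → Prop} {T : ℕ} (hn : s.var 0 = n)
    (hb : ∀ r, TallyFrame s r → (∀ j < T, r.var (20 + j) < n) →
      (b.Holds r ↔ Q fun j => r.var (20 + j))) (m : ℕ) (hm : m ≤ T) (r : State)
    (hr : TallyFrame s r) (hlt : ∀ j, m ≤ j → j < T → r.var (20 + j) < n) :
    (∀ v, v ≠ s.var 7 → (run (tupleLoop (tallyP b) m) r).arr 6 v = r.arr 6 v) ∧
    (run (tupleLoop (tallyP b) m) r).arr 6 (s.var 7) =
      r.arr 6 (s.var 7) + countTuples n Q m fun j => r.var (20 + j) := by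
  induction m generalizing r with
  | zero =>
    have h7 : r.var 7 = s.var 7 := hr.1 7 (by norm_num)
    have := hb r hr fun j hj => hlt j (Nat.zero_le j) hj
    by_cases h : b.Holds r
    · have hQ := this.1 h
      refine ⟨fun v hv => ?_, ?_⟩
      · simp [tupleLoop, tallyP, run, h, h7, hv]
      · simp [tupleLoop, tallyP, run, countTuples, h, hQ, h7]
    · have hQ := mt this.2 h
      simp [tupleLoop, tallyP, run, countTuples, h, hQ]
  | succ m ih =>
    have h0 : r.var 0 = n := by rw [hr.1 0 (by norm_num), hn]
    have key := run_for (x := 20 + m) (y := 0) (s := r) (p := tupleLoop (tallyP b) m)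
      (tupleLoop_keepsVar (by simp [tallyP]) (Or.inr le_rfl))
      (fun i q => (∀ v, v ≠ s.var 7 → q.arr 6 v = r.arr 6 v) ∧
        q.arr 6 (s.var 7) = r.arr 6 (s.var 7) + ∑ x ∈ Finset.range i,
          countTuples n Q m (Function.update (fun j => r.var (20 + j)) m x))
      (by simp) (by
        rintro i q hi hq hf ⟨h1, h2⟩
        have hk : ∀ z, z < 20 ∨ 20 + (m + 1) ≤ z → q.var z = r.var z := fun z hz =>
          hf.var z (tupleLoop_keepsVar (m := m + 1) (p := tallyP b) (by simp [tallyP]) hz)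
        have hqs : TallyFrame s q :=
          ⟨fun z hz => (hk z (Or.inl hz)).trans (hr.1 z hz), fun a ha =>
            (hf.arr a (tupleLoop_keepsArr (m := m + 1) (p := tallyP b)
              (by simp [tallyP, ha]))).trans (hr.2.1 a ha), fun a =>
            (hf.warr a (tupleLoop_keepsWArr (m := m + 1) (p := tallyP b)
              (by simp [tallyP]))).trans (hr.2.2 a)⟩
        obtain ⟨i1, i2⟩ := ih (by omega) q hqs fun j hmj hjT => by
          rcases Nat.eq_or_lt_of_le hmj with rfl | hlt'
          · rw [hq, ← h0]; exact hi
          · rw [hk _ (Or.inr (by omega))]; exact hlt j hlt' hjT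
        refine ⟨fun v hv => ?_, ?_⟩
        · rw [State.setVar_arr, i1 v hv, h1 v hv]
        · rw [State.setVar_arr, i2, h2, Finset.sum_range_succ, add_assoc]
          congr 2
          refine countTuples_congr fun j hj => ?_
          rcases Nat.eq_or_lt_of_le hj with rfl | hlt'
          · simp [hq]
          · rw [Function.update_of_ne (by omega), hk _ (Or.inr (by omega))])
    rw [h0] at key
    exact key

end RAM

namespace RAM
open FProg

variable {n k : ℕ} {H : SimpleGraph ℕ} {w : ℕ → ℚ} {L M : ℕ} {s r : State}

theorem countTuples_eq_card (Q : (ℕ → ℕ) → Prop) (m : ℕ) (g : ℕ → ℕ) [DecidablePred Q] :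
    countTuples n Q m g = (Finset.univ.filter fun f : Fin m → Fin n =>
      Q fun j => if h : j < m then (f ⟨j, h⟩ : ℕ) else g j).card := by
  classical
  induction m generalizing g with
  | zero =>
    simp only [countTuples, not_lt_zero, dite_false]
    split_ifs with h <;> simp [h]
  | succ m ih =>
    rw [Finset.card_filter, ← Equiv.sum_comp (Fin.snocEquiv fun _ => Fin n),
      Fintype.sum_prod_type, countTuples, Finset.sum_range]
    refine Finset.sum_congr rfl fun x _ => ?_
    rw [ih, Finset.card_filter]
    refine Finset.sum_congr rfl fun f _ => ?_
    congr 2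
    funext j
    rcases lt_trichotomy j m with hj | rfl | hj
    · rw [dif_pos hj, dif_pos (by omega)]
      have : (⟨j, by omega⟩ : Fin (m + 1)) = Fin.castSucc ⟨j, hj⟩ := rfl
      rw [this, Fin.snocEquiv_apply, Fin.snoc_castSucc]
    · rw [dif_neg (lt_irrefl _), dif_pos (Nat.lt_succ_self _)]
      have : (⟨j, Nat.lt_succ_self j⟩ : Fin (j + 1)) = Fin.last j := rfl
      rw [this]
      simp [Fin.snocEquiv]
    · rw [dif_neg (by omega), dif_neg (by omega), Function.update_of_ne (by omega)]

theorem WeakChain.congr {V : Type*} [LinearOrder V] {G : SimpleGraph V} {g g' : ℕ → V}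
    (h : ∀ j < k + 4, g j = g' j) : WeakChain k G g ↔ WeakChain k G g' := by
  simp only [WeakChain, h 0 (by omega), h 1 (by omega), h (k + 2) (by omega), h (k + 3) (by omega)]
  refine and_congr Iff.rfl (and_congr (forall_congr' fun i => forall_congr' fun _ =>
    forall_congr' fun hi => ?_) Iff.rfl)
  rw [h i (by omega), h (i + 1) (by omega)]

theorem countTuples_chains {S : Finset ℕ} (hS : S ⊆ Finset.range n) (g : ℕ → ℕ) :
    countTuples n (fun g => (∀ j < k + 4, g j ∈ S) ∧ WeakChain k H g) (k + 4) g =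
      (chains k H S).card := by
  classical
  rw [countTuples_eq_card]
  refine Finset.card_bij (fun f _ i => (f i : ℕ)) ?_ ?_ ?_
  · intro f hf
    obtain ⟨h1, h2⟩ := (Finset.mem_filter.1 hf).2
    refine mem_chains.2 ⟨fun i => ?_, (WeakChain.congr fun j hj => ?_).1 h2⟩
    · simpa using h1 i i.2
    · rw [dif_pos hj, tupleFun]
      congr 2
      exact Fin.ext (Nat.mod_eq_of_lt hj).symm
  · exact fun f _ g _ h => funext fun i => Fin.ext (congrFun h i)
  · intro f hf
    obtain ⟨h1, h2⟩ := mem_chains.1 hf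
    refine ⟨fun i => ⟨f i, Finset.mem_range.1 (hS (h1 i))⟩, ?_, rfl⟩
    refine Finset.mem_filter.2 ⟨Finset.mem_univ _, fun j hj => ?_,
      (WeakChain.congr fun j hj => ?_).2 h2⟩
    · simpa only [dif_pos hj] using h1 _
    · rw [dif_pos hj, tupleFun]
      exact congrArg f (Fin.ext (Nat.mod_eq_of_lt hj).symm)

/-- The test whether the tuple variables hold a weak chain that avoids the closed neighbourhood of
variable `7` in the remaining graph. -/
def chainTest (k : ℕ) : Test :=
  .and (.all ((List.range (k + 4)).map fun j => .and (.mem 4 (.var (20 + j)))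
    (.and (.not (.eq (.var (20 + j)) (.var 7))) (.not (.adj (.var 7) (.var (20 + j)))))))
  (.and (.lt (.var 20) (.var 21))
  (.and (.all ((List.range (k + 1)).map fun j => .le (.var (20 + (j + 1))) (.var (20 + (j + 2)))))
  (.and (.lt (.var (20 + (k + 2))) (.var (20 + (k + 3))))
  (.and (.adj (.var 20) (.var 21)) (.adj (.var (20 + (k + 2))) (.var (20 + (k + 3))))))))

/-- Count the chains that avoid the closed neighbourhood of `v`, for `v = 0, …, n`. -/
def countP (k : ℕ) : FProg :=
  .for_ 7 1 (.seq (.store 6 (.var 7) (.const 0)) (tupleLoop (tallyP (chainTest k)) (k + 4)))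

theorem chainTest_holds (h : Input n H w L M r) (h7 : r.var 7 ≤ n)
    (hlt : ∀ j < k + 4, r.var (20 + j) < n) :
    (chainTest k).Holds r ↔ (∀ j < k + 4, r.var (20 + j) ∈ removeNbhd H (vset n r 4) (r.var 7)) ∧
      WeakChain k H fun j => r.var (20 + j) := by
  have hadj : ∀ i ≤ n, ∀ j < n, 1 ≤ r.arr 0 (r.arr 2 i + j) ↔ H.Adj i j := fun i hi j hj =>
    h.adj_get hi hj
  have hA : (∀ j < k + 4, r.var (20 + j) ∈ removeNbhd H (vset n r 4) (r.var 7)) ↔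
      ∀ j < k + 4, 1 ≤ r.arr 4 (r.var (20 + j)) ∧
        ¬ (r.var (20 + j) ≤ r.var 7 ∧ r.var 7 ≤ r.var (20 + j)) ∧
        ¬ 1 ≤ r.arr 0 (r.arr 2 (r.var 7) + r.var (20 + j)) := by
    refine forall_congr' fun j => forall_congr' fun hj => ?_
    rw [mem_removeNbhd, mem_vset, hadj _ h7 _ (hlt j hj), ← le_antisymm_iff]
    simp [hlt j hj]
  have hB : (∀ i, 1 ≤ i → i < k + 2 → r.var (20 + i) ≤ r.var (20 + (i + 1))) ↔
      ∀ j < k + 1, r.var (20 + (j + 1)) ≤ r.var (20 + (j + 2)) := by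
    constructor
    · exact fun h j hj => h (j + 1) (by omega) (by omega)
    · intro h i h1 h2
      obtain ⟨j, rfl⟩ : ∃ j, i = j + 1 := ⟨i - 1, by omega⟩
      exact h j (by omega)
  have e1 := hadj (r.var 20) (hlt 0 (by omega)).le (r.var 21) (hlt 1 (by omega))
  have e2 := hadj (r.var (20 + (k + 2))) (hlt _ (by omega)).le (r.var (20 + (k + 3)))
    (hlt _ (by omega))
  rw [hA, WeakChain, hB]
  simp only [chainTest, Test.Holds, Test.all_holds, List.mem_map, List.mem_range, Test.mem,
    Test.eq, Test.lt, Test.adj, Expr.eval, forall_exists_index, and_imp,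
    forall_apply_eq_imp_iff₂, e1, e2, not_le, add_zero]

theorem countP_keepsInput : (countP k).KeepsInput := by
  refine ⟨?_, ?_, ?_, ?_, ?_, ?_, ?_⟩
  iterate 4 exact ⟨by norm_num, trivial, tupleLoop_keepsVar (by simp [tallyP])
    (Or.inl (by norm_num))⟩
  iterate 2 exact ⟨by norm_num, tupleLoop_keepsArr (by simp [tallyP])⟩
  exact ⟨trivial, tupleLoop_keepsWArr (by simp [tallyP])⟩

theorem countP_keepsVar {z : ℕ} (h7 : z ≠ 7) (hz : z < 20) : (countP k).KeepsVar z :=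
  ⟨h7, trivial, tupleLoop_keepsVar (by simp [tallyP]) (Or.inl hz)⟩

theorem countP_keepsArr {z : ℕ} (h6 : z ≠ 6) : (countP k).KeepsArr z :=
  ⟨h6, tupleLoop_keepsArr (by simp [tallyP, h6])⟩

theorem countP_keepsWVar {z : ℕ} : (countP k).KeepsWVar z :=
  ⟨trivial, tupleLoop_keepsWVar (by simp [tallyP])⟩

/-- The case `v = n` is included: it yields the total number of chains, with which the search for a
heavy vertex starts. -/
theorem run_countP (h : Input n H w L M s) :
    ∀ v ≤ n, (run (countP k) s).arr 6 v = chainCount k H (vset n s 4) v := by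
  have key := run_for (x := 7) (y := 1) (s := s)
    (p := .seq (.store 6 (.var 7) (.const 0)) (tupleLoop (tallyP (chainTest k)) (k + 4)))
    ⟨trivial, tupleLoop_keepsVar (by simp [tallyP]) (Or.inl (by norm_num))⟩
    (fun i r => ∀ v < i, r.arr 6 v = chainCount k H (vset n s 4) v) (by simp) (by
      rintro i r hi hri hf ih v hv
      rw [h.size'] at hi
      have hin := h.of_frame countP_keepsInput hf
      set r' := run (.store 6 (.var 7) (.const 0)) r with hr'
      have hin' : Input n H w L M r' := hin.run (by simp)
      have h7 : r'.var 7 = i := hri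
      obtain ⟨t1, t2⟩ := run_tupleLoop (n := n) (s := r') (b := chainTest k) (T := k + 4)
        (Q := fun g => (∀ j < k + 4, g j ∈ removeNbhd H (vset n r' 4) (r'.var 7)) ∧
          WeakChain k H g) hin'.size (by
          rintro q ⟨hq1, hq2, hq3⟩ hlt
          have hinq : Input n H w L M q := by
            refine ⟨?_, ?_, ?_, ?_, ?_, ?_, ?_⟩
            · rw [hq1 0 (by norm_num), hin'.size]
            · rw [hq1 1 (by norm_num), hin'.size']
            · rw [hq1 2 (by norm_num), hin'.digits]
            · rw [hq1 3 (by norm_num), hin'.codes]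
            · rw [hq2 2 (by norm_num)]; exact hin'.row
            · rw [hq2 0 (by norm_num)]; exact hin'.adj
            · rw [hq3]; exact hin'.weight
          rw [chainTest_holds hinq (by rw [hq1 7 (by norm_num), h7]; omega) hlt,
            hq1 7 (by norm_num), vset_congr (hq2 4 (by norm_num))])
        (k + 4) le_rfl r' ⟨fun _ _ => rfl, fun _ _ => rfl, fun _ => rfl⟩ (by omega)
      have hS : vset n r' 4 = vset n s 4 := by
        refine vset_congr ?_
        rw [← hf.arr 4 (countP_keepsArr (by norm_num))]
        rw [hr', (frame_run _ _).arr 4 (by simp)]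
      rw [countTuples_chains (removeNbhd_subset.trans vset_subset), hS, h7] at t2
      rw [h7] at t1
      simp only [State.setVar_arr]
      change (run _ r').arr 6 v = _
      rcases Nat.lt_succ_iff_lt_or_eq.1 hv with hv | rfl
      · rw [t1 v (by omega), ← ih v hv]
        simp [hr', run, hri]
        omega
      · rw [t2]
        simp [hr', run, hri, chainCount])
  rw [h.size'] at key
  exact fun v hv => key v (by omega)

/-! ### The program: picking and branching -/

/-- Pick a heavy vertex. -/
def pickP : FProg :=
  .seq (.assign 11 (.var 0)) (.for_ 5 0 (.cond
    (.and (.mem 4 (.var 5)) (.lt (.get 6 (.var 5)) (.get 6 (.var 11))))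
    (.assign 11 (.var 5)) .nop))

theorem run_pickP (h : Input n H w L M s)
    (hc : ∀ v ≤ n, s.arr 6 v = chainCount k H (vset n s 4) v) :
    (run pickP s).var 11 = pickBelow k H n (vset n s 4) n := by
  have hle : ∀ i, pickBelow k H n (vset n s 4) i ≤ n := fun i => by
    rcases (pickBelow_spec (k := k) (H := H) (n := n) (vset n s 4) i).1 with h | h
    · exact h.le
    · exact (mem_vset.1 h.1).1.le
  have key := run_for (x := 5) (y := 0) (s := run (.assign 11 (.var 0)) s)
    (p := .cond (.and (.mem 4 (.var 5)) (.lt (.get 6 (.var 5)) (.get 6 (.var 11))))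
    (.assign 11 (.var 5)) .nop) (by simp)
    (fun i r => r.var 11 = pickBelow k H n (vset n s 4) i)
    (by simp [run, h.size, pickBelow]) (by
      rintro i r hi hri hf ih
      have hi' : i < n := by simpa [run, h.size] using hi
      have e4 : r.arr 4 = s.arr 4 := (hf.arr 4 (by simp)).trans (by simp [run])
      have e6 : r.arr 6 = s.arr 6 := (hf.arr 6 (by simp)).trans (by simp [run])
      simp only [pickBelow, mem_vset, run, Test.Holds, Test.mem, Test.lt, Expr.eval, hri, ih, e4,
        e6, hc i hi'.le, hc _ (hle i), hi', true_and, not_le]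
      split_ifs
      · simp
      · simp [ih])
  rw [show (run (.assign 11 (.var 0)) s).var 0 = n by simp [run, h.size]] at key
  exact key

/-- Choose or discard the picked vertex. -/
def chooseP : FProg :=
  .cond (.lt (.var 11) (.var 0)) (.cond (.mem 3 (.var 11))
    (.seq (.store 5 (.var 11) (.const 1)) (.seq (.store 4 (.var 11) (.const 0))
      (.for_ 5 0 (.cond (.adj (.var 11) (.var 5)) (.store 4 (.var 5) (.const 0)) .nop))))
    (.store 4 (.var 11) (.const 0))) .nop

theorem run_chooseP (h : Input n H w L M s) :
    (vset n (run chooseP s) 4, vset n (run chooseP s) 5) =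
      if s.var 11 < n then if s.var 11 ∈ vset n s 3 then
        (removeNbhd H (vset n s 4) (s.var 11), insert (s.var 11) (vset n s 5))
        else ((vset n s 4).erase (s.var 11), vset n s 5) else (vset n s 4, vset n s 5) := by
  by_cases h1 : s.var 11 < n
  swap
  · rw [if_neg h1, chooseP, run_cond_neg (by simpa [h.size] using h1)]
    rfl
  rw [if_pos h1, chooseP, run_cond_pos (by simpa [h.size] using h1)]
  by_cases h2 : s.var 11 ∈ vset n s 3
  swap
  · rw [if_neg h2, run_cond_neg (fun h3 => h2 (mem_vset.2 ⟨h1, by simpa using h3⟩))]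
    refine Prod.ext ?_ ?_
    · ext u
      rw [Finset.mem_erase, mem_vset, mem_vset]
      by_cases e : u = s.var 11 <;> simp [run, e]
    · exact vset_congr (by simp [run, State.setArr_arr])
  rw [if_pos h2, run_cond_pos (by simpa using (mem_vset.1 h2).2), run_seq, run_seq]
  set s' := run (.store 4 (.var 11) (.const 0)) (run (.store 5 (.var 11) (.const 1)) s) with hs'
  have hin : Input n H w L M s' :=
    h.run (p := .seq (.store 5 (.var 11) (.const 1)) (.store 4 (.var 11) (.const 0))) (by simp)
  have key := run_for (x := 5) (y := 0) (s := s')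
    (p := .cond (.adj (.var 11) (.var 5)) (.store 4 (.var 5) (.const 0)) .nop) (by simp)
    (fun i r => ∀ u < n, 1 ≤ r.arr 4 u ↔ 1 ≤ s.arr 4 u ∧ u ≠ s.var 11 ∧
      ¬ (u < i ∧ H.Adj (s.var 11) u))
    (by
      intro u hu
      by_cases e : u = s.var 11 <;> simp [hs', run, e]) (by
      rintro i r hi hri hf ih u hu
      have hi' : i < n := by simpa [hin.size] using hi
      have hinr := hin.of_frame (by simp) hf
      have e11 : r.var 11 = s.var 11 := (hf.var 11 (by simp)).trans (by simp [hs', run])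
      have hadj := hinr.adj_get h1.le hi'
      by_cases ha : H.Adj (s.var 11) i
      · rw [run_cond_pos (by simpa [e11, hri] using hadj.2 ha)]
        simp only [run, State.setVar_arr, State.setArr_arr_apply, true_and, Expr.eval, hri]
        by_cases e : u = i
        · subst e; simp [ha]
        · rw [if_neg e, ih u hu]
          have : u < i + 1 ↔ u < i := by omega
          rw [this]
      · rw [run_cond_neg (fun hh => ha (hadj.1 (by simpa [e11, hri] using hh)))]
        simp only [run, State.setVar_arr]
        rw [ih u hu]
        by_cases e : u = i
        · subst e; simp [ha]
        · have : u < i + 1 ↔ u < i := by omega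
          rw [this])
  rw [hin.size] at key
  have e5 : (run (.for_ 5 0 (.cond (.adj (.var 11) (.var 5)) (.store 4 (.var 5) (.const 0)) .nop))
    s').arr 5 = s'.arr 5 := (frame_run _ _).arr 5 (by simp)
  refine Prod.ext ?_ ?_
  · ext u
    rw [mem_removeNbhd, mem_vset, mem_vset]
    constructor
    · rintro ⟨hu, h4⟩
      obtain ⟨k1, k2, k3⟩ := (key u hu).1 h4
      exact ⟨⟨hu, k1⟩, k2, fun ha => k3 ⟨hu, ha⟩⟩
    · rintro ⟨⟨hu, k1⟩, k2, k3⟩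
      exact ⟨hu, (key u hu).2 ⟨k1, k2, fun ha => k3 ha.2⟩⟩
  · ext u
    rw [mem_vset, Finset.mem_insert, mem_vset, e5]
    by_cases e : u = s.var 11
    · simp [hs', run, e, h1]
    · simp [hs', run, e]

/-- Branch along the marked vertices. -/
def branchP (k : ℕ) : FProg :=
  .seq (fillP 4 1 0) (.seq (fillP 5 0 0) (.for_ 15 0 (.seq (countP k) (.seq pickP chooseP))))

theorem branchP_keepsInput : (branchP k).KeepsInput := by
  obtain ⟨h0, h1, h2, h3, h4, h5, h6⟩ := countP_keepsInput (k := k)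
  simp [branchP, fillP, pickP, chooseP, h0, h1, h2, h3, h4, h5, h6]

theorem run_branchP (h : Input n H w L M s) :
    (vset n (run (branchP k) s) 4, vset n (run (branchP k) s) 5) =
      branch k H n (vset n s 3) n := by
  have h1 := h.run (p := fillP 4 1 0) (by simp [fillP])
  set s1 := run (fillP 4 1 0) s with hs1
  have h2 := h1.run (p := fillP 5 0 0) (by simp [fillP])
  set s2 := run (fillP 5 0 0) s1 with hs2
  have e3 : s2.arr 3 = s.arr 3 := by
    rw [hs2, (frame_run _ _).arr 3 (by simp [fillP]), hs1, (frame_run _ _).arr 3 (by simp [fillP])]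
  have e4 : ∀ i < n, s2.arr 4 i = 1 := fun i hi => by
    rw [hs2, (frame_run _ _).arr 4 (by simp [fillP])]
    exact run_fillP i (by rw [h.size]; exact hi)
  have e5 : ∀ i < n, s2.arr 5 i = 0 := fun i hi => run_fillP i (by rw [h1.size]; exact hi)
  have hkeep : (.for_ 15 0 (.seq (countP k) (.seq pickP chooseP)) : FProg).KeepsInput := by
    obtain ⟨h0, h1, h2, h3, h4, h5, h6⟩ := countP_keepsInput (k := k)
    simp [pickP, chooseP, h0, h1, h2, h3, h4, h5, h6]
  have key := run_for (x := 15) (y := 0) (s := s2) (p := .seq (countP k) (.seq pickP chooseP))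
    ⟨countP_keepsVar (by norm_num) (by norm_num), by simp [pickP], by simp [chooseP]⟩
    (fun i r => (vset n r 4, vset n r 5) = branch k H n (vset n s 3) i)
    (by
      refine Prod.ext ?_ ?_
      · ext v
        simp only [mem_vset, branch, State.setVar_arr, Finset.mem_range]
        exact ⟨fun h => h.1, fun h => ⟨h, (e4 v h).ge⟩⟩
      · ext v
        simp only [mem_vset, branch, State.setVar_arr, Finset.notMem_empty, iff_false]
        rintro ⟨hv, h⟩
        rw [e5 v hv] at h
        omega) (by
      rintro i r hi hri hf ih
      have hr := h2.of_frame hkeep hf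
      have hr1 := hr.run (p := countP k) countP_keepsInput
      have hr2 := hr1.run (p := pickP) (by simp [pickP])
      have c3 : (run pickP (run (countP k) r)).arr 3 = s.arr 3 := by
        rw [(frame_run _ _).arr 3 (by simp [pickP]), (frame_run _ _).arr 3
          (countP_keepsArr (by norm_num)), hf.arr 3, e3]
        exact ⟨countP_keepsArr (by norm_num), by simp [pickP], by simp [chooseP]⟩
      have c4' : (run (countP k) r).arr 4 = r.arr 4 :=
        (frame_run _ _).arr 4 (countP_keepsArr (by norm_num))
      have c4 : (run pickP (run (countP k) r)).arr 4 = r.arr 4 := by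
        rw [(frame_run _ _).arr 4 (by simp [pickP]), c4']
      have c5 : (run pickP (run (countP k) r)).arr 5 = r.arr 5 := by
        rw [(frame_run _ _).arr 5 (by simp [pickP]), (frame_run _ _).arr 5
          (countP_keepsArr (by norm_num))]
      have hpick := run_pickP (k := k) hr1 (by
        rw [vset_congr c4']
        exact run_countP hr)
      have hch := run_chooseP hr2
      rw [hpick, vset_congr c3, vset_congr c4, vset_congr c5, vset_congr c4'] at hch
      rw [branch, ← ih]
      simp only [run]
      exact hch)
  rw [h2.size] at key
  exact key

end RAM

namespace RAM
open FProg

/-! ### The program: bipartite graphs -/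

variable {n : ℕ} {H : SimpleGraph ℕ} {w : ℕ → ℚ} {L M : ℕ} {s r : State}

/-- Find the least right end of an edge in the remaining graph. -/
def splitP : FProg :=
  .seq (.assign 12 (.var 0)) (.for_ 5 0 (.for_ 6 0 (.cond
    (.and (.lt (.var 5) (.var 6)) (.and (.mem 4 (.var 5)) (.and (.mem 4 (.var 6))
      (.and (.adj (.var 5) (.var 6)) (.lt (.var 6) (.var 12))))))
    (.assign 12 (.var 6)) .nop)))

theorem run_splitP (h : Input n H w L M s) :
    IsSplit H (vset n s 4) ((run splitP s).var 12) := by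
  set b : Test := .and (.lt (.var 5) (.var 6)) (.and (.mem 4 (.var 5)) (.and (.mem 4 (.var 6))
      (.and (.adj (.var 5) (.var 6)) (.lt (.var 6) (.var 12))))) with hb
  have h1 := h.run (p := .assign 12 (.var 0)) (by simp)
  set s1 := run (.assign 12 (.var 0)) s with hs1
  set S := vset n s 4 with hS
  have hlt : ∀ x ∈ S, x < n := fun x hx => (mem_vset.1 hx).1
  -- The initial value `n` remains if there is no edge; then all vertices lie to the left of the
  -- split.
  let Good : ℕ → Prop := fun p =>
    (∃ x ∈ S, ∃ y ∈ S, x < y ∧ H.Adj x y ∧ p = y) ∨ p = n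
  have key := run_for (x := 5) (y := 0) (s := s1) (p := .for_ 6 0 (.cond b (.assign 12 (.var 6)) .nop))
    (by simp)
    (fun i r => Good (r.var 12) ∧ ∀ x ∈ S, x < i → ∀ y ∈ S, x < y → H.Adj x y → r.var 12 ≤ y)
    (by simp [Good, hs1, run, h.size]) (by
      rintro i r hi hri hf ⟨g1, g2⟩
      rw [h1.size] at hi
      have hr := h1.of_frame (by simp) hf
      have key2 := run_for (x := 6) (y := 0) (s := r) (p := .cond b (.assign 12 (.var 6)) .nop)
        (by simp)
        (fun j q => Good (q.var 12) ∧ (∀ x ∈ S, x < i → ∀ y ∈ S, x < y → H.Adj x y → q.var 12 ≤ y) ∧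
          (i ∈ S → ∀ y ∈ S, y < j → i < y → H.Adj i y → q.var 12 ≤ y))
        ⟨by simpa using g1, by simpa using g2, by simp⟩ (by
          rintro j q hj hqj hf' ⟨k1, k2, k3⟩
          rw [hr.size] at hj
          have hq := hr.of_frame (by simp) hf'
          have hqi : q.var 5 = i := (hf'.var 5 (by simp)).trans hri
          have hq4 : q.arr 4 = s.arr 4 := by
            rw [hf'.arr 4 (by simp), hf.arr 4 (by simp)]; rfl
          have hbq : b.Holds q ↔ i < j ∧ i ∈ S ∧ j ∈ S ∧ H.Adj i j ∧ j < q.var 12 := by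
            simp [hb, hqi, hqj, hq4, hq.adj_get hi.le hj, hS, mem_vset, hi, hj]
          by_cases hc : b.Holds q
          · rw [run_cond_pos hc]
            obtain ⟨c1, c2, c3, c4, c5⟩ := hbq.1 hc
            simp only [run, Expr.eval, hqj, State.setVar_var]
            norm_num
            refine ⟨Or.inl ⟨i, c2, j, c3, c1, c4, rfl⟩, fun x hx hxi y hy hxy ha => ?_,
              fun _ y hy hyj hiy ha => ?_⟩
            · exact c5.le.trans (k2 x hx hxi y hy hxy ha)
            · rcases Nat.lt_or_eq_of_le hyj with hyj | rfl
              · exact c5.le.trans (k3 c2 y hy hyj hiy ha)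
              · exact le_rfl
          · rw [run_cond_neg hc]
            simp only [run, State.setVar_var]
            norm_num
            refine ⟨k1, k2, fun hiS y hy hyj hiy ha => ?_⟩
            rcases Nat.lt_or_eq_of_le hyj with hyj | rfl
            · exact k3 hiS y hy hyj hiy ha
            · exact not_lt.1 fun hlt => hc (hbq.2 ⟨hiy, hiS, hy, ha, hlt⟩))
      rw [hr.size] at key2
      obtain ⟨k1, k2, k3⟩ := key2
      simp only [State.setVar_var]
      norm_num
      refine ⟨k1, fun x hx hxi y hy hxy ha => ?_⟩
      rcases Nat.lt_or_eq_of_le hxi with hxi | rfl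
      · exact k2 x hx hxi y hy hxy ha
      · exact k3 hx y hy (hlt y hy) hxy ha)
  rw [h1.size] at key
  obtain ⟨k1, k2⟩ := key
  refine ⟨fun x hx y hy hxy ha => k2 x hx (hlt x hx) y hy hxy ha, ?_⟩
  rcases k1 with k1 | k1
  · exact Or.inl k1
  · right
    intro x hx
    change x < (run _ s1).var 12
    rw [k1]
    exact hlt x hx

theorem rowcol_inj {i j u v : ℕ} (hj : j < n) (hv : v < n) :
    i * n + j = u * n + v ↔ i = u ∧ j = v := by
  constructor
  · intro h
    have hn : 0 < n := by omega
    have h1 : (i * n + j) / n = i := by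
      rw [Nat.mul_comm, Nat.mul_add_div hn, Nat.div_eq_of_lt hj, add_zero]
    have h2 : (u * n + v) / n = u := by
      rw [Nat.mul_comm, Nat.mul_add_div hn, Nat.div_eq_of_lt hv, add_zero]
    have h3 : i = u := by rw [← h1, h, h2]
    subst h3
    exact ⟨rfl, by omega⟩
  · rintro ⟨rfl, rfl⟩; rfl

/-- The preflow in the memory. -/
def flowOf (n : ℕ) (s : State) : Preflow where
  E := s.warr 1
  r i j := s.warr 2 (i * n + j)
  d := s.arr 7

/-- Initialize the preflow. -/
def initFlowP : FProg :=
  .for_ 5 0 (.seq (.store 7 (.var 5) (.const 0)) (.seq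
    (.cond (.mem 4 (.var 5)) (.cond (.lt (.var 5) (.var 12))
      (.wstore 1 (.var 5) (.get 0 (.var 5)))
      (.wstore 1 (.var 5) (.sub .zero (.get 0 (.var 5)))))
      (.wstore 1 (.var 5) .zero))
    (.for_ 6 0 (.cond (.and (.mem 4 (.var 5)) (.and (.mem 4 (.var 6)) (.and
      (.adj (.var 5) (.var 6)) (.and (.lt (.var 5) (.var 12)) (.le (.var 12) (.var 6))))))
      (.wstore 2 (.add (.get 2 (.var 5)) (.var 6)) (.add (.get 0 (.var 5)) (.get 0 (.var 6))))
      (.wstore 2 (.add (.get 2 (.var 5)) (.var 6)) .zero)))))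

theorem run_initFlowP (h : Input n H w L M s) :
    (∀ i < n, (flowOf n (run initFlowP s)).d i = 0) ∧
    (∀ i < n, (flowOf n (run initFlowP s)).E i = initExcess (vset n s 4) (s.var 12) w i) ∧
    ∀ i < n, ∀ j < n, (flowOf n (run initFlowP s)).r i j =
      initCapacity H (vset n s 4) (s.var 12) w i j := by
  set b : Test := .and (.mem 4 (.var 5)) (.and (.mem 4 (.var 6)) (.and
      (.adj (.var 5) (.var 6)) (.and (.lt (.var 5) (.var 12)) (.le (.var 12) (.var 6))))) with hb
  set c : FProg := .cond (.mem 4 (.var 5)) (.cond (.lt (.var 5) (.var 12))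
      (.wstore 1 (.var 5) (.get 0 (.var 5)))
      (.wstore 1 (.var 5) (.sub .zero (.get 0 (.var 5)))))
      (.wstore 1 (.var 5) .zero) with hc
  set d : FProg := .cond b
      (.wstore 2 (.add (.get 2 (.var 5)) (.var 6)) (.add (.get 0 (.var 5)) (.get 0 (.var 6))))
      (.wstore 2 (.add (.get 2 (.var 5)) (.var 6)) .zero) with hd
  set S := vset n s 4 with hS
  set p := s.var 12 with hp
  have hkeep : initFlowP.KeepsInput := by simp [initFlowP]
  have key := run_for (x := 5) (y := 0) (s := s)
    (p := .seq (.store 7 (.var 5) (.const 0)) (.seq c (.for_ 6 0 d))) (by simp [hc, hd])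
    (fun i r => (∀ u < i, (flowOf n r).d u = 0) ∧
      (∀ u < i, (flowOf n r).E u = initExcess S p w u) ∧
      ∀ u < i, ∀ v < n, (flowOf n r).r u v = initCapacity H S p w u v) (by simp) (by
      rintro i r hi hri hf ⟨i1, i2, i3⟩
      rw [h.size] at hi
      have hr := h.of_frame hkeep hf
      have hr4 : r.arr 4 = s.arr 4 := hf.arr 4 (by simp [hc, hd])
      have hr12 : r.var 12 = p := hf.var 12 (by simp [hc, hd])
      have hiS : i ∈ S ↔ 1 ≤ r.arr 4 i := by rw [hS, mem_vset, hr4]; simp [hi]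
      rw [run_seq, run_seq]
      set r1 := run (.store 7 (.var 5) (.const 0)) r with hr1
      have hc1 : (run c r1).warr 1 = Function.update (r.warr 1) i (initExcess S p w i) := by
        have hw := hr.weight i hi
        by_cases a : i ∈ S
        · have a' := hiS.1 a
          rw [hc, run_cond_pos (by simpa [hr1, run, hri] using a')]
          by_cases a2 : i < p
          · rw [run_cond_pos (by simpa [hr1, run, hri, hr12] using a2)]
            simp [run, State.setWArr_warr, hr1, hri, initExcess, a, a2, hw]
          · rw [run_cond_neg (by simpa [hr1, run, hri, hr12] using a2)]
            simp [run, State.setWArr_warr, hr1, hri, initExcess, a, a2, hw]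
        · rw [hc, run_cond_neg (by simpa [hr1, run, hri] using mt hiS.2 a)]
          simp [run, State.setWArr_warr, hr1, hri, initExcess, a]
      have hr2 : Input n H w L M (run c r1) := (hr.run (by simp)).run (by simp [hc])
      have f2 := frame_run c r1
      have g5 : (run c r1).var 5 = i := by
        rw [f2.var 5 (by simp [hc]), hr1]; exact hri
      have g12 : (run c r1).var 12 = p := by
        rw [f2.var 12 (by simp [hc]), hr1]; exact hr12
      have g4 : (run c r1).arr 4 = s.arr 4 := by
        rw [f2.arr 4 (by simp [hc]), hr1, ← hr4]; simp [run, State.setArr_arr]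
      have g7 : (run c r1).arr 7 = Function.update (r.arr 7) i 0 := by
        rw [f2.arr 7 (by simp [hc]), hr1]; simp [run, State.setArr_arr, hri]
      have gw2 : (run c r1).warr 2 = r.warr 2 := f2.warr 2 (by simp [hc])
      set r2 := run c r1 with hr2'
      have f3 := frame_run (.for_ 6 0 d) r2
      have key2 := run_for (x := 6) (y := 0) (s := r2) (p := d) (by simp [hd])
        (fun j q => (∀ u < i, ∀ v < n, q.warr 2 (u * n + v) = r.warr 2 (u * n + v)) ∧
          ∀ v < j, q.warr 2 (i * n + v) = initCapacity H S p w i v)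
        (by simp [gw2]) (by
          rintro j q hj hqj hf' ⟨j1, j2⟩
          rw [hr2.size] at hj
          have hq := hr2.of_frame (by simp [hd]) hf'
          have q5 : q.var 5 = i := (hf'.var 5 (by simp [hd])).trans g5
          have q12 : q.var 12 = p := (hf'.var 12 (by simp [hd])).trans g12
          have q4 : q.arr 4 = s.arr 4 := (hf'.arr 4 (by simp [hd])).trans g4
          have hbq : b.Holds q ↔ i ∈ S ∧ j ∈ S ∧ H.Adj i j ∧ i < p ∧ p ≤ j := by
            simp [hb, q5, hqj, q4, hq.adj_get hi.le hj, hS, mem_vset, hi, hj, q12]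
          have hrun : (run d q).warr 2 = Function.update (q.warr 2) (i * n + j)
              (initCapacity H S p w i j) := by
            by_cases hh : b.Holds q
            · rw [hd, run_cond_pos hh, initCapacity, if_pos (hbq.1 hh)]
              simp [run, State.setWArr_warr, q5, hqj, hq.row i hi.le, hq.weight i hi,
                hq.weight j hj]
            · rw [hd, run_cond_neg hh, initCapacity, if_neg (mt hbq.2 hh)]
              simp [run, State.setWArr_warr, q5, hqj, hq.row i hi.le]
          simp only [State.setVar_warr, hrun]
          refine ⟨fun u hu v hv => ?_, fun v hv => ?_⟩
          · rw [Function.update_of_ne, j1 u hu v hv]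
            rw [Ne, rowcol_inj hv hj]
            omega
          · rcases Nat.lt_succ_iff_lt_or_eq.1 hv with hv | rfl
            · rw [Function.update_of_ne, j2 v hv]
              omega
            · simp)
      rw [hr2.size] at key2
      obtain ⟨k1, k2⟩ := key2
      have e7 : (run (.for_ 6 0 d) r2).arr 7 = Function.update (r.arr 7) i 0 := by
        rw [f3.arr 7 (by simp [hd]), g7]
      have e1 : (run (.for_ 6 0 d) r2).warr 1 =
          Function.update (r.warr 1) i (initExcess S p w i) := by
        rw [f3.warr 1 (by simp [hd]), hc1]
      simp only [flowOf, State.setVar_arr, State.setVar_warr, e7, e1]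
      refine ⟨fun u hu => ?_, fun u hu => ?_, fun u hu v hv => ?_⟩
      · rcases Nat.lt_succ_iff_lt_or_eq.1 hu with hu | rfl
        · rw [Function.update_of_ne (by omega)]; exact i1 u hu
        · simp
      · rcases Nat.lt_succ_iff_lt_or_eq.1 hu with hu | rfl
        · rw [Function.update_of_ne (by omega)]; exact i2 u hu
        · simp
      · rcases Nat.lt_succ_iff_lt_or_eq.1 hu with hu | rfl
        · rw [k1 u hu v hv]; exact i3 u hu v hv
        · exact k2 v hv)
  rw [h.size] at key
  exact key

theorem initFlow_valid {F : Preflow} {S : Finset ℕ} {p : ℕ} (hw : ∀ i ∈ S, 0 < w i)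
    (hd : ∀ i < n, F.d i = 0) (hE : ∀ i < n, F.E i = initExcess S p w i)
    (hr : ∀ i < n, ∀ j < n, F.r i j = initCapacity H S p w i j) :
    F.Valid n (initExcess S p w) (initCapacity H S p w) where
  nonneg i hi j hj := by
    rw [hr i hi j hj, initCapacity]
    split_ifs with h
    · exact add_nonneg (hw i h.1).le (hw j h.2.1).le
    · exact le_rfl
  steep i hi j hj _ := by rw [hd i hi]; omega
  height i hi := by rw [hd i hi]; omega
  symm i hi j hj := by rw [hr i hi j hj, hr j hj i hi]
  excess i hi := by
    rw [hE i hi, Finset.sum_eq_zero, sub_zero]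
    intro j hj
    rw [hr i hi j (Finset.mem_range.1 hj), sub_self]
  deficit i hi h := ⟨hd i hi, hE i hi ▸ h⟩

/-- Find the last index that passes a test, or `n`. -/
def findP (x : ℕ) (b : Test) : FProg :=
  .seq (.assign x (.var 0)) (.for_ 5 0 (.cond b (.assign x (.var 5)) .nop))

theorem run_findP {x : ℕ} {b : Test} {Q : ℕ → Prop} (hn : s.var 0 = n) (hx0 : x ≠ 0) (hx5 : x ≠ 5)
    (hb : ∀ i < n, ∀ r, r.var 5 = i → Frame (findP x b) s r → (b.Holds r ↔ Q i)) :
    (run (findP x b) s).var x < n ∧ Q ((run (findP x b) s).var x) ∨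
      (run (findP x b) s).var x = n ∧ ∀ i < n, ¬ Q i := by
  have h5x : (5 : ℕ) ≠ x := hx5.symm
  have key := run_for (x := 5) (y := 0) (s := run (.assign x (.var 0)) s)
    (p := .cond b (.assign x (.var 5)) .nop) (by simp [h5x])
    (fun i r => r.var x < n ∧ Q (r.var x) ∨ r.var x = n ∧ ∀ j < i, ¬ Q j)
    (by simp [run, hn, hx5]) (by
      rintro i r hi hri hf ih
      have hi' : i < n := by simpa [run, hn, hx0.symm] using hi
      have hfr : Frame (findP x b) s r := by
        refine ⟨fun z hz => ?_, fun z hz => ?_, fun z hz => ?_, fun z hz => ?_⟩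
        · obtain ⟨z1, z2, z3, z4⟩ := hz
          rw [hf.var z ⟨z2, z3, z4⟩]
          simp [run, show z ≠ x from z1]
        · exact hf.arr z hz.2
        · exact hf.wvar z hz.2
        · exact hf.warr z hz.2
      have hbi := hb i hi' r hri hfr
      by_cases hc : b.Holds r
      · rw [run_cond_pos hc]
        left
        simp [run, hri, hx5, hi', hbi.1 hc]
      · rw [run_cond_neg hc]
        rcases ih with ih | ⟨ih1, ih2⟩
        · left; simpa [run, hx5] using ih
        · right
          refine ⟨by simpa [run, hx5] using ih1, fun j hj => ?_⟩
          rcases Nat.lt_succ_iff_lt_or_eq.1 hj with hj | rfl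
          · exact ih2 j hj
          · exact mt hbi.2 hc)
  rw [show (run (.assign x (.var 0)) s).var 0 = n by simp [run, hn, hx0.symm]] at key
  exact key

/-- Push from variable `7` to variable `8`. -/
def pushP : FProg :=
  .seq (.wassign 2 (.get 1 (.var 7)))
  (.seq (.cond (.wle (.get 2 (.add (.get 2 (.var 7)) (.var 8))) (.var 2))
    (.wassign 2 (.get 2 (.add (.get 2 (.var 7)) (.var 8)))) .nop)
  (.seq (.wstore 1 (.var 7) (.sub (.get 1 (.var 7)) (.var 2)))
  (.seq (.wstore 1 (.var 8) (.add (.get 1 (.var 8)) (.var 2)))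
  (.seq (.wstore 2 (.add (.get 2 (.var 7)) (.var 8))
    (.sub (.get 2 (.add (.get 2 (.var 7)) (.var 8))) (.var 2)))
  (.wstore 2 (.add (.get 2 (.var 8)) (.var 7))
    (.add (.get 2 (.add (.get 2 (.var 8)) (.var 7))) (.var 2)))))))

theorem run_pushP (h : Input n H w L M s) {u v : ℕ} (hu : s.var 7 = u) (hv : s.var 8 = v)
    (hun : u < n) (hvn : v < n) (huv : u ≠ v) (hE : 0 < (flowOf n s).E u)
    (hlow : (flowOf n s).d u < n) (hr : 0 < (flowOf n s).r u v) (hd : (flowOf n s).d u = (flowOf n s).d v + 1) :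
    Preflow.Push n (flowOf n s) (flowOf n (run pushP s)) u v := by
  set q := run (.cond (.wle (.get 2 (.add (.get 2 (.var 7)) (.var 8))) (.var 2))
    (.wassign 2 (.get 2 (.add (.get 2 (.var 7)) (.var 8)))) .nop)
    (run (.wassign 2 (.get 1 (.var 7))) s) with hq
  have hδ : q.wvar 2 = min (s.warr 1 u) (s.warr 2 (u * n + v)) := by
    by_cases hc : s.warr 2 (u * n + v) ≤ s.warr 1 u
    · rw [hq, run_cond_pos (by simpa [run, hu, hv, h.row u hun.le] using hc), min_eq_right hc]
      simp [run, hu, hv, h.row u hun.le]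
    · rw [hq, run_cond_neg (by simpa [run, hu, hv, h.row u hun.le] using hc),
        min_eq_left (not_le.1 hc).le]
      simp [run, hu]
  have fq : Frame (.seq (.wassign 2 (.get 1 (.var 7)))
      (.cond (.wle (.get 2 (.add (.get 2 (.var 7)) (.var 8))) (.var 2))
    (.wassign 2 (.get 2 (.add (.get 2 (.var 7)) (.var 8)))) .nop)) s q := frame_run _ s
  have q7 : q.var 7 = u := (fq.var 7 (by simp)).trans hu
  have q8 : q.var 8 = v := (fq.var 8 (by simp)).trans hv
  have qw1 : q.warr 1 = s.warr 1 := fq.warr 1 (by simp)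
  have qw2 : q.warr 2 = s.warr 2 := fq.warr 2 (by simp)
  have q2 : q.arr 2 = s.arr 2 := fq.arr 2 (by simp)
  have hrun : run pushP s = (((q.setWArr 1 u (s.warr 1 u - q.wvar 2)).setWArr 1 v
      (s.warr 1 v + q.wvar 2)).setWArr 2 (u * n + v) (s.warr 2 (u * n + v) - q.wvar 2)).setWArr 2
      (v * n + u) (s.warr 2 (v * n + u) + q.wvar 2) := by
    -- The two arcs occupy different cells, so the writes do not interfere.
    have huv' : ¬ (v * n + u = u * n + v) := by
      rw [rowcol_inj hun hvn]; exact fun e => huv e.1.symm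
    simp only [pushP, run_seq, ← hq]
    simp [run, q7, q8, qw1, qw2, q2, h.row u hun.le, h.row v hvn.le, huv.symm, huv']
  refine ⟨hun, hvn, hE, hlow, hr, hd, fun i hi => ?_, fun i hi j hj => ?_, fun i _ => ?_⟩
  · simp only [flowOf, hrun, hδ, State.setWArr_warr_apply, qw1]
    by_cases e1 : i = u
    · have : ¬ i = v := fun e => huv (e1.symm.trans e)
      simp [e1, huv]
    · by_cases e2 : i = v <;> simp [e1, e2, huv.symm]
  · simp only [flowOf, hrun, hδ, State.setWArr_warr_apply, qw2, rowcol_inj hj hvn,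
      rowcol_inj hj hun]
    by_cases e1 : i = u ∧ j = v
    · have : ¬ (i = v ∧ j = u) := fun e => huv (e1.1.symm.trans e.1)
      simp [e1, huv]
    · by_cases e2 : i = v ∧ j = u
      · simp [e2, huv.symm]
      · rw [if_neg e1, if_neg e2]
        simp [e1, e2]
  · simp only [flowOf, hrun, State.setWArr_arr]
    rw [fq.arr 7 (by simp)]

/-- One operation of the push-relabel method. -/
def flowStepP : FProg :=
  .seq (findP 7 (.and (.wlt .zero (.get 1 (.var 5))) (.lt (.get 7 (.var 5)) (.var 0))))
  (.cond (.lt (.var 7) (.var 0))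
    (.seq (findP 8 (.and (.wlt .zero (.get 2 (.add (.get 2 (.var 7)) (.var 5))))
      (.eq (.get 7 (.var 7)) (.add (.get 7 (.var 5)) (.const 1)))))
    (.cond (.lt (.var 8) (.var 0)) pushP
      (.store 7 (.var 7) (.add (.get 7 (.var 7)) (.const 1))))) .nop)

/-- The alternatives are: no active vertex below height `n` is found; one is found but no arc to
push along, which is precisely the condition for raising it; or both are found. -/
theorem run_flowStepP (h : Input n H w L M s) :
    (flowOf n (run flowStepP s) = flowOf n s ∧ (flowOf n s).Final n) ∨
    (∃ u, Preflow.Relabel n (flowOf n s) (flowOf n (run flowStepP s)) u) ∨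
    ∃ u v, Preflow.Push n (flowOf n s) (flowOf n (run flowStepP s)) u v := by
  set b1 : Test := .and (.wlt .zero (.get 1 (.var 5))) (.lt (.get 7 (.var 5)) (.var 0)) with hb1
  set b2 : Test := .and (.wlt .zero (.get 2 (.add (.get 2 (.var 7)) (.var 5))))
      (.eq (.get 7 (.var 7)) (.add (.get 7 (.var 5)) (.const 1))) with hb2
  have h1 := h.run (p := findP 7 b1) (by simp [findP])
  have f1 := frame_run (findP 7 b1) s
  have fl1 : flowOf n (run (findP 7 b1) s) = flowOf n s := by
    simp only [flowOf]
    rw [f1.warr 1 (by simp [findP]), f1.warr 2 (by simp [findP]), f1.arr 7 (by simp [findP])]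
  have hfind := run_findP (x := 7) (b := b1)
    (Q := fun i => 0 < (flowOf n s).E i ∧ (flowOf n s).d i < n) h.size (by norm_num) (by norm_num) (by
      intro i hi r hri hf
      have := (h.of_frame (by simp [findP]) hf).size
      simp [hb1, hri, hf.warr 1 (by simp [findP]), hf.arr 7 (by simp [findP]), this, flowOf])
  rw [flowStepP, run_seq]
  set s1 := run (findP 7 b1) s with hs1
  rcases hfind with ⟨hu, hE, hd⟩ | ⟨hu, hno⟩
  swap
  · left
    rw [run_cond_neg (by simp [hu, h1.size])]
    refine ⟨fl1, fun i hi hpos => not_lt.1 fun hlt => hno i hi ⟨hpos, hlt⟩⟩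
  right
  rw [run_cond_pos (by simpa [h1.size] using hu), run_seq]
  set u := s1.var 7 with hu'
  have h2 := h1.run (p := findP 8 b2) (by simp [findP])
  have f2 := frame_run (findP 8 b2) s1
  have fl2 : flowOf n (run (findP 8 b2) s1) = flowOf n s := by
    rw [← fl1]
    simp only [flowOf]
    rw [f2.warr 1 (by simp [findP]), f2.warr 2 (by simp [findP]), f2.arr 7 (by simp [findP])]
  have hfind := run_findP (x := 8) (b := b2)
    (Q := fun j => 0 < (flowOf n s).r u j ∧ (flowOf n s).d u = (flowOf n s).d j + 1)
    h1.size (by norm_num) (by norm_num) (by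
      intro j hj r hrj hf
      have hin := h1.of_frame (by simp [findP]) hf
      have r7 : r.var 7 = u := hf.var 7 (by simp [findP])
      rw [← fl1, le_antisymm_iff]
      simp [hb2, hrj, r7, hf.warr 2 (by simp [findP]), hf.arr 7 (by simp [findP]),
        hin.row u hu.le, flowOf])
  have h27 : (run (findP 8 b2) s1).var 7 = u := f2.var 7 (by simp [findP])
  set s2 := run (findP 8 b2) s1 with hs2
  rcases hfind with ⟨hv, hr, hdd⟩ | ⟨hv, hno⟩
  · right
    rw [run_cond_pos (by simpa [h2.size] using hv)]
    refine ⟨u, s2.var 8, ?_⟩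
    have := run_pushP h2 h27 rfl hu hv (fun e => by rw [← e] at hdd; omega)
      (by rw [fl2]; exact hE) (by rw [fl2]; exact hd) (by rw [fl2]; exact hr) (by rw [fl2]; exact hdd)
    rwa [fl2] at this
  · left
    rw [run_cond_neg (by simp [hv, h2.size])]
    refine ⟨u, hu, hE, hd, fun j hj hr hdd => hno j hj ⟨hr, hdd⟩, fun i _ => ?_, fun i _ j _ => ?_,
      fun i _ => ?_⟩
    · rw [← fl2]; rfl
    · rw [← fl2]; rfl
    · rw [← fl2]
      by_cases e : i = u <;> simp [flowOf, run, h27, e]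

/-- The push-relabel method. -/
def flowP : FProg := .for_ 15 3 flowStepP

theorem flowStepP_keepsInput : flowStepP.KeepsInput := by simp [flowStepP, findP, pushP]

/-- Every effective round lowers the potential, and there are more rounds than its initial value;
surplus rounds change nothing. For `n = 0` finality is vacuous. -/
theorem run_flowP (h : Input n H w L M s) {E₀ : ℕ → ℚ} {r₀ : ℕ → ℕ → ℚ}
    (hF : (flowOf n s).Valid n E₀ r₀) (hM : 0 < n → (n + 1) ^ 8 < M) :
    (flowOf n (run flowP s)).Valid n E₀ r₀ ∧ (flowOf n (run flowP s)).Final n := by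
  have key := run_for (x := 15) (y := 3) (s := s) (p := flowStepP)
    (by simp [flowStepP, findP, pushP])
    (fun i r => (flowOf n r).Valid n E₀ r₀ ∧ ((flowOf n r).Final n ∨
      Preflow.potential n (flowOf n r) + i ≤ (n + 1) ^ 8))
    ⟨hF, Or.inr hF.potential_le⟩ (by
      rintro i r - - hf ⟨i1, i2⟩
      have hr := h.of_frame (by simpa using flowStepP_keepsInput) hf
      change (flowOf n (run flowStepP r)).Valid n E₀ r₀ ∧ ((flowOf n (run flowStepP r)).Final n ∨
        Preflow.potential n (flowOf n (run flowStepP r)) + (i + 1) ≤ (n + 1) ^ 8)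
      rcases run_flowStepP hr with ⟨e, hfin⟩ | ⟨u, hre⟩ | ⟨u, v, hpu⟩
      · rw [e]; exact ⟨i1, Or.inl hfin⟩
      · refine ⟨i1.relabel hre, Or.inr ?_⟩
        rcases i2 with hfin | i2
        · exact absurd (hfin u hre.hu hre.pos) (not_le.2 hre.low)
        · have := Preflow.potential_relabel_lt i1 hre
          omega
      · refine ⟨i1.push hpu, ?_⟩
        rcases i2 with hfin | i2
        · exact absurd (hfin u hpu.hu hpu.pos) (not_le.2 hpu.low)
        · have := Preflow.potential_push_lt i1 hpu
          right
          omega)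
  rw [h.codes] at key
  refine ⟨key.1, key.2.elim id fun hp => ?_⟩
  rcases Nat.eq_zero_or_pos n with rfl | hn
  · intro i hi; omega
  · have := hM hn
    omega

end RAM

/-! ### The program: reading off the independent set -/

namespace RAM
open FProg

variable {n k : ℕ} {H : SimpleGraph ℕ} {w : ℕ → ℚ} {L M : ℕ} {s r : State}

/-- Find an empty level. -/
def levelP : FProg :=
  .seq (.assign 13 (.const 0)) (.for_ 5 1 (.seq (.assign 14 (.const 1)) (.seq
    (.for_ 6 0 (.cond (.eq (.get 7 (.var 6)) (.var 5)) (.assign 14 (.const 0)) .nop))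
    (.cond (.le (.const 1) (.var 14)) (.assign 13 (.var 5)) .nop))))

/-- The invariant is conditional: variable `13` is meaningful only once an empty level has been
passed. `exists_empty_level` guarantees that this happens. -/
theorem run_levelP (h : Input n H w L M s) :
    (run levelP s).var 13 ≤ n ∧ ∀ i < n, s.arr 7 i ≠ (run levelP s).var 13 := by
  let Empty : ℕ → Prop := fun l => ∀ i < n, s.arr 7 i ≠ l
  set q : FProg := .cond (.eq (.get 7 (.var 6)) (.var 5)) (.assign 14 (.const 0)) .nop with hq
  set c : FProg := .cond (.le (.const 1) (.var 14)) (.assign 13 (.var 5)) .nop with hc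
  have h1 := h.run (p := .assign 13 (.const 0)) (by simp)
  set s1 := run (.assign 13 (.const 0)) s with hs1
  have key := run_for (x := 5) (y := 1) (s := s1)
    (p := .seq (.assign 14 (.const 1)) (.seq (.for_ 6 0 q) c)) (by simp [hq, hc])
    (fun i r => (∃ l < i, Empty l) → r.var 13 ≤ n ∧ Empty (r.var 13)) (by simp) (by
      rintro i r hi hri hf ih ⟨l, hl, hlE⟩
      rw [h1.size'] at hi
      have hr := h1.of_frame (by simp [hq, hc]) hf
      have hr7 : r.arr 7 = s.arr 7 := (hf.arr 7 (by simp [hq, hc])).trans rfl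
      rw [run_seq, run_seq]
      set r1 := run (.assign 14 (.const 1)) r with hr1
      have hin1 : Input n H w L M r1 := hr.run (by simp)
      have key2 := run_for (x := 6) (y := 0) (s := r1) (p := q) (by simp [hq])
        (fun j t => 1 ≤ t.var 14 ↔ ∀ u < j, s.arr 7 u ≠ i) (by simp [hr1, run]) (by
          rintro j t hj htj hf' ih'
          have t5 : t.var 5 = i := (hf'.var 5 (by simp [hq])).trans hri
          have t7 : t.arr 7 = s.arr 7 := (hf'.arr 7 (by simp [hq])).trans hr7
          by_cases e : s.arr 7 j = i
          · rw [hq, run_cond_pos (by simp [htj, t5, t7, e])]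
            simp only [run, State.setVar_var, Expr.eval]
            norm_num
            exact ⟨j, le_rfl, e⟩
          · rw [hq, run_cond_neg (by
              simp only [Test.eq, Test.Holds, Expr.eval, htj, t5, t7]
              omega)]
            simp only [run, State.setVar_var]
            norm_num
            rw [ih']
            constructor
            · intro hall u hu
              rcases Nat.lt_or_eq_of_le hu with hu | rfl
              · exact hall u hu
              · exact e
            · exact fun hall u hu => hall u hu.le)
      rw [hin1.size] at key2
      have f2 := frame_run (.for_ 6 0 q) r1
      have g5 : (run (.for_ 6 0 q) r1).var 5 = i := (f2.var 5 (by simp [hq])).trans hri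
      have g13 : (run (.for_ 6 0 q) r1).var 13 = r.var 13 := by
        rw [f2.var 13 (by simp [hq])]; simp [hr1, run]
      set r2 := run (.for_ 6 0 q) r1 with hr2
      by_cases e : 1 ≤ r2.var 14
      · rw [hc, run_cond_pos (by simpa using e)]
        simp only [run, State.setVar_var, Expr.eval]
        norm_num
        rw [g5]
        exact ⟨by omega, key2.1 e⟩
      · rw [hc, run_cond_neg (by simpa using e)]
        simp only [run, State.setVar_var]
        norm_num
        rw [g13]
        refine ih ⟨l, ?_, hlE⟩
        rcases Nat.lt_succ_iff_lt_or_eq.1 hl with hl | rfl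
        · exact hl
        · exact absurd (key2.2 hlE) e)
  rw [h1.size'] at key
  obtain ⟨l, hl, hlE⟩ := Preflow.exists_empty_level n (s.arr 7)
  exact key ⟨l, by omega, hlE⟩

/-- Add the independent set of the bipartite graph to the chosen vertices. -/
def collectP : FProg :=
  .for_ 5 0 (.cond (.and (.mem 4 (.var 5)) (.not (.and
    (.not (.and (.lt (.var 5) (.var 12)) (.lt (.var 13) (.get 7 (.var 5)))))
    (.not (.and (.le (.var 12) (.var 5)) (.le (.get 7 (.var 5)) (.var 13)))))))
    (.store 5 (.var 5) (.const 1)) .nop)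

theorem run_collectP (h : Input n H w L M s) : vset n (run collectP s) 5 =
    vset n s 5 ∪ cutSet (vset n s 4) (s.var 12) (s.var 13) (s.arr 7) := by
  set b : Test := .and (.mem 4 (.var 5)) (.not (.and
    (.not (.and (.lt (.var 5) (.var 12)) (.lt (.var 13) (.get 7 (.var 5)))))
    (.not (.and (.le (.var 12) (.var 5)) (.le (.get 7 (.var 5)) (.var 13)))))) with hb
  set C := cutSet (vset n s 4) (s.var 12) (s.var 13) (s.arr 7) with hC
  have key := run_for (x := 5) (y := 0) (s := s) (p := .cond b (.store 5 (.var 5) (.const 1)) .nop)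
    (by simp)
    (fun i r => ∀ u < n, 1 ≤ r.arr 5 u ↔ 1 ≤ s.arr 5 u ∨ u < i ∧ u ∈ C) (by simp) (by
      rintro i r hi hri hf ih u hu
      rw [h.size] at hi
      have r4 := hf.arr 4 (by simp)
      have r7 := hf.arr 7 (by simp)
      have r12 := hf.var 12 (by simp)
      have r13 := hf.var 13 (by simp)
      have hbr : b.Holds r ↔ i ∈ C := by
        rw [hC, cutSet, Finset.mem_filter, mem_vset]
        simp only [hb, Test.Holds, Test.mem, Test.lt, Expr.eval, hri, r4, r7, r12, r13, hi,
          true_and]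
        refine and_congr Iff.rfl ?_
        omega
      have hsplit : (u < i + 1 ∧ u ∈ C) ↔ (u < i ∧ u ∈ C) ∨ (u = i ∧ i ∈ C) := by
        constructor
        · rintro ⟨h1, h2⟩
          rcases Nat.lt_succ_iff_lt_or_eq.1 h1 with h1 | rfl
          · exact Or.inl ⟨h1, h2⟩
          · exact Or.inr ⟨rfl, h2⟩
        · rintro (⟨h1, h2⟩ | ⟨rfl, h2⟩)
          · exact ⟨by omega, h2⟩
          · exact ⟨by omega, h2⟩
      rw [hsplit, ← or_assoc, ← ih u hu]
      by_cases e : b.Holds r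
      · rw [run_cond_pos e]
        have := hbr.1 e
        by_cases eu : u = i <;> simp [run, hri, eu, this]
      · rw [run_cond_neg e]
        have := mt hbr.2 e
        simp [run, this])
  rw [h.size] at key
  ext u
  rw [Finset.mem_union, mem_vset, mem_vset]
  constructor
  · rintro ⟨hu, h1⟩
    exact ((key u hu).1 h1).imp (fun h => ⟨hu, h⟩) (fun h => h.2)
  · rintro (⟨hu, h1⟩ | h1)
    · exact ⟨hu, (key u hu).2 (Or.inl h1)⟩
    · have hu : u < n := (mem_vset.1 (Finset.mem_filter.1 h1).1).1
      exact ⟨hu, (key u hu).2 (Or.inr ⟨hu, h1⟩)⟩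

/-- Compute the weight of the chosen set. -/
def weighP : FProg :=
  .seq (.wassign 1 .zero) (.for_ 5 0 (.cond (.mem 5 (.var 5))
    (.wassign 1 (.add (.var 1) (.get 0 (.var 5)))) .nop))

theorem run_weighP (h : Input n H w L M s) :
    (run weighP s).wvar 1 = ∑ v ∈ vset n s 5, w v := by
  have h1 := h.run (p := .wassign 1 .zero) (by simp)
  have key := run_for (x := 5) (y := 0) (s := run (.wassign 1 .zero) s)
    (p := .cond (.mem 5 (.var 5)) (.wassign 1 (.add (.var 1) (.get 0 (.var 5)))) .nop) (by simp)
    (fun i r => r.wvar 1 = ∑ v ∈ (Finset.range i).filter (fun v => 1 ≤ s.arr 5 v), w v)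
    (by simp [run]) (by
      rintro i r hi hri hf ih
      rw [h1.size] at hi
      have hr := h1.of_frame (by simp) hf
      have r5 : r.arr 5 = s.arr 5 := (hf.arr 5 (by simp)).trans rfl
      rw [Finset.range_add_one, Finset.filter_insert]
      by_cases e : 1 ≤ s.arr 5 i
      · rw [run_cond_pos (by simpa [hri, r5] using e), if_pos e,
          Finset.sum_insert (by simp), ← ih]
        simp [run, hri, hr.weight i hi, add_comm]
      · rw [run_cond_neg (by simpa [hri, r5] using e), if_neg e, ← ih]
        simp [run])
  rw [h1.size] at key
  exact key

/-- Keep the better one of the output and the chosen set. -/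
def updateP : FProg :=
  .cond (.wlt (.var 0) (.var 1)) (.seq (.wassign 0 (.var 1)) (.for_ 5 0
    (.cond (.mem 5 (.var 5)) (.store 1 (.var 5) (.const 1)) (.store 1 (.var 5) (.const 0))))) .nop

/-- The output is the set `O`. -/
def Output (n : ℕ) (w : ℕ → ℚ) (O : Finset ℕ) (s : State) : Prop :=
  O ⊆ Finset.range n ∧ s.wvar 0 = ∑ v ∈ O, w v ∧ ∀ v < n, s.arr 1 v = if v ∈ O then 1 else 0

theorem run_updateP (h : Input n H w L M s) (h1 : s.wvar 1 = ∑ v ∈ vset n s 5, w v)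
    {O : Finset ℕ} (hO : Output n w O s) :
    ∃ O', Output n w O' (run updateP s) ∧ (O' = O ∨ O' = vset n s 5) ∧
      ∑ v ∈ O, w v ≤ ∑ v ∈ O', w v ∧ ∑ v ∈ vset n s 5, w v ≤ ∑ v ∈ O', w v := by
  obtain ⟨o1, o2, o3⟩ := hO
  by_cases e : s.wvar 0 < s.wvar 1
  · refine ⟨vset n s 5, ⟨vset_subset, ?_, ?_⟩, Or.inr rfl, ?_, le_rfl⟩
    · rw [updateP, run_cond_pos (by simpa using e), run_seq, (frame_run _ _).wvar 0 (by simp)]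
      simp [run, h1]
    · rw [updateP, run_cond_pos (by simpa using e), run_seq]
      have hin := h.run (p := .wassign 0 (.var 1)) (by simp)
      have key := run_for (x := 5) (y := 0) (s := run (.wassign 0 (.var 1)) s)
        (p := .cond (.mem 5 (.var 5)) (.store 1 (.var 5) (.const 1))
          (.store 1 (.var 5) (.const 0))) (by simp)
        (fun i r => ∀ v < i, r.arr 1 v = if v ∈ vset n s 5 then 1 else 0) (by simp) (by
          rintro i r hi hri hf ih v hv
          rw [hin.size] at hi
          have r5 : r.arr 5 = s.arr 5 := (hf.arr 5 (by simp)).trans rfl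
          have hmem : i ∈ vset n s 5 ↔ 1 ≤ s.arr 5 i := by simp [mem_vset, hi]
          by_cases e : 1 ≤ s.arr 5 i
          · rw [run_cond_pos (by simpa [hri, r5] using e)]
            by_cases ev : v = i
            · simp [run, hri, ev, hmem, e]
            · simp only [run, hri, ev, State.setVar_arr, State.setArr_arr_apply, Expr.eval,
                and_false, if_false]
              exact ih v (by omega)
          · rw [run_cond_neg (by simpa [hri, r5] using e)]
            by_cases ev : v = i
            · simp [run, hri, ev, hmem, e]
            · simp only [run, hri, ev, State.setVar_arr, State.setArr_arr_apply, Expr.eval,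
                and_false, if_false]
              exact ih v (by omega))
      rw [hin.size] at key
      exact key
    · rw [← o2, ← h1]; exact e.le
  · rw [updateP, run_cond_neg (by simpa using e)]
    refine ⟨O, ⟨o1, o2, o3⟩, Or.inl rfl, le_rfl, ?_⟩
    rw [← o2, ← h1]
    exact not_lt.1 e

/-- Find a maximum weight independent set of the remaining bipartite graph and add it to the chosen
vertices. -/
def bipartiteP : FProg :=
  .seq splitP (.seq initFlowP (.seq flowP (.seq levelP collectP)))

theorem run_bipartiteP (h : Input n H w L M s) (hM : 0 < n → (n + 1) ^ 8 < M)
    (hw : ∀ v < n, 0 < w v) (hchains : chains k H (vset n s 4) = ∅) :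
    ∃ C ⊆ vset n s 4, vset n (run bipartiteP s) 5 = vset n s 5 ∪ C ∧
      H.IsIndepSet (C : Set ℕ) ∧
      ∀ T ⊆ vset n s 4, H.IsIndepSet (T : Set ℕ) → ∑ i ∈ T, w i ≤ ∑ i ∈ C, w i := by
  simp only [bipartiteP, run_seq]
  have hsplit := run_splitP h
  have h1 := h.run (p := splitP) (by simp [splitP])
  have f1 := frame_run splitP s
  set s1 := run splitP s
  have h2 := h1.run (p := initFlowP) (by simp [initFlowP])
  have f2 := frame_run initFlowP s1
  have hinit := run_initFlowP h1
  set s2 := run initFlowP s1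
  have h3 := h2.run (p := flowP) (by simpa [flowP] using flowStepP_keepsInput)
  have f3 := frame_run flowP s2
  have e14 : s1.arr 4 = s.arr 4 := f1.arr 4 (by simp [splitP])
  have hwS : ∀ i ∈ vset n s1 4, 0 < w i := fun i hi => hw i (mem_vset.1 hi).1
  have hflow := run_flowP h2 (initFlow_valid hwS hinit.1 hinit.2.1 hinit.2.2) hM
  set s3 := run flowP s2
  have h4 := h3.run (p := levelP) (by simp [levelP])
  have f4 := frame_run levelP s3
  have hlevel := run_levelP h3
  set s4 := run levelP s3
  have e4 : s4.arr 4 = s.arr 4 := by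
    rw [f4.arr 4 (by simp [levelP]), f3.arr 4 (by simp [flowP, flowStepP, findP, pushP]),
      f2.arr 4 (by simp [initFlowP]), e14]
  have e5 : s4.arr 5 = s.arr 5 := by
    rw [f4.arr 5 (by simp [levelP]), f3.arr 5 (by simp [flowP, flowStepP, findP, pushP]),
      f2.arr 5 (by simp [initFlowP]), f1.arr 5 (by simp [splitP])]
  have e12 : s4.var 12 = s1.var 12 := by
    rw [f4.var 12 (by simp [levelP]), f3.var 12 (by simp [flowP, flowStepP, findP, pushP]),
      f2.var 12 (by simp [initFlowP])]
  have e7 : s4.arr 7 = s3.arr 7 := f4.arr 7 (by simp [levelP])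
  have hcol := run_collectP h4
  rw [vset_congr e5, vset_congr e4, e12, e7] at hcol
  rw [vset_congr e14] at hflow hwS
  refine ⟨_, Finset.filter_subset _ _, hcol, ?_⟩
  exact cutSet_isMax (F := flowOf n s3) vset_subset hwS
    (fun u hu v hv huv ha => hsplit.adj hchains hu hv huv ha) hflow.1 hflow.2 hlevel.1 hlevel.2

/-! ### The program: search through all codes -/

/-- Try one code. -/
def tryP (k : ℕ) : FProg :=
  .seq decodeP (.seq (branchP k) (.seq bipartiteP (.seq weighP updateP)))

theorem bipartiteP_keepsInput : bipartiteP.KeepsInput := by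
  simp [bipartiteP, splitP, initFlowP, flowP, flowStepP, findP, pushP, levelP, collectP]

theorem tryP_keepsInput : (tryP k).KeepsInput := by
  obtain ⟨a0, a1, a2, a3, a4, a5, a6⟩ := branchP_keepsInput (k := k)
  obtain ⟨b0, b1, b2, b3, b4, b5, b6⟩ := bipartiteP_keepsInput
  simp [tryP, decodeP, fillP, divP, weighP, updateP, a0, a1, a2, a3, a4, a5, a6, b0, b1, b2, b3, b4,
    b5, b6]

theorem branchP_keepsVar4 : (branchP k).KeepsVar 4 := by
  simp [branchP, fillP, pickP, chooseP, countP_keepsVar]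

theorem tryP_keepsVar4 : (tryP k).KeepsVar 4 := by
  simp [tryP, decodeP, fillP, divP, weighP, updateP, bipartiteP, splitP, initFlowP, flowP,
    flowStepP, findP, pushP, levelP, collectP, branchP_keepsVar4]

/-- An independent set `I` that follows the branch consists of the chosen vertices and an
independent set of the bipartite rest, which the flow computation does not fall short of. Every
code, even one that belongs to no `I`, proposes an independent set, since no remaining vertex is
adjacent to a chosen one. -/
theorem run_tryP (hH : OrderedFree (aakbb k) H) (hn : ∀ u v, H.Adj u v → u < n)
    (h : Input n H w L M s) (hM : 0 < n → (n + 1) ^ 8 < M) (hw : ∀ v < n, 0 < w v) {c : ℕ}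
    (hc : s.var 4 = c) (hcM : c < M) {O : Finset ℕ} (hO : Output n w O s)
    (hOi : H.IsIndepSet (O : Set ℕ)) :
    ∃ O', Output n w O' (run (tryP k) s) ∧ H.IsIndepSet (O' : Set ℕ) ∧
      ∑ v ∈ O, w v ≤ ∑ v ∈ O', w v ∧
      ∀ I ⊆ Finset.range n, H.IsIndepSet (I : Set ℕ) →
        I ⊆ (branch k H n (digitSet n L c) n).2 ∪ (branch k H n (digitSet n L c) n).1 →
        (branch k H n (digitSet n L c) n).2 ⊆ I → ∑ v ∈ I, w v ≤ ∑ v ∈ O', w v := by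
  simp only [tryP, run_seq]
  have hdec := run_decodeP h hc hcM
  have h1 := h.run (p := decodeP) (by simp [decodeP, fillP, divP])
  have f1 := frame_run decodeP s
  set s1 := run decodeP s
  have h2 := h1.run (p := branchP k) branchP_keepsInput
  have f2 := frame_run (branchP k) s1
  have hbr := run_branchP (k := k) h1
  rw [hdec] at hbr
  set s2 := run (branchP k) s1
  obtain ⟨i1, i2, i3, i4, -⟩ := branch_invariant hH hn (digitSet n L c) n
  have hch := chains_branch hH hn (digitSet n L c)
  set B := branch k H n (digitSet n L c) n
  have hB1 : vset n s2 4 = B.1 := congrArg Prod.fst hbr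
  have hB2 : vset n s2 5 = B.2 := congrArg Prod.snd hbr
  obtain ⟨C, hCS, hC5, hCi, hCmax⟩ := run_bipartiteP h2 hM hw (k := k) (by rw [hB1]; exact hch)
  rw [hB1] at hCS hCmax
  rw [hB2] at hC5
  have h3 := h2.run (p := bipartiteP) bipartiteP_keepsInput
  have f3 := frame_run bipartiteP s2
  set s3 := run bipartiteP s2
  have hwt := run_weighP h3
  have h4 := h3.run (p := weighP) (by simp [weighP])
  have f4 := frame_run weighP s3
  set s4 := run weighP s3
  have e5 : s4.arr 5 = s3.arr 5 := f4.arr 5 (by simp [weighP])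
  have e1 : s4.arr 1 = s.arr 1 := by
    rw [f4.arr 1 (by simp [weighP]), f3.arr 1 (by simp [bipartiteP, splitP, initFlowP, flowP,
      flowStepP, findP, pushP, levelP, collectP]), f2.arr 1 (by
      simp [branchP, fillP, pickP, chooseP, countP_keepsArr]),
      f1.arr 1 (by simp [decodeP, fillP, divP])]
  have e0 : s4.wvar 0 = s.wvar 0 := by
    rw [f4.wvar 0 (by simp [weighP]), f3.wvar 0 (by simp [bipartiteP, splitP, initFlowP, flowP,
      flowStepP, findP, pushP, levelP, collectP]), f2.wvar 0 (by
      simp [branchP, fillP, pickP, chooseP, countP_keepsWVar]),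
      f1.wvar 0 (by simp [decodeP, fillP, divP])]
  have hO4 : Output n w O s4 := ⟨hO.1, e0.trans hO.2.1, by rw [e1]; exact hO.2.2⟩
  obtain ⟨O', hO', hor, hle1, hle2⟩ := run_updateP h4 (by rw [vset_congr e5]; exact hwt) hO4
  rw [vset_congr e5, hC5] at hor hle2
  have hdisj : Disjoint B.2 C := Finset.disjoint_left.2 fun a ha haC => (i4 a ha a (hCS haC)).1 rfl
  refine ⟨O', hO', ?_, hle1, fun I hIn hI hI1 hI2 => le_trans ?_ hle2⟩
  · rcases hor with rfl | rfl
    · exact hOi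
    · intro u hu v hv huv
      rcases Finset.mem_union.1 (Finset.mem_coe.1 hu) with hu | hu <;>
        rcases Finset.mem_union.1 (Finset.mem_coe.1 hv) with hv | hv
      · exact i3 hu hv huv
      · exact (i4 u hu v (hCS hv)).2
      · exact fun ha => (i4 v hv u (hCS hu)).2 ha.symm
      · exact hCi hu hv huv
  · rw [Finset.sum_union hdisj, ← Finset.sum_sdiff hI2, add_comm]
    refine add_le_add_right (hCmax (I \ B.2) (fun v hv => ?_) ?_) _
    · obtain ⟨hv1, hv2⟩ := Finset.mem_sdiff.1 hv
      exact (Finset.mem_union.1 (hI1 hv1)).resolve_left hv2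
    · exact hI.mono (by exact_mod_cast Finset.sdiff_subset)

/-- Try all codes. -/
def searchP (k : ℕ) : FProg := .for_ 4 3 (tryP k)

theorem run_searchP (hH : OrderedFree (aakbb k) H) (hn : ∀ u v, H.Adj u v → u < n)
    (h : Input n H w L ((n + 1) ^ L) s) (hM : 0 < n → (n + 1) ^ 8 < (n + 1) ^ L)
    (hw : ∀ v < n, 0 < w v) {j : ℕ} (hj : n ≤ 2 ^ j)
    (hL : (k + 1) * (k + 4) * ((k + 4) * j + 1) ≤ L) (hO : Output n w ∅ s) :
    ∃ O, Output n w O (run (searchP k) s) ∧ H.IsIndepSet (O : Set ℕ) ∧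
      ∀ I ⊆ Finset.range n, H.IsIndepSet (I : Set ℕ) → ∑ v ∈ I, w v ≤ ∑ v ∈ O, w v := by
  have key := run_for (x := 4) (y := 3) (s := s) (p := tryP k) tryP_keepsVar4
    (fun i r => ∃ O, Output n w O r ∧ H.IsIndepSet (O : Set ℕ) ∧
      ∀ c < i, ∀ I ⊆ Finset.range n, H.IsIndepSet (I : Set ℕ) →
        I ⊆ (branch k H n (digitSet n L c) n).2 ∪ (branch k H n (digitSet n L c) n).1 →
        (branch k H n (digitSet n L c) n).2 ⊆ I → ∑ v ∈ I, w v ≤ ∑ v ∈ O, w v)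
    ⟨∅, hO, by simp, by simp⟩ (by
      rintro i r hi hri hf ⟨O, o1, o2, o3⟩
      rw [h.codes] at hi
      have hr := h.of_frame (by simpa using tryP_keepsInput) hf
      obtain ⟨O', p1, p2, p3, p4⟩ := run_tryP hH hn hr hM hw hri hi o1 o2
      refine ⟨O', p1, p2, fun c hc I hIn hI hI1 hI2 => ?_⟩
      rcases Nat.lt_succ_iff_lt_or_eq.1 hc with hc | rfl
      · exact (o3 c hc I hIn hI hI1 hI2).trans p3
      · exact p4 I hIn hI hI1 hI2)
  rw [h.codes] at key
  obtain ⟨O, o1, o2, o3⟩ := key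
  refine ⟨O, o1, o2, fun I hIn hI => ?_⟩
  obtain ⟨c, hc, hc1, hc2⟩ := exists_branch_code hH hn hI hIn hj hL
  exact o3 c hc I hIn hI hc1 hc2

end RAM

namespace RAM
open FProg

/-! ### The program: parameters -/

variable {n k : ℕ} {s : State}

/-- Compute the number of digits `a + b * ⌈log₂ n⌉`. -/
def digitsP (a b : ℕ) : FProg :=
  .seq (.assign 1 (.add (.var 0) (.const 1))) (.seq (.assign 16 (.const 1)) (.seq
    (.assign 2 (.const a)) (.for_ 5 0 (.cond (.lt (.var 16) (.var 0))
      (.seq (.assign 16 (.add (.var 16) (.var 16))) (.assign 2 (.add (.var 2) (.const b)))) .nop))))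

/-- Variable `16` is doubled until it reaches `n`, and `n` rounds suffice as `n ≤ 2 ^ n`. The bound
`n ≤ 2 ^ j` serves correctness and `2 ^ (j - 1) < n` the running time. -/
theorem run_digitsP {a b : ℕ} (hn : s.var 0 = n) :
    (run (digitsP a b) s).var 1 = n + 1 ∧ ∃ j, n ≤ 2 ^ j ∧ (j = 0 ∨ 2 ^ (j - 1) < n) ∧
      (run (digitsP a b) s).var 2 = a + b * j := by
  simp only [digitsP, run_seq]
  set s1 := run (.assign 2 (.const a)) (run (.assign 16 (.const 1))
    (run (.assign 1 (.add (.var 0) (.const 1))) s)) with hs1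
  have h0 : s1.var 0 = n := by simp [hs1, run, hn]
  have key := run_for (x := 5) (y := 0) (s := s1) (p := .cond (.lt (.var 16) (.var 0))
      (.seq (.assign 16 (.add (.var 16) (.var 16))) (.assign 2 (.add (.var 2) (.const b)))) .nop)
    (by simp)
    (fun i r => ∃ j, r.var 16 = 2 ^ j ∧ (j = 0 ∨ 2 ^ (j - 1) < n) ∧ r.var 2 = a + b * j ∧
      (2 ^ j < n → j = i))
    ⟨0, by simp [hs1, run]⟩ (by
      rintro i r - - hf ⟨j, j1, j2, j3, j4⟩
      have r0 : r.var 0 = n := (hf.var 0 (by simp)).trans h0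
      by_cases e : 2 ^ j < n
      · rw [run_cond_pos (by simpa [j1, r0] using e)]
        refine ⟨j + 1, ?_, Or.inr (by simpa using e), ?_, fun _ => by rw [j4 e]⟩
        · simp [run, j1, pow_succ]; ring
        · simp [run, j3]; ring
      · rw [run_cond_neg (by simpa [j1, r0] using e)]
        exact ⟨j, by simpa [run] using j1, j2, by simpa [run] using j3, fun h => absurd h e⟩)
  rw [h0] at key
  refine ⟨?_, ?_⟩
  · rw [(frame_run _ _).var 1 (by simp)]
    simp [hs1, run, hn]
  · obtain ⟨j, -, j2, j3, j4⟩ := key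
    refine ⟨j, ?_, j2, j3⟩
    by_contra! hlt
    have := j4 hlt
    subst this
    exact absurd hlt (not_lt.2 Nat.lt_two_pow_self.le)

/-- Compute the row offsets. -/
def rowsP : FProg :=
  .seq (.assign 9 (.const 0)) (.for_ 5 1
    (.seq (.store 2 (.var 5) (.var 9)) (.assign 9 (.add (.var 9) (.var 0)))))

theorem run_rowsP (hn : s.var 0 = n) (h1 : s.var 1 = n + 1) :
    ∀ i ≤ n, (run rowsP s).arr 2 i = i * n := by
  have key := run_for (x := 5) (y := 1) (s := run (.assign 9 (.const 0)) s)
    (p := .seq (.store 2 (.var 5) (.var 9)) (.assign 9 (.add (.var 9) (.var 0)))) (by simp)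
    (fun i r => r.var 9 = i * n ∧ ∀ u < i, r.arr 2 u = u * n) (by simp [run]) (by
      rintro i r - hri hf ⟨i1, i2⟩
      have r0 : r.var 0 = n := (hf.var 0 (by simp)).trans (by simp [run, hn])
      refine ⟨by simp [run, i1, r0, Nat.add_mul], fun u hu => ?_⟩
      by_cases e : u = i
      · simp [run, hri, e, i1]
      · simpa [run, hri, e] using i2 u (by omega))
  rw [show (run (.assign 9 (.const 0)) s).var 1 = n + 1 by simp [run, h1]] at key
  exact fun i hi => key.2 i (by omega)

/-- Compute the number of codes. -/
def powerP : FProg :=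
  .seq (.assign 3 (.const 1)) (.for_ 5 2 (.seq (.assign 9 (.const 0))
    (.seq (.for_ 6 1 (.assign 9 (.add (.var 9) (.var 3)))) (.assign 3 (.var 9)))))

theorem run_powerP {L : ℕ} (h1 : s.var 1 = n + 1) (h2 : s.var 2 = L) :
    (run powerP s).var 3 = (n + 1) ^ L := by
  have key := run_for (x := 5) (y := 2) (s := run (.assign 3 (.const 1)) s)
    (p := .seq (.assign 9 (.const 0))
    (.seq (.for_ 6 1 (.assign 9 (.add (.var 9) (.var 3)))) (.assign 3 (.var 9)))) (by simp)
    (fun i r => r.var 3 = (n + 1) ^ i) (by simp [run]) (by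
      rintro i r - - hf ih
      have r1 : r.var 1 = n + 1 := (hf.var 1 (by simp)).trans (by simp [run, h1])
      have key2 := run_for (x := 6) (y := 1) (s := run (.assign 9 (.const 0)) r)
        (p := .assign 9 (.add (.var 9) (.var 3))) (by simp)
        (fun j q => q.var 9 = j * (n + 1) ^ i) (by simp [run]) (by
          rintro j q - - hf' ih'
          have q3 : q.var 3 = (n + 1) ^ i := (hf'.var 3 (by simp)).trans (by simp [run, ih])
          simp [run, q3, ih', Nat.add_mul])
      rw [show (run (.assign 9 (.const 0)) r).var 1 = n + 1 by simp [run, r1]] at key2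
      rw [run_seq, run_seq]
      simp only [State.setVar_var]
      norm_num
      rw [run, State.setVar_var, if_pos rfl, Expr.eval, key2, pow_succ'])
  rw [show (run (.assign 3 (.const 1)) s).var 2 = L by simp [run, h2]] at key
  exact key

/-- The whole program. -/
def solveP (k : ℕ) : FProg :=
  .seq (digitsP ((k + 1) * (k + 4) + 9) ((k + 1) * (k + 4) * (k + 4)))
    (.seq (.seq rowsP powerP) (searchP k))

/-! ### Running time -/

theorem tupleLoop_counted {B : Set ℕ} {p : FProg} (hp : p.Counted B) (h0 : 0 ∈ B)
    (hB : ∀ z ∈ B, z < 20) (hkeep : ∀ z, 20 ≤ z → p.KeepsVar z) (m : ℕ) :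
    (tupleLoop p m).Counted B := by
  induction m with
  | zero => exact hp
  | succ m ih =>
    exact ⟨fun h => absurd (hB _ h) (by omega), h0,
      tupleLoop_keepsVar (hkeep _ (by omega)) (Or.inr le_rfl), ih⟩

theorem searchP_counted (k : ℕ) : (searchP k).Counted {0, 1, 2, 3} := by
  refine ⟨by simp, by simp, tryP_keepsVar4, ?_⟩
  have hcount : (countP k).Counted {0, 1, 2, 3} :=
    ⟨by simp, by simp, ⟨trivial, tupleLoop_keepsVar (by simp [tallyP]) (Or.inl (by norm_num))⟩,
      trivial, tupleLoop_counted (by simp [tallyP, Counted]) (by simp) (by simp) (by simp [tallyP]) _⟩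
  simp [tryP, decodeP, fillP, divP, weighP, updateP, bipartiteP, splitP, initFlowP, flowP,
    flowStepP, findP, pushP, levelP, collectP, branchP, pickP, chooseP, Counted, hcount,
    countP_keepsVar]

/-- Variables `1`, `2`, `3` are computed before they become loop bounds, so the stages are timed
separately, with growing sets of bound variables. The common bound `(n + 2) ^ L` dominates `n`, `n +
1`, `L` and `(n + 1) ^ L`. -/
theorem exec_solveP (k : ℕ) (hn : s.var 0 = n) {L : ℕ} (hL0 : 1 ≤ L)
    (hL : (run (digitsP ((k + 1) * (k + 4) + 9) ((k + 1) * (k + 4) * (k + 4))) s).var 2 = L) :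
    ∃ t ≤ (solveP k).time ((n + 2) ^ L), Exec (solveP k).compile s t (run (solveP k) s) := by
  set a := (k + 1) * (k + 4) + 9
  set b := (k + 1) * (k + 4) * (k + 4)
  have hn2 : n + 2 ≤ (n + 2) ^ L := Nat.le_self_pow (by omega) _
  have hL2 : L ≤ (n + 2) ^ L := Nat.lt_two_pow_self.le.trans (Nat.pow_le_pow_left (by omega) _)
  have hM2 : (n + 1) ^ L ≤ (n + 2) ^ L := Nat.pow_le_pow_left (by omega) _
  have hn1 := (run_digitsP (a := a) (b := b) hn).1
  have hn0 : (run (digitsP a b) s).var 0 = n := by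
    rw [(frame_run _ _).var 0 (by simp [digitsP]), hn]
  obtain ⟨t1, ht1, e1⟩ := exec_compile (B := {0}) (K := (n + 2) ^ L) (p := digitsP a b)
    (by simp [digitsP, Counted]) (s := s) (by simp [hn]; omega)
  have f2 := frame_run (.seq rowsP powerP) (run (digitsP a b) s)
  obtain ⟨t2, ht2, e2⟩ := exec_compile (B := {0, 1, 2}) (K := (n + 2) ^ L) (p := .seq rowsP powerP)
    (by simp [rowsP, powerP, Counted]) (s := run (digitsP a b) s) (by
      simp only [Set.mem_insert_iff, Set.mem_singleton_iff, forall_eq_or_imp, forall_eq, hn0, hn1,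
        hL]
      omega)
  obtain ⟨t3, ht3, e3⟩ := exec_compile (K := (n + 2) ^ L) (searchP_counted k)
    (s := run (.seq rowsP powerP) (run (digitsP a b) s)) (by
      have h3 : (run (.seq rowsP powerP) (run (digitsP a b) s)).var 3 = (n + 1) ^ L := by
        rw [run_seq]
        refine run_powerP ?_ ?_
        · rw [(frame_run _ _).var 1 (by simp [rowsP]), hn1]
        · rw [(frame_run _ _).var 2 (by simp [rowsP]), hL]
      simp only [Set.mem_insert_iff, Set.mem_singleton_iff, forall_eq_or_imp, forall_eq,
        f2.var 0 (by simp [rowsP, powerP]), f2.var 1 (by simp [rowsP, powerP]),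
        f2.var 2 (by simp [rowsP, powerP]), hn0, hn1, hL, h3]
      omega)
  refine ⟨_, Nat.add_le_add ht1 (Nat.add_le_add ht2 ht3), .seq e1 (.seq e2 e3)⟩

/-! ### Correctness -/

/-- A graph on `Fin n` as a graph on the natural numbers. -/
def natGraph {n : ℕ} (G : SimpleGraph (Fin n)) : SimpleGraph ℕ where
  Adj u v := ∃ a b : Fin n, G.Adj a b ∧ (a : ℕ) = u ∧ (b : ℕ) = v
  symm := ⟨fun _ _ ⟨a, b, h, e1, e2⟩ => ⟨b, a, h.symm, e2, e1⟩⟩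
  loopless := ⟨fun _ ⟨_, _, h, e1, e2⟩ => h.ne (Fin.ext (e1.trans e2.symm))⟩

theorem natGraph_adj {G : SimpleGraph (Fin n)} {u v : ℕ} :
    (natGraph G).Adj u v ↔ ∃ a b : Fin n, G.Adj a b ∧ (a : ℕ) = u ∧ (b : ℕ) = v := Iff.rfl

theorem natGraph_adj_val {G : SimpleGraph (Fin n)} {a b : Fin n} :
    (natGraph G).Adj a b ↔ G.Adj a b := by
  rw [natGraph_adj]
  constructor
  · rintro ⟨a', b', h, e1, e2⟩
    rwa [← Fin.ext e1, ← Fin.ext e2]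
  · exact fun h => ⟨a, b, h, rfl, rfl⟩

theorem natGraph_lt {G : SimpleGraph (Fin n)} (u v : ℕ) (h : (natGraph G).Adj u v) : u < n := by
  obtain ⟨a, b, -, rfl, -⟩ := natGraph_adj.1 h
  exact a.2

/-- The last vertex of a copy of `aa(k)bb` is in an edge, hence is less than `n`, and the other
vertices precede it; so no isolated vertex of the copy lies outside `G`. -/
theorem orderedFree_natGraph {G : SimpleGraph (Fin n)} (hG : OrderedFree (aakbb k) G) :
    OrderedFree (aakbb k) (natGraph G) := by
  rintro ⟨f, hf⟩
  have hlast : f ⟨k + 3, by omega⟩ < n := by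
    refine natGraph_lt _ (f ⟨k + 2, by omega⟩) (f.map_adj_iff.2 ?_)
    rw [aakbb_adj]
    simp
  have hlt : ∀ i, f i < n := fun i =>
    (hf.monotone (Fin.le_def.2 (by have := i.2; simp only; omega))).trans_lt hlast
  refine hG ⟨⟨⟨fun i => ⟨f i, hlt i⟩, fun i j h => f.injective (congrArg Fin.val h)⟩, ?_⟩,
    fun i j hij => hf hij⟩
  intro i j
  rw [← f.map_adj_iff, ← natGraph_adj_val]
  rfl

/-- Weights on `Fin n` as weights on the natural numbers. -/
def natWeight {n : ℕ} (w : Fin n → ℚ) (i : ℕ) : ℚ := if h : i < n then w ⟨i, h⟩ else 0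

theorem natWeight_val {w : Fin n → ℚ} (v : Fin n) : natWeight w v = w v := by
  simp [natWeight]

/-- No bound on `i` is needed: beyond the matrix the array holds zeros, so row `n` correctly shows
an isolated vertex. -/
theorem inputState_adj {G : SimpleGraph (Fin n)} {w : Fin n → ℚ} {i j : ℕ} (hj : j < n) :
    1 ≤ (inputState n G w).arr 0 (i * n + j) ↔ (natGraph G).Adj i j := by
  have : (∃ a b : Fin n, G.Adj a b ∧ i * n + j = (a : ℕ) * n + (b : ℕ)) ↔
      (natGraph G).Adj i j := by
    rw [natGraph_adj]
    refine exists_congr fun a => exists_congr fun b => and_congr Iff.rfl ?_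
    rw [rowcol_inj hj b.2]
    exact and_congr eq_comm eq_comm
  rw [← this]
  simp only [inputState, true_and]
  split_ifs with h
  · exact iff_of_true le_rfl h.2
  · exact iff_of_false (by omega) fun h' => h ⟨rfl, h'⟩

theorem run_solveP {G : SimpleGraph (Fin n)} {w : Fin n → ℚ} (hG : OrderedFree (aakbb k) G)
    (hw : ∀ v, 0 < w v) : ∃ S : Finset (Fin n),
      IsOutput (run (solveP k) (inputState n G w)) S ∧ IsMaxWeightIndepSet G w S := by
  classical
  set s := inputState n G w with hs
  set a := (k + 1) * (k + 4) + 9 with ha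
  set b := (k + 1) * (k + 4) * (k + 4) with hb
  obtain ⟨hn1, j, hj, -, hL⟩ := run_digitsP (a := a) (b := b) (s := s) (n := n) (by simp [hs, inputState])
  set L := a + b * j with hLdef
  set s1 := run (digitsP a b) s with hs1
  set s2 := run rowsP s1 with hs2
  set s3 := run powerP s2 with hs3
  have f1 := frame_run (digitsP a b) s
  have f2 := frame_run rowsP s1
  have f3 := frame_run powerP s2
  have h0 : s1.var 0 = n := by rw [f1.var 0 (by simp [digitsP])]; simp [hs, inputState]
  have hin : Input n (natGraph G) (natWeight w) L ((n + 1) ^ L) s3 := by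
    refine ⟨?_, ?_, ?_, ?_, ?_, fun i _ j hj => ?_, fun i hi => ?_⟩
    · rw [f3.var 0 (by simp [powerP]), f2.var 0 (by simp [rowsP]), h0]
    · rw [f3.var 1 (by simp [powerP]), f2.var 1 (by simp [rowsP]), hn1]
    · rw [f3.var 2 (by simp [powerP]), f2.var 2 (by simp [rowsP]), hL]
    · refine run_powerP ?_ ?_
      · rw [f2.var 1 (by simp [rowsP]), hn1]
      · rw [f2.var 2 (by simp [rowsP]), hL]
    · rw [f3.arr 2 (by simp [powerP])]
      exact run_rowsP h0 hn1
    · rw [f3.arr 0 (by simp [powerP]), f2.arr 0 (by simp [rowsP]), f1.arr 0 (by simp [digitsP])]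
      exact inputState_adj hj
    · rw [f3.warr 0 (by simp [powerP]), f2.warr 0 (by simp [rowsP]), f1.warr 0 (by simp [digitsP])]
      simp [hs, inputState, natWeight, hi]
  have hO : Output n (natWeight w) ∅ s3 := by
    refine ⟨by simp, ?_, fun v _ => ?_⟩
    · rw [f3.wvar 0 (by simp [powerP]), f2.wvar 0 (by simp [rowsP]), f1.wvar 0 (by simp [digitsP])]
      simp [hs, inputState]
    · rw [f3.arr 1 (by simp [powerP]), f2.arr 1 (by simp [rowsP]), f1.arr 1 (by simp [digitsP])]
      simp [hs, inputState]
  obtain ⟨O, ⟨o1, -, o3⟩, oi, omax⟩ := run_searchP (orderedFree_natGraph hG) natGraph_lt hin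
    -- The summand 9 in `a` makes `L ≥ 9`, so that the flow loop has more than `(n + 1) ^ 8` rounds.
    (fun hn => Nat.pow_lt_pow_right (by omega) (by omega))
    (fun v hv => by rw [natWeight, dif_pos hv]; exact hw _) hj
    (by rw [hLdef, ha, hb, mul_add, mul_one, ← mul_assoc]; omega) hO
  have hsum : ∀ T : Finset (Fin n), ∑ v ∈ T.map Fin.valEmbedding, natWeight w v = ∑ v ∈ T, w v :=
    fun T => by simp [Finset.sum_map, natWeight_val]
  have hind : ∀ T : Finset (Fin n), (natGraph G).IsIndepSet (T.map Fin.valEmbedding : Set ℕ) ↔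
      G.IsIndepSet (T : Set (Fin n)) := by
    intro T
    constructor
    · intro h u hu v hv huv
      rw [← natGraph_adj_val]
      exact h (Finset.mem_coe.2 (Finset.mem_map_of_mem Fin.valEmbedding hu))
        (Finset.mem_coe.2 (Finset.mem_map_of_mem Fin.valEmbedding hv)) (fun e => huv (Fin.ext e))
    · intro h u hu v hv huv
      obtain ⟨u, hu', rfl⟩ := Finset.mem_map.1 (Finset.mem_coe.1 hu)
      obtain ⟨v, hv', rfl⟩ := Finset.mem_map.1 (Finset.mem_coe.1 hv)
      exact fun hadj => h hu' hv' (fun e => huv (congrArg _ e)) (natGraph_adj_val.1 hadj)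
  have hOS : (Finset.univ.filter fun v : Fin n => (v : ℕ) ∈ O).map Fin.valEmbedding = O := by
    ext v
    simp only [Finset.mem_map, Finset.mem_filter, Finset.mem_univ, true_and,
      Fin.valEmbedding_apply]
    constructor
    · rintro ⟨v, h, rfl⟩; exact h
    · exact fun h => ⟨⟨v, Finset.mem_range.1 (o1 h)⟩, h, rfl⟩
  refine ⟨Finset.univ.filter fun v : Fin n => (v : ℕ) ∈ O, fun v => ?_, ?_, fun T hT => ?_⟩
  · rw [show run (solveP k) s = run (searchP k) s3 from rfl, o3 v v.2]
    simp
  · rw [← hind, hOS]; exact oi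
  · rw [← hsum, ← hsum, hOS]
    refine omax _ (fun v hv => ?_) ((hind T).2 hT)
    obtain ⟨v, -, rfl⟩ := Finset.mem_map.1 hv
    exact Finset.mem_range.2 v.2

/-- With `N = max n 2`, the base is at most `N ^ 2` and `j ≤ log₂ N + 1 ≤ 2 log₂ N`, so the exponent
is already linear in `log₂ N`; it is bounded by the square because `log₂ N ≥ 1`. -/
theorem pow_digits_le {n j a b e : ℕ} (hj : j = 0 ∨ 2 ^ (j - 1) < n) :
    (((n + 2) ^ (a + b * j)) ^ e : ℝ) ≤
      (max n 2 : ℝ) ^ ((2 * (a + 2 * b) * e : ℝ) * Real.logb 2 (max n 2 : ℝ) ^ 2) := by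
  set N : ℝ := max n 2 with hN
  have hN2 : (2 : ℝ) ≤ N := le_max_right _ _
  have hl : 1 ≤ Real.logb 2 N := by
    rw [Real.le_logb_iff_rpow_le (by norm_num) (by linarith)]
    simpa using hN2
  have hjl : (j : ℝ) ≤ 2 * Real.logb 2 N := by
    rcases hj with rfl | hj
    · simp only [Nat.cast_zero]; linarith
    · have h1 : ((j - 1 : ℕ) : ℝ) ≤ Real.logb 2 N := by
        rw [Real.le_logb_iff_rpow_le (by norm_num) (by linarith), Real.rpow_natCast]
        exact le_trans (by exact_mod_cast hj.le) (le_max_left _ _)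
      have h2 : (j : ℝ) ≤ ((j - 1 : ℕ) : ℝ) + 1 := by exact_mod_cast (by omega : j ≤ j - 1 + 1)
      linarith
  have hbase : ((n : ℝ) + 2) ≤ N ^ 2 := by
    have : (n : ℝ) ≤ N := le_max_left _ _
    nlinarith
  set l := Real.logb 2 N
  calc (((n : ℝ) + 2) ^ (a + b * j)) ^ e ≤ ((N ^ 2) ^ (a + b * j)) ^ e :=
        pow_le_pow_left₀ (by positivity) (pow_le_pow_left₀ (by positivity) hbase _) _
    _ = N ^ ((2 * (a + b * j) * e : ℕ) : ℝ) := by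
        rw [Real.rpow_natCast, ← pow_mul, ← pow_mul, mul_assoc]
    _ ≤ N ^ ((2 * (a + 2 * b) * e : ℝ) * l ^ 2) := by
        refine Real.rpow_le_rpow_of_exponent_le (by linarith) ?_
        push_cast
        have h1 : (a : ℝ) + b * j ≤ (a + 2 * b) * l ^ 2 := by
          have ha : (0 : ℝ) ≤ a := Nat.cast_nonneg a
          have hb : (0 : ℝ) ≤ b := Nat.cast_nonneg b
          have hl2 : l ≤ l ^ 2 := by nlinarith
          have h3 : (b : ℝ) * j ≤ b * (2 * l ^ 2) :=
            mul_le_mul_of_nonneg_left (by linarith) hb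
          have h4 : (a : ℝ) * 1 ≤ a * l ^ 2 := mul_le_mul_of_nonneg_left (by linarith) ha
          linarith
        calc (2 : ℝ) * (a + b * j) * e = 2 * e * (a + b * j) := by ring
          _ ≤ 2 * e * ((a + 2 * b) * l ^ 2) := mul_le_mul_of_nonneg_left h1 (by positivity)
          _ = _ := by ring

end RAM

theorem mainTheorem3 (k : ℕ) :
    ∃ (p : RAM.Program) (C : ℝ),
      SolvesMWISInTime p (fun _ G => OrderedFree (aakbb k) G)
        (fun n => (max n 2 : ℝ) ^ (C * (Real.logb 2 (max n 2 : ℝ)) ^ 2)) := by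
  obtain ⟨e, he⟩ := RAM.FProg.exists_time_le (RAM.solveP k)
  set a := (k + 1) * (k + 4) + 9 with ha
  set b := (k + 1) * (k + 4) * (k + 4) with hb
  refine ⟨(RAM.solveP k).compile, 2 * (a + 2 * b) * e, fun n G w hG hw => ?_⟩
  obtain ⟨S, hS, hmax⟩ := RAM.run_solveP hG hw
  have hn : (RAM.inputState n G w).var 0 = n := by simp [RAM.inputState]
  obtain ⟨-, j, -, hj, hL⟩ := RAM.run_digitsP (a := a) (b := b) hn
  obtain ⟨t, ht, hexec⟩ := RAM.exec_solveP k hn (L := a + b * j) (by omega) hL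
  refine ⟨t, _, S, hexec, ?_, hS, hmax⟩
  have h2 : 2 ≤ (n + 2) ^ (a + b * j) :=
    (by omega : 2 ≤ n + 2).trans (Nat.le_self_pow (by omega) _)
  refine le_trans ?_ (RAM.pow_digits_le hj)
  exact_mod_cast ht.trans (he _ h2)
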